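/- Let $\mathbb S^2=\{x\in\mathbb R^3:|x|=1\}$ and let $E\subset\mathbb S^2$ be compact (for instance $E=\mathbb S^2$). Let $Q$ be a function on $\mathbb S^2$ with values in $[0,\infty]$ that is lower semicontinuous on $E$, finite on a subset of $E$ of positive surface measure, and, on $E$, invariant under rotations about the polar axis (i.e. $Q(x)$, $x\in E$, depends only on $x_3$). For a Borel probability measure $\mu$ supported on $E$ put $$I_Q(\mu)=\iint\frac{1}{|x-y|}\,d\mu(x)\,d\mu(y)+2\int Q\,d\mu ,\qquad V_Q=\inf_\mu I_Q(\mu),$$ the infimum being over all such $\mu$. Let $\mu_Q$ be a Borel probability measure supported on $E$ with $I_Q(\mu_Q)=V_Q$ (the equilibrium measure), let $S_Q=\operatorname{supp}\mu_Q$, and let $F_Q=V_Q-\int Q\,d\mu_Q$. Suppose that $Q\in C^2(N)$ for some open neighborhood $N$ of $S_Q$ in $\mathbb S^2$, and that $S_Q$ is the spherical cap $C_{N,\alpha}=\{(\sin\varphi\cos\theta,\sin\varphi\sin\theta,\cos\varphi):0\le\varphi\le\alpha,\ 0\le\theta\le2\pi\}$ for some $0<\alpha\le\pi$. Write $Q(\varphi)$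 for the value of $Q$ at the points of polar angle $\varphi$, and for $0<t<\alpha$ and $0<\varphi<\alpha$ let $$g(t)=\frac1{4\pi}\frac{d}{dt}\int_0^t\frac{Q(\xi)\sin\xi\,d\xi}{\sqrt{\cos\xi-\cos t}},\qquad F(\varphi)=\frac2\pi\,\frac1{\sin\varphi}\,\frac{d}{d\varphi}\int_\varphi^\alpha\frac{g(t)\sin t\,dt}{\sqrt{\cos\varphi-\cos t}} .$$ Then $V_Q$ and $\int Q\,d\mu_Q$ are finite, these integrals converge and are differentiable at every point of $(0,\alpha)$, $F(\varphi)\sin\varphi$ is integrable on $(0,\alpha)$, the measure $\mu_Q$ is given by $d\mu_Q=f(\varphi)\sin\varphi\,d\theta\,d\varphi$ on $C_{N,\alpha}$ with $$f(\varphi)=\frac{F_Q}{4\pi}\left\{1+\frac2\pi\left[\sqrt{\frac{1+\cos\alpha}{\cos\varphi-\cos\alpha}}-\arctan\sqrt{\frac{1+\cos\alpha}{\cos\varphi-\cos\alpha}}\,\right]\right\}+F(\varphi)\ \ge 0,\qquad 0<\varphi<\alpha,$$ and the constant $F_Q$ equals $$F_Q=\frac{\pi}{\sin\alpha+\alpha}\left\{1-2\pi\int_0^\alpha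 F(\varphi)\sin\varphi\,d\varphi\right\}.$$ -/

import Mathlib

open Real Set MeasureTheory
open scoped ENNReal Manifold

noncomputable section

namespace SphereEnergy

/-- The unit sphere of the Euclidean space `ℝ³`. Its distance is the chordal (Euclidean) one. -/
abbrev S2 : Type := Metric.sphere (0 : EuclideanSpace ℝ (Fin 3)) 1

/-- The point of the sphere with azimuth `θ` and polar angle `φ` (measured from the North Pole). -/
def sph (θ φ : ℝ) : S2 :=
  ⟨!₂[sin φ * cos θ, sin φ * sin θ, cos φ], by
    rw [mem_sphere_zero_iff_norm, EuclideanSpace.norm_eq, Real.sqrt_eq_one]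
    simp only [Fin.sum_univ_three, Real.norm_eq_abs, sq_abs]
    simp only [Matrix.cons_val_zero, Matrix.cons_val_one, Matrix.cons_val]
    have h1 := sin_sq_add_cos_sq φ
    have h2 := sin_sq_add_cos_sq θ
    linear_combination h1 + (sin φ) ^ 2 * h2⟩

theorem continuous_sph : Continuous (fun p : ℝ × ℝ => sph p.1 p.2) := by
  refine Continuous.subtype_mk ?_ _
  refine (PiLp.continuous_toLp 2 _).comp (continuous_pi fun i => ?_)
  fin_cases i <;> simp <;> fun_prop

/-- The closed spherical cap centred at the North Pole with opening angle `α`. -/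
def northCap (α : ℝ) : Set S2 :=
  (fun p : ℝ × ℝ => sph p.1 p.2) '' (Icc 0 (2 * π) ×ˢ Icc 0 α)

/-- Lebesgue surface measure on the sphere (total mass `4π`). -/
def surfaceMeasure : Measure S2 := (volume : Measure (EuclideanSpace ℝ (Fin 3))).toSphere

/-- Unit positive Borel measures supported on `E`. -/
def unitMeasures (E : Set S2) : Set (Measure S2) :=
  {μ | IsProbabilityMeasure μ ∧ μ.support ⊆ E}

/-- The Newtonian energy `∬ 1 / |x - y| dμ(x) dμ(y)`; the kernel is `∞` on the diagonal. -/
def energy (μ : Measure S2) : ℝ≥0∞ := ∫⁻ x, ∫⁻ y, (edist x y)⁻¹ ∂μ ∂μ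

/-- The weighted energy `I(μ) + 2 ∫ Q dμ`. -/
def weightedEnergy (Q : S2 → ℝ≥0∞) (μ : Measure S2) : ℝ≥0∞ :=
  energy μ + 2 * ∫⁻ x, Q x ∂μ

/-- The minimal weighted energy `V_Q` over the unit measures supported on `E`. -/
def minEnergy (E : Set S2) (Q : S2 → ℝ≥0∞) : ℝ≥0∞ :=
  ⨅ μ ∈ unitMeasures E, weightedEnergy Q μ

/-- `Q` is an external field on `E`: lower semicontinuous with values in `[0, ∞]`, and finite on a
set of positive surface measure. -/
structure IsExternalField (E : Set S2) (Q : S2 → ℝ≥0∞) : Prop where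
  lsc : LowerSemicontinuousOn Q E
  finite_pos : 0 < surfaceMeasure {x | x ∈ E ∧ Q x < ⊤}

/-- `Q` depends on `E` only on the third coordinate: it is invariant under rotations about the
polar axis. -/
def RotInvariant (E : Set S2) (Q : S2 → ℝ≥0∞) : Prop :=
  ∀ x ∈ E, ∀ y ∈ E, x.1 2 = y.1 2 → Q x = Q y

/-- `Q` is a (finite) twice continuously differentiable function on the subset `N` of the smooth
manifold `S²`. -/
def IsC2On (Q : S2 → ℝ≥0∞) (N : Set S2) : Prop :=
  (∀ x ∈ N, Q x < ⊤) ∧ ContMDiffOn (𝓡 2) 𝓘(ℝ, ℝ) 2 (fun x => (Q x).toReal) N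

/-- `μ` is an extremal measure for `Q` on `E`. -/
def IsExtremal (E : Set S2) (Q : S2 → ℝ≥0∞) (μ : Measure S2) : Prop :=
  μ ∈ unitMeasures E ∧ weightedEnergy Q μ = minEnergy E Q

/-- The constant `F_Q = V_Q - ∫ Q dμ_Q`. -/
def robin (E : Set S2) (Q : S2 → ℝ≥0∞) (μ : Measure S2) : ℝ :=
  (minEnergy E Q).toReal - (∫⁻ x, Q x ∂μ).toReal

/-- A rotationally invariant field as a function of the polar angle. -/
def profile (Q : S2 → ℝ≥0∞) (ξ : ℝ) : ℝ := (Q (sph 0 ξ)).toReal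

/-- The integrand of the inner Abel integral. -/
def gIntegrand (Q : S2 → ℝ≥0∞) (t ξ : ℝ) : ℝ :=
  profile Q ξ * sin ξ / √(cos ξ - cos t)

/-- The inner Abel integral `∫₀ᵗ Q(ξ) sin ξ / √(cos ξ - cos t) dξ`. -/
def gIntegral (Q : S2 → ℝ≥0∞) (t : ℝ) : ℝ := ∫ ξ in (0 : ℝ)..t, gIntegrand Q t ξ

/-- The auxiliary function `g`. -/
def gFun (Q : S2 → ℝ≥0∞) (t : ℝ) : ℝ := 1 / (4 * π) * deriv (gIntegral Q) t

/-- The integrand of the outer Abel integral. -/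
def FIntegrand (Q : S2 → ℝ≥0∞) (φ t : ℝ) : ℝ :=
  gFun Q t * sin t / √(cos φ - cos t)

/-- The outer Abel integral `∫_φ^α g(t) sin t / √(cos φ - cos t) dt`. -/
def FIntegral (Q : S2 → ℝ≥0∞) (α φ : ℝ) : ℝ := ∫ t in φ..α, FIntegrand Q φ t

/-- The auxiliary function `F`. -/
def FFun (Q : S2 → ℝ≥0∞) (α φ : ℝ) : ℝ :=
  2 / π * (1 / sin φ) * deriv (FIntegral Q α) φ

/-- The density formula with constant `c` in place of `F_Q`. -/
def densityFormula (Q : S2 → ℝ≥0∞) (α c φ : ℝ) : ℝ :=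
  c / (4 * π) *
      (1 + 2 / π * (√((1 + cos α) / (cos φ - cos α))
        - arctan √((1 + cos α) / (cos φ - cos α))))
    + FFun Q α φ

/-- The measure `f(φ) sin φ dθ dφ` on the cap `0 ≤ φ ≤ α`, for a function `f` that is non-negative
on `(0, α)`. -/
def capMeasure (α : ℝ) (f : ℝ → ℝ) : Measure S2 :=
  Measure.map (fun p : ℝ × ℝ => sph p.1 p.2)
    ((volume.restrict (Ioo 0 (2 * π) ×ˢ Ioo 0 α)).withDensity
      fun p => ENNReal.ofReal (f p.2 * sin p.2))

end SphereEnergy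

end

/-!
The equilibrium condition on the cap is an integral equation in the polar angle that two successive
Abel inversions solve.

*Symmetry.* The Newtonian kernel is a positive mixture of Gaussians, so it is strictly positive
definite (`eq_of_energy_le`). Hence the extremal measure `μ` is invariant under rotations about the
polar axis (`map_rot_eq_of_isExtremal`), and it is the measure of revolution of a law `M` of the
polar angle (`eq_revolve_of_rot_invariant`).

*Equilibrium condition.* Varying `μ` gives `U^μ + Q ≥ F` off a set that measures of finite energy do
not charge (`measure_potential_lt_eq_zero`), where `F = I(μ) + ∫ Q dμ` is the constant `F_Q`. Equality
holds `μ`-almost everywhere, and lower semicontinuity of the potential gives `U^μ + Q ≤ F` on the whole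
support (`potential_add_le_of_mem_support`). In particular the potential is finite on the cap, so `M`
has no atoms. As the surface measure of the cap has finite energy (`energy_revolve_capLaw`),
`U^μ + Q = F` for almost every polar angle in `(0, α)` (`exists_polar_law`).

*Inversion.* The mean of `1 / |x - y|` over a parallel is a complete elliptic integral, and by Landen's
transformation it is the composition of two Abel kernels (`lintegral_inv_edist`). With the Abel
transform `S(t) = ∫_{φ > t} dM(φ) / √(cos t - cos φ)`, the equilibrium condition becomes an Abel
equation for `S`, with the solution `S(t) = F √(1 + cos t) - 4 π g(t)` (`toReal_abelTransform_eq`), and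
a second inversion gives the tail of `M`:
`π M (φ, α) = ∫_φ^α S(t) sin t / √(cos φ - cos t) dt` (`FIntegrand_integral`).
The first summand of `S` contributes an elementary function (`capTransform`), whose derivative yields
the bracket in the density; the second contributes the function `F(φ)` of the statement. Monotonicity
of the tail shows that the density is nonnegative, and its value `1` at `φ = 0` determines the constant
(`polar_law_eq`). As all inversions are carried out on nonnegative measurable functions by Tonelli's
theorem, no integrability has to be assumed: that of `g` near `α` and of the outer integrand are
consequences. Differentiability of the Abel integrals in the open interval comes from splitting them
into a far part and a rescaled near part (`contDiffOn_abel_left`).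
-/

namespace SphereEnergy
open Filter Topology

/-! ### Regularity of Abel integrals -/

/-- Differentiation under the integral sign, `n` times: if the affine functions `x ↦ p s + x q s` stay in
a compact part of the set where `h` is `Cⁿ`, then `x ↦ ∫ f s * h (p s + x * q s) ∂ν` is `Cⁿ`. -/
theorem contDiffOn_integral_comp_affine {X : Type*} [MeasurableSpace X] {ν : Measure X}
    {p q : X → ℝ} (hp : Measurable p) (hq : Measurable q) (hq1 : ∀ s, |q s| ≤ 1)
    {U V : Set ℝ} (hU : IsOpen U) (hV : IsOpen V)
    (hK : ∀ x ∈ U, ∃ ε > 0, ∃ K ⊆ V, IsCompact K ∧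
      ∀ᵐ s ∂ν, ∀ y ∈ Metric.ball x ε, p s + y * q s ∈ K)
    (n : ℕ) {f : X → ℝ} (hf : Integrable f ν) {h : ℝ → ℝ} (hh : ContDiffOn ℝ n h V) :
    ContDiffOn ℝ n (fun x => ∫ s, f s * h (p s + x * q s) ∂ν) U := by
  have hmeas : ∀ {f h : _ → ℝ}, Integrable f ν → ContinuousOn h V → ∀ x ∈ U,
      AEStronglyMeasurable (fun s => f s * h (p s + x * q s)) ν := by
    intro f h hf hh x hx
    obtain ⟨ε, hε, K, hKV, -, hK⟩ := hK x hx
    refine hf.aestronglyMeasurable.mul ?_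
    have h1 : Measurable (V.indicator h) := by
      classical
      have := hh.measurable_piecewise (g := fun _ => (0 : ℝ)) continuousOn_const hV.measurableSet
      convert this using 1
      ext y
      simp [Set.indicator, Set.piecewise]
    refine (h1.comp (hp.add (hq.const_mul x))).aestronglyMeasurable.congr ?_
    filter_upwards [hK] with s hs
    have := hs x (Metric.mem_ball_self hε)
    simp [Set.indicator_of_mem (hKV this)]
  have hbd : ∀ {h : ℝ → ℝ}, ContinuousOn h V → ∀ x ∈ U, ∃ ε > 0, ∃ C : ℝ,
      ∀ᵐ s ∂ν, ∀ y ∈ Metric.ball x ε, p s + y * q s ∈ V ∧ |h (p s + y * q s)| ≤ C := by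
    intro h hh x hx
    obtain ⟨ε, hε, K, hKV, hKc, hK⟩ := hK x hx
    obtain ⟨C, hC⟩ := hKc.exists_bound_of_continuousOn (hh.mono hKV)
    refine ⟨ε, hε, C, ?_⟩
    filter_upwards [hK] with s hs y hy
    exact ⟨hKV (hs y hy), by simpa using hC _ (hs y hy)⟩
  induction n generalizing f h with
  | zero =>
    simp only [Nat.cast_zero, contDiffOn_zero] at hh ⊢
    intro x hx
    obtain ⟨ε, hε, C, hC⟩ := hbd hh x hx
    refine ContinuousAt.continuousWithinAt ?_
    refine continuousAt_of_dominated (bound := fun s => |f s| * C) ?_ ?_ (hf.abs.mul_const C) ?_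
    · filter_upwards [hU.mem_nhds hx] with y hy using hmeas hf hh y hy
    · filter_upwards [Metric.ball_mem_nhds x hε] with y hy
      filter_upwards [hC] with s hs
      rw [Real.norm_eq_abs, abs_mul]
      exact mul_le_mul_of_nonneg_left (hs y hy).2 (abs_nonneg _)
    · filter_upwards [hC] with s hs
      have := hh.continuousAt (hV.mem_nhds (hs x (Metric.mem_ball_self hε)).1)
      refine continuousAt_const.mul (ContinuousAt.comp (g := h) this ?_)
      fun_prop
  | succ n ih =>
    rw [Nat.cast_succ, contDiffOn_succ_iff_deriv_of_isOpen hV] at hh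
    obtain ⟨hd, -, hc⟩ := hh
    have hqf : Integrable (fun s => f s * q s) ν := by
      refine hf.mul_bdd (c := 1) hq.aestronglyMeasurable (ae_of_all _ fun s => by simpa using hq1 s)
    have hder : ∀ x ∈ U, HasDerivAt (fun x => ∫ s, f s * h (p s + x * q s) ∂ν)
        (∫ s, (f s * q s) * deriv h (p s + x * q s) ∂ν) x := by
      intro x hx
      obtain ⟨ε, hε, C, hC⟩ := hbd (hc.continuousOn) x hx
      obtain ⟨ε', hε', C', hC'⟩ := hbd (hd.continuousOn) x hx
      refine (hasDerivAt_integral_of_dominated_loc_of_deriv_le (𝕜 := ℝ)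
        (F := fun x s => f s * h (p s + x * q s))
        (F' := fun x s => f s * q s * deriv h (p s + x * q s)) (Metric.ball_mem_nhds x hε)
        (bound := fun s => |f s * q s| * C) ?_ ?_ ?_ ?_ (hqf.abs.mul_const C) ?_).2
      · filter_upwards [hU.mem_nhds hx] with y hy using hmeas hf hd.continuousOn y hy
      · refine (hf.abs.mul_const C').mono' (hmeas hf hd.continuousOn x hx) ?_
        filter_upwards [hC'] with s hs
        rw [Real.norm_eq_abs, abs_mul]
        exact mul_le_mul_of_nonneg_left (hs x (Metric.mem_ball_self hε')).2 (abs_nonneg _)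
      · exact hmeas hqf hc.continuousOn x hx
      · filter_upwards [hC] with s hs y hy
        rw [Real.norm_eq_abs, abs_mul]
        exact mul_le_mul_of_nonneg_left (hs y hy).2 (abs_nonneg _)
      · filter_upwards [hC] with s hs y hy
        have h1 : HasDerivAt (fun y => p s + y * q s) (q s) y := by
          simpa using ((hasDerivAt_id y).mul_const (q s)).const_add (p s)
        have h2 := (hd.differentiableAt (hV.mem_nhds (hs y hy).1)).hasDerivAt
        exact ((h2.comp y h1).const_mul (f s)).congr_deriv (by ring)
    rw [Nat.cast_succ, contDiffOn_succ_iff_deriv_of_isOpen hU]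
    refine ⟨fun x hx => (hder x hx).differentiableAt.differentiableWithinAt, by simp, ?_⟩
    exact (ih hqf hc).congr fun x hx => (hder x hx).deriv

/-- The Abel integral of an integrable function that is `Cⁿ` in the open interval is `Cⁿ` there. The
integral is split at a point `a`: over `(c, a)` the kernel is smooth, and the part over `(a, x)` is
rescaled to `(0, 1)`, which moves the dependence on `x` into `f`. -/
theorem contDiffOn_abel_left {n : ℕ} {b c : ℝ} {f : ℝ → ℝ}
    (hf : ∀ x ∈ Ioo c b, IntervalIntegrable f volume c x) (hfn : ContDiffOn ℝ n f (Ioo c b)) :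
    ContDiffOn ℝ n (fun x => ∫ u in c..x, f u / √(x - u)) (Ioo c b) ∧
    ∀ x ∈ Ioo c b, IntervalIntegrable (fun u => f u / √(x - u)) volume c x := by
  have hker : ContDiffOn ℝ n (fun y : ℝ => (√y)⁻¹) (Ioi 0) := fun y hy =>
    ((Real.contDiffAt_sqrt (ne_of_gt hy)).inv (by simpa using (Real.sqrt_pos.2 hy).ne')).contDiffWithinAt
  have hw : IntegrableOn (fun s : ℝ => (√(1 - s))⁻¹) (Ioo 0 1) := by
    have h1 : IntervalIntegrable (fun x : ℝ => x ^ (-(1/2) : ℝ)) volume 0 1 :=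
      intervalIntegral.intervalIntegrable_rpow' (by norm_num)
    have h2 := (h1.comp_sub_left 1).symm
    simp only [sub_zero, sub_self] at h2
    rw [intervalIntegrable_iff_integrableOn_Ioo_of_le zero_le_one] at h2
    refine h2.congr_fun (fun s hs => ?_) measurableSet_Ioo
    simp only
    rw [Real.rpow_neg (by linarith [hs.2]), Real.sqrt_eq_rpow]
  -- the integral over `(a, x)` after rescaling to `(0, 1)`; the truncation of `s` to `[0, 1]` makes the
  -- affine maps `a (1 - s) + x s` bounded for all real `s`
  have hnear : ∀ a ∈ Ioo c b, ContDiffOn ℝ n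
      (fun x => ∫ s in Ioo 0 1, (√(1 - s))⁻¹ * f (a * (1 - max 0 (min 1 s)) + x * max 0 (min 1 s))) (Ioo c b) := by
    intro a ha
    refine contDiffOn_integral_comp_affine (by fun_prop) (by fun_prop) ?_ isOpen_Ioo isOpen_Ioo
      ?_ n hw hfn
    · intro s
      rw [abs_le]
      constructor
      · linarith [le_max_left 0 (min 1 s)]
      · exact max_le zero_le_one (min_le_left _ _)
    · intro x hx
      obtain ⟨ε, hε, h⟩ := Metric.isOpen_iff.1 isOpen_Ioo x hx
      rw [Real.ball_eq_Ioo] at h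
      have hK : Icc (min a (x - ε / 2)) (max a (x + ε / 2)) ⊆ Ioo c b := by
        have h1 := h (show x - ε / 2 ∈ _ from ⟨by linarith, by linarith⟩)
        have h2 := h (show x + ε / 2 ∈ _ from ⟨by linarith, by linarith⟩)
        intro y hy
        exact ⟨lt_of_lt_of_le (lt_min ha.1 h1.1) hy.1, lt_of_le_of_lt hy.2 (max_lt ha.2 h2.2)⟩
      refine ⟨ε / 2, by linarith, _, hK, isCompact_Icc, ae_of_all _ fun s y hy => ?_⟩
      rw [Real.ball_eq_Ioo] at hy
      set σ := max 0 (min 1 s)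
      have h0 : 0 ≤ σ := le_max_left _ _
      have h1 : σ ≤ 1 := max_le zero_le_one (min_le_left _ _)
      refine convex_Icc (min a (x - ε / 2)) (max a (x + ε / 2)) |>.add_smul_sub_mem (x := a) (y := y) (t := σ)
        ⟨min_le_left _ _, le_max_left _ _⟩ ⟨(min_le_right _ _).trans hy.1.le, hy.2.le.trans (le_max_right _ _)⟩
        ⟨h0, h1⟩ |> fun h => ?_
      convert h using 1
      simp only [smul_eq_mul]; ring
  -- the integral over `(c, a)`, where the kernel is smooth in `x`
  have hfar : ∀ a ∈ Ioo c b, ContDiffOn ℝ n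
      (fun x => ∫ u in Ioc c a, f u * (√(-u + x * 1))⁻¹) (Ioi a) := by
    intro a ha
    refine contDiffOn_integral_comp_affine (h := fun y => (√y)⁻¹) (q := fun _ => 1) (by fun_prop) (by fun_prop)
      (by simp) isOpen_Ioi isOpen_Ioi ?_ n ((hf a ha).1) hker
    intro x hx
    have hx : a < x := hx
    refine ⟨(x - a) / 2, by linarith, Icc ((x - a) / 2) (x + (x - a) / 2 - c), ?_, isCompact_Icc, ?_⟩
    · intro y hy
      exact lt_of_lt_of_le (by linarith) hy.1
    · refine ae_restrict_of_forall_mem measurableSet_Ioc fun u hu y hy => ?_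
      rw [Real.ball_eq_Ioo] at hy
      constructor <;> linarith [hy.1, hy.2, hu.1, hu.2]
  have hsplit : ∀ a ∈ Ioo c b, ∀ x ∈ Ioo a b, IntervalIntegrable (fun u => f u / √(x - u)) volume c x ∧
      ∫ u in c..x, f u / √(x - u) = (∫ u in Ioc c a, f u * (√(-u + x * 1))⁻¹) +
        √(x - a) * ∫ s in Ioo 0 1, (√(1 - s))⁻¹ * f (a * (1 - max 0 (min 1 s)) + x * max 0 (min 1 s)) := by
    intro a ha x hx
    have hax : 0 < x - a := sub_pos.2 hx.1
    have e1 : ∀ u, f u * (√(-u + x * 1))⁻¹ = f u / √(x - u) := fun u => by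
      rw [div_eq_mul_inv]; congr 3; ring
    have i1 : IntervalIntegrable (fun u => f u / √(x - u)) volume c a := by
      have hcont : ContinuousOn (fun u => (√(x - u))⁻¹) (uIcc c a) := by
        refine ContinuousOn.inv₀ (by fun_prop) fun u hu => ?_
        rw [uIcc_of_le ha.1.le] at hu
        exact (Real.sqrt_pos.2 (by linarith [hu.2])).ne'
      exact (hf a ha).mul_continuousOn hcont
    have hcontf : ContinuousOn f (Icc a x) :=
      hfn.continuousOn.mono fun u hu => ⟨lt_of_lt_of_le ha.1 hu.1, lt_of_le_of_lt hu.2 hx.2⟩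
    have hint : IntervalIntegrable (fun s : ℝ => (√(1 - s))⁻¹ * f (a + (x - a) * s)) volume 0 1 := by
      rw [← intervalIntegrable_iff_integrableOn_Ioo_of_le zero_le_one] at hw
      refine hw.mul_continuousOn (hcontf.comp (by fun_prop) fun s hs => ?_)
      rw [uIcc_of_le zero_le_one] at hs
      constructor
      · nlinarith [hs.1]
      · nlinarith [hs.2]
    have hscale : ∀ s : ℝ, (f (a + (x - a) * s) / √(x - (a + (x - a) * s))) =
        (√(x - a))⁻¹ * ((√(1 - s))⁻¹ * f (a + (x - a) * s)) := by
      intro s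
      rw [show x - (a + (x - a) * s) = (x - a) * (1 - s) by ring, Real.sqrt_mul hax.le, div_eq_mul_inv,
        mul_inv]
      ring
    have i2 : IntervalIntegrable (fun u => f u / √(x - u)) volume a x := by
      have h3 : IntervalIntegrable (fun s => f (a + (x - a) * s) / √(x - (a + (x - a) * s))) volume 0 1 := by
        simp_rw [hscale]
        exact hint.const_mul _
      have h4 := (h3.comp_mul_left (c := (x - a)⁻¹)).comp_sub_right a
      have e : (1:ℝ) / (x - a)⁻¹ + a = x := by field_simp; ring
      rw [e] at h4
      simp only [zero_div, zero_add] at h4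
      refine h4.congr fun u _ => ?_
      rw [mul_inv_cancel_left₀ hax.ne']
      congr 3 <;> ring
    refine ⟨i1.trans i2, ?_⟩
    rw [← intervalIntegral.integral_add_adjacent_intervals i1 i2]
    congr 1
    · rw [intervalIntegral.integral_of_le ha.1.le]
      simp_rw [e1]
    · have h5 := intervalIntegral.integral_comp_add_mul (a := 0) (b := 1) (fun u => f u / √(x - u)) hax.ne' a
      simp only [mul_zero, add_zero, mul_one, add_sub_cancel] at h5
      have h6 : ∫ s in Ioo (0:ℝ) 1, (√(1 - s))⁻¹ * f (a * (1 - max 0 (min 1 s)) + x * max 0 (min 1 s))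
          = ∫ s in (0:ℝ)..1, (√(1 - s))⁻¹ * f (a + (x - a) * s) := by
        rw [intervalIntegral.integral_of_le zero_le_one, integral_Ioc_eq_integral_Ioo]
        refine setIntegral_congr_fun measurableSet_Ioo fun s hs => ?_
        rw [min_eq_right hs.2.le, max_eq_right hs.1.le]
        congr 2; ring
      rw [h6]
      simp_rw [hscale] at h5
      rw [intervalIntegral.integral_const_mul, smul_eq_mul] at h5
      have hs := Real.sqrt_pos.2 hax
      have hss := Real.mul_self_sqrt hax.le
      have h7 : √(x - a) ≠ 0 := hs.ne'
      generalize (∫ s in (0:ℝ)..1, (√(1 - s))⁻¹ * f (a + (x - a) * s)) = A at h5 ⊢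
      generalize (∫ u in a..x, f u / √(x - u)) = B at h5 ⊢
      have h8 : A = (x - a)⁻¹ * √(x - a) * B := by
        rw [mul_comm _ (√(x - a)), mul_assoc, ← h5, mul_inv_cancel_left₀ h7]
      rw [h8, ← mul_assoc, mul_left_comm, hss, inv_mul_cancel₀ hax.ne', one_mul]
  refine ⟨fun x hx => ?_, fun x hx => ?_⟩
  · have ha : (c + x) / 2 ∈ Ioo c b := ⟨by linarith [hx.1], by linarith [hx.1, hx.2]⟩
    have hxa : x ∈ Ioo ((c + x) / 2) b := ⟨by linarith [hx.1], hx.2⟩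
    refine ContDiffAt.contDiffWithinAt ?_
    have h1 := (hfar _ ha).contDiffAt (Ioi_mem_nhds hxa.1)
    have h2 := (hnear _ ha).contDiffAt (isOpen_Ioo.mem_nhds hx)
    have h3 : ContDiffAt ℝ n (fun y => √(y - (c + x) / 2)) x :=
      ContDiffAt.sqrt (by fun_prop) (by linarith [hxa.1])
    refine (h1.add (h3.mul h2)).congr_of_eventuallyEq ?_
    filter_upwards [isOpen_Ioo.mem_nhds hxa] with y hy using (hsplit _ ha y hy).2
  · have ha : (c + x) / 2 ∈ Ioo c b := ⟨by linarith [hx.1], by linarith [hx.1, hx.2]⟩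
    exact (hsplit _ ha x ⟨by linarith [hx.1], hx.2⟩).1

theorem contDiffOn_abel_right {n : ℕ} {b c : ℝ} {f : ℝ → ℝ}
    (hf : ∀ x ∈ Ioo c b, IntervalIntegrable f volume x b) (hfn : ContDiffOn ℝ n f (Ioo c b)) :
    ContDiffOn ℝ n (fun x => ∫ u in x..b, f u / √(u - x)) (Ioo c b) := by
  have hneg : MapsTo (fun x : ℝ => -x) (Ioo (-b) (-c)) (Ioo c b) := fun x hx =>
    ⟨by linarith [hx.2], by linarith [hx.1]⟩
  have h1 := (contDiffOn_abel_left (n := n) (c := -b) (b := -c) (f := fun u => f (-u)) ?_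
    (hfn.comp contDiff_neg.contDiffOn hneg)).1
  · have h2 : MapsTo (fun x : ℝ => -x) (Ioo c b) (Ioo (-b) (-c)) := fun x hx =>
      ⟨by linarith [hx.2], by linarith [hx.1]⟩
    refine (h1.comp contDiff_neg.contDiffOn h2).congr fun x _ => ?_
    have := intervalIntegral.integral_comp_neg (a := -b) (b := -x) (fun u => f u / √(u - x))
    simp only [neg_neg] at this
    rw [← this]
    simp only [Function.comp]
    refine intervalIntegral.integral_congr fun u _ => ?_
    congr 2; ring
  · intro x hx
    have := (IntervalIntegrable.iff_comp_neg (by simp)).1 (hf (-x) (hneg hx))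
    simpa using this.symm

/-! ### Elementary Abel integrals -/

/-- The fundamental theorem of calculus for a nonnegative derivative, in its Bochner and its Lebesgue
form; integrability is part of the conclusion. -/
theorem lintegral_Ioo_deriv_of_nonneg {a b : ℝ} (hab : a ≤ b) {f g : ℝ → ℝ}
    (hg : ContinuousOn g (Icc a b)) (hd : ∀ x ∈ Ioo a b, HasDerivAt g (f x) x)
    (h0 : ∀ x ∈ Ioo a b, 0 ≤ f x) :
    IntervalIntegrable f volume a b ∧ ∫ x in a..b, f x = g b - g a ∧
      ∫⁻ x in Ioo a b, ENNReal.ofReal (f x) = ENNReal.ofReal (g b - g a) := by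
  have h1 := intervalIntegral.integrableOn_deriv_of_nonneg hg hd h0
  have h2 : IntervalIntegrable f volume a b := (intervalIntegrable_iff_integrableOn_Ioc_of_le hab).2 h1
  have h3 := intervalIntegral.integral_eq_sub_of_hasDerivAt_of_le hab hg hd h2
  refine ⟨h2, h3, ?_⟩
  rw [← h3, intervalIntegral.integral_of_le hab, integral_Ioc_eq_integral_Ioo,
    ofReal_integral_eq_lintegral_ofReal (h1.mono_set Ioo_subset_Ioc_self)
    (ae_restrict_of_forall_mem measurableSet_Ioo h0)]

theorem cos_lt_cos_of_mem {a b : ℝ} (ha : 0 ≤ a) (hab : a < b) (hb : b ≤ π) : 0 < cos a - cos b :=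
  sub_pos.2 (cos_lt_cos_of_nonneg_of_le_pi ha hb hab)

theorem sin_nonneg_of_mem_Ioo {a b x : ℝ} (ha : 0 ≤ a) (hb : b ≤ π) (hx : x ∈ Ioo a b) : 0 ≤ sin x :=
  sin_nonneg_of_nonneg_of_le_pi (ha.trans hx.1.le) (hx.2.le.trans hb)

/-- The beta integral on which Abel inversion rests: the two half-order kernels compose to the constant `π`. -/
theorem lintegral_abel_product {a b : ℝ} (ha : 0 ≤ a) (hab : a < b) (hb : b ≤ π) :
    ∫⁻ x in Ioo a b, ENNReal.ofReal (sin x / (√(cos a - cos x) * √(cos x - cos b))) =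
      ENNReal.ofReal π := by
  have hc := cos_lt_cos_of_mem ha hab hb
  set c := cos a - cos b with hcdef
  -- the antiderivative is the arcsine of `cos x` mapped affinely from `[cos b, cos a]` onto `[-1, 1]`
  have key := (lintegral_Ioo_deriv_of_nonneg hab.le
    (g := fun x => arcsin ((cos a + cos b - 2 * cos x) / c))
    (f := fun x => sin x / (√(cos a - cos x) * √(cos x - cos b))) ?_ ?_ ?_).2.2
  · rw [key]
    rw [show (cos a + cos b - 2 * cos b) / c = 1 by rw [div_eq_one_iff_eq hc.ne']; ring,
      show (cos a + cos b - 2 * cos a) / c = -1 by rw [div_eq_iff hc.ne']; ring, arcsin_one, arcsin_neg_one]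
    ring_nf
  · exact continuous_arcsin.comp_continuousOn (by fun_prop)
  · intro x hx
    have h1 := cos_lt_cos_of_mem ha hx.1 (hx.2.le.trans hb)
    have h2 := cos_lt_cos_of_mem (ha.trans hx.1.le) hx.2 hb
    have hz : 1 - ((cos a + cos b - 2 * cos x) / c) ^ 2 =
        (2 / c) ^ 2 * ((cos a - cos x) * (cos x - cos b)) := by
      field_simp; rw [hcdef]; ring
    have hz0 : 0 < 1 - ((cos a + cos b - 2 * cos x) / c) ^ 2 := by rw [hz]; positivity
    have hne1 : (cos a + cos b - 2 * cos x) / c ≠ -1 := fun h => by rw [h] at hz0; norm_num at hz0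
    have hne2 : (cos a + cos b - 2 * cos x) / c ≠ 1 := fun h => by rw [h] at hz0; norm_num at hz0
    have hd : HasDerivAt (fun x => (cos a + cos b - 2 * cos x) / c) (2 * sin x / c) x := by
      have := (((hasDerivAt_cos x).const_mul 2).const_sub (cos a + cos b)).div_const c
      exact this.congr_deriv (by ring)
    refine ((hasDerivAt_arcsin hne1 hne2).comp x hd).congr_deriv ?_
    rw [hz, Real.sqrt_mul (by positivity), Real.sqrt_sq (by positivity), Real.sqrt_mul h1.le]
    have := Real.sqrt_pos.2 h1
    have := Real.sqrt_pos.2 h2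
    field_simp
  · intro x hx
    have := sin_nonneg_of_mem_Ioo ha hb hx
    positivity

theorem integral_abel_left {τ : ℝ} (h0 : 0 ≤ τ) (hπ : τ ≤ π) :
    IntervalIntegrable (fun x => sin x / √(cos x - cos τ)) volume 0 τ ∧
    ∫ x in 0..τ, sin x / √(cos x - cos τ) = 2 * √(1 - cos τ) ∧
    ∫⁻ x in Ioo 0 τ, ENNReal.ofReal (sin x / √(cos x - cos τ)) = ENNReal.ofReal (2 * √(1 - cos τ)) := by
  have key := lintegral_Ioo_deriv_of_nonneg h0
    (g := fun x => - (2 * √(cos x - cos τ)))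
    (f := fun x => sin x / √(cos x - cos τ)) ?_ ?_ ?_
  · simpa using key
  · fun_prop
  · intro x hx
    have h2 := cos_lt_cos_of_mem hx.1.le hx.2 hπ
    refine ((((hasDerivAt_cos x).sub_const (cos τ)).sqrt h2.ne').const_mul 2).neg.congr_deriv ?_
    have := Real.sqrt_pos.2 h2
    field_simp
  · intro x hx
    have := sin_nonneg_of_mem_Ioo le_rfl hπ hx
    positivity

theorem integral_abel_right {t α : ℝ} (h0 : 0 ≤ t) (ht : t ≤ α) (hπ : α ≤ π) :
    ∫⁻ x in Ioo t α, ENNReal.ofReal (sin x / √(cos t - cos x)) = ENNReal.ofReal (2 * √(cos t - cos α)) := by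
  have key := (lintegral_Ioo_deriv_of_nonneg ht
    (g := fun x => 2 * √(cos t - cos x))
    (f := fun x => sin x / √(cos t - cos x)) ?_ ?_ ?_).2.2
  · simpa using key
  · fun_prop
  · intro x hx
    have h2 := cos_lt_cos_of_mem h0 hx.1 (hx.2.le.trans hπ)
    refine ((((hasDerivAt_cos x).const_sub (cos t)).sqrt h2.ne').const_mul 2).congr_deriv ?_
    have := Real.sqrt_pos.2 h2
    field_simp
  · intro x hx
    have := sin_nonneg_of_mem_Ioo h0 hπ hx
    positivity

/-- The right Abel transform of `√(1 + cos t)` over `(φ, α)` in closed form; see `integral_capTransform`.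
Minus its derivative, divided by `sin φ`, is a constant multiple of the elementary part of the density. -/
noncomputable def capTransform (α φ : ℝ) : ℝ :=
  √((1 + cos α) * (cos φ - cos α)) + (1 + cos φ) * arcsin √((cos φ - cos α) / (1 + cos φ))

theorem integral_capTransform {φ α : ℝ} (h0 : 0 ≤ φ) (hφ : φ < α) (hπ : α ≤ π) :
    IntervalIntegrable (fun t => √(1 + cos t) * sin t / √(cos φ - cos t)) volume φ α ∧
    ∫ t in φ..α, √(1 + cos t) * sin t / √(cos φ - cos t) = capTransform α φ := by
  have hp : 0 < 1 + cos φ := by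
    have := cos_lt_cos_of_mem h0 (hφ.trans_le hπ) le_rfl
    rw [cos_pi] at this; linarith
  have key := lintegral_Ioo_deriv_of_nonneg hφ.le
    (g := fun t => capTransform t φ)
    (f := fun t => √(1 + cos t) * sin t / √(cos φ - cos t)) ?_ ?_ ?_
  · refine ⟨key.1, key.2.1.trans ?_⟩
    simp [capTransform]
  · unfold capTransform
    refine ContinuousOn.add (by fun_prop) (continuousOn_const.mul ?_)
    exact continuous_arcsin.comp_continuousOn (by fun_prop)
  · intro t ht
    have h1 := cos_lt_cos_of_mem h0 ht.1 (ht.2.le.trans hπ)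
    have h2 := cos_lt_cos_of_mem (h0.trans ht.1.le) (ht.2.trans_le hπ) le_rfl
    rw [cos_pi] at h2
    have h3 : 0 < 1 + cos t := by linarith
    have hd1 : HasDerivAt (fun t => (1 + cos t) * (cos φ - cos t))
        (sin t * (1 + 2 * cos t - cos φ)) t :=
      (((hasDerivAt_cos t).const_add 1).mul ((hasDerivAt_cos t).const_sub (cos φ))).congr_deriv (by ring)
    have hd2 : HasDerivAt (fun t => (cos φ - cos t) / (1 + cos φ)) (sin t / (1 + cos φ)) t :=
      (((hasDerivAt_cos t).const_sub (cos φ)).div_const _).congr_deriv (by ring)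
    have hw : 0 < (cos φ - cos t) / (1 + cos φ) := by positivity
    have hd3 := hd2.sqrt hw.ne'
    have hz : 1 - √((cos φ - cos t) / (1 + cos φ)) ^ 2 = (1 + cos t) / (1 + cos φ) := by
      rw [Real.sq_sqrt hw.le]; field_simp; ring
    have hz0 : 0 < 1 - √((cos φ - cos t) / (1 + cos φ)) ^ 2 := by rw [hz]; positivity
    have hne1 : √((cos φ - cos t) / (1 + cos φ)) ≠ -1 := fun h => by rw [h] at hz0; norm_num at hz0
    have hne2 : √((cos φ - cos t) / (1 + cos φ)) ≠ 1 := fun h => by rw [h] at hz0; norm_num at hz0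
    refine ((hd1.sqrt (by positivity)).add
      (((hasDerivAt_arcsin hne1 hne2).comp t hd3).const_mul (1 + cos φ))).congr_deriv ?_
    rw [hz, Real.sqrt_mul h3.le, Real.sqrt_div h3.le, Real.sqrt_div h1.le]
    have e1 := Real.sqrt_pos.2 h1
    have e2 := Real.sqrt_pos.2 h3
    have e3 := Real.sqrt_pos.2 hp
    have q1 := Real.sq_sqrt h1.le
    have q2 := Real.sq_sqrt h3.le
    have q3 := Real.sq_sqrt hp.le
    field_simp
    rw [q3, q2]
    field_simp
    ring
  · intro t ht
    have := sin_nonneg_of_mem_Ioo h0 hπ ht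
    positivity

theorem hasDerivAt_capTransform {φ α : ℝ} (h0 : 0 < φ) (hφ : φ < α) (hπ : α ≤ π) :
    HasDerivAt (capTransform α)
      (-sin φ * (√((1 + cos α) / (cos φ - cos α)) + (π / 2 - arctan √((1 + cos α) / (cos φ - cos α))))) φ := by
  have h1 := cos_lt_cos_of_mem h0.le hφ hπ
  have h2 := cos_lt_cos_of_mem h0.le (hφ.trans_le hπ) le_rfl
  rw [cos_pi] at h2
  have h3 : 0 < 1 + cos φ := by linarith
  have h4 : 0 ≤ 1 + cos α := by linarith [neg_one_le_cos α]
  have harc : π / 2 - arctan √((1 + cos α) / (cos φ - cos α)) =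
      arcsin √((cos φ - cos α) / (1 + cos φ)) := by
    set ρ := √((1 + cos α) / (cos φ - cos α)) with hρ
    have e1 : √((cos φ - cos α) / (1 + cos φ)) = sin (π / 2 - arctan ρ) := by
      rw [sin_pi_div_two_sub, cos_arctan, hρ, Real.sq_sqrt (by positivity), one_div, ← Real.sqrt_inv]
      congr 1
      field_simp
      ring
    have e2 : 0 ≤ arctan ρ := arctan_nonneg.2 (Real.sqrt_nonneg _)
    rw [e1, arcsin_sin] <;> linarith [arctan_lt_pi_div_two ρ]
  rw [harc]
  -- for `α = π` the argument of the arcsine is constantly `1`, where the arcsine is not differentiable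
  rcases eq_or_lt_of_le hπ with rfl | hπ'
  · have hloc : capTransform π =ᶠ[𝓝 φ] fun x => (1 + cos x) * (π / 2) := by
      filter_upwards [isOpen_Ioo.mem_nhds (show φ ∈ Ioo 0 π from ⟨h0, hφ⟩)] with x hx
      have := cos_lt_cos_of_mem hx.1.le hx.2 le_rfl
      rw [cos_pi] at this
      unfold capTransform
      rw [cos_pi, show cos x - -1 = 1 + cos x by ring, div_self (by linarith)]
      simp
    refine HasDerivAt.congr_of_eventuallyEq ?_ hloc
    refine (((hasDerivAt_cos φ).const_add 1).mul_const (π / 2)).congr_deriv ?_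
    rw [cos_pi, show cos φ - -1 = 1 + cos φ by ring, div_self (by linarith)]
    simp
  have h5 := cos_lt_cos_of_mem (h0.le.trans hφ.le) hπ' le_rfl
  rw [cos_pi] at h5
  have h6 : 0 < 1 + cos α := by linarith
  have hd1 : HasDerivAt (fun x => (1 + cos α) * (cos x - cos α)) ((1 + cos α) * -sin φ) φ :=
    ((hasDerivAt_cos φ).sub_const (cos α)).const_mul _
  have hd2 : HasDerivAt (fun x => (cos x - cos α) / (1 + cos x))
      (- sin φ * (1 + cos α) / (1 + cos φ) ^ 2) φ :=
    (((hasDerivAt_cos φ).sub_const (cos α)).div ((hasDerivAt_cos φ).const_add 1) h3.ne').congr_deriv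
      (by congr 1; ring)
  have hw : 0 < (cos φ - cos α) / (1 + cos φ) := by positivity
  have hd3 := hd2.sqrt hw.ne'
  have hz : 1 - √((cos φ - cos α) / (1 + cos φ)) ^ 2 = (1 + cos α) / (1 + cos φ) := by
    rw [Real.sq_sqrt hw.le]; field_simp; ring
  have hz0 : 0 < 1 - √((cos φ - cos α) / (1 + cos φ)) ^ 2 := by rw [hz]; positivity
  have hne1 : √((cos φ - cos α) / (1 + cos φ)) ≠ -1 := fun h => by rw [h] at hz0; norm_num at hz0
  have hne2 : √((cos φ - cos α) / (1 + cos φ)) ≠ 1 := fun h => by rw [h] at hz0; norm_num at hz0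
  refine ((hd1.sqrt (by positivity)).add (((hasDerivAt_cos φ).const_add 1).mul
    ((hasDerivAt_arcsin hne1 hne2).comp φ hd3))).congr_deriv ?_
  simp only [Function.comp]
  rw [hz, Real.sqrt_mul h6.le, Real.sqrt_div h6.le, Real.sqrt_div h6.le, Real.sqrt_div h1.le]
  have e1 := Real.sqrt_pos.2 h1
  have e2 := Real.sqrt_pos.2 h6
  have e3 := Real.sqrt_pos.2 h3
  have q1 := Real.sq_sqrt h1.le
  have q2 := Real.sq_sqrt h6.le
  have q3 := Real.sq_sqrt h3.le
  field_simp
  rw [q3]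
  field_simp
  linear_combination (2 * sin φ) * q2

theorem capTransform_zero {α : ℝ} (h0 : 0 ≤ α) (hπ : α ≤ π) : capTransform α 0 = α + sin α := by
  have h1 : 0 ≤ sin (α / 2) := sin_nonneg_of_nonneg_of_le_pi (by linarith) (by linarith)
  have e1 : 1 - cos α = 2 * sin (α / 2) ^ 2 := by
    have := cos_two_mul' (α / 2); have := sin_sq_add_cos_sq (α / 2)
    rw [show 2 * (α / 2) = α by ring] at *; linarith
  have e2 : (1 + cos α) * (1 - cos α) = sin α ^ 2 := by have := sin_sq_add_cos_sq α; linarith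
  unfold capTransform
  rw [cos_zero, e2, Real.sqrt_sq (sin_nonneg_of_nonneg_of_le_pi h0 hπ), e1,
    show 2 * sin (α / 2) ^ 2 / (1 + 1) = sin (α / 2) ^ 2 by ring, Real.sqrt_sq h1,
    arcsin_sin (by linarith) (by linarith)]
  ring

/-! ### The Newtonian kernel averaged over parallels -/

theorem one_sub_sq_mul_sin_sq_pos {k : ℝ} (hk0 : 0 < k) (hk1 : k < 1) (ψ : ℝ) :
    0 < 1 - k ^ 2 * sin ψ ^ 2 := by
  have h1 := sin_sq_le_one ψ
  have h2 : k ^ 2 < 1 := by nlinarith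
  nlinarith [sq_nonneg (sin ψ), sq_nonneg k]

/-- Landen's transformation of the complete elliptic integral, by the substitution
`θ = π - ψ - arcsin (k sin ψ)`. -/
theorem integral_landen {k : ℝ} (hk0 : 0 < k) (hk1 : k < 1) :
    ∫ θ in 0..π, (√(1 + k ^ 2 - 2 * k * cos θ))⁻¹ = ∫ ψ in 0..π, (√(1 - k ^ 2 * sin ψ ^ 2))⁻¹ := by
  have hpos := one_sub_sq_mul_sin_sq_pos hk0 hk1
  have hrange : ∀ ψ, -1 < k * sin ψ ∧ k * sin ψ < 1 := fun ψ => by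
    have := hpos ψ
    constructor <;> nlinarith
  have hder : ∀ ψ, HasDerivAt (fun ψ => π - ψ - arcsin (k * sin ψ))
      (-1 - k * cos ψ / √(1 - k ^ 2 * sin ψ ^ 2)) ψ := by
    intro ψ
    have h1 : HasDerivAt (fun ψ => k * sin ψ) (k * cos ψ) ψ := (hasDerivAt_sin ψ).const_mul k
    refine (((hasDerivAt_id ψ).const_sub π).sub
      ((hasDerivAt_arcsin (hrange ψ).1.ne' (hrange ψ).2.ne).comp ψ h1)).congr_deriv ?_
    rw [mul_pow]; ring
  have hcont : Continuous fun θ => (√(1 + k ^ 2 - 2 * k * cos θ))⁻¹ := by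
    refine Continuous.inv₀ (by fun_prop) fun θ => (Real.sqrt_pos.2 ?_).ne'
    nlinarith [cos_le_one θ, sq_nonneg (1 - k), mul_pos (sub_pos.2 hk1) (sub_pos.2 hk1)]
  have hcont' : Continuous fun ψ => -1 - k * cos ψ / √(1 - k ^ 2 * sin ψ ^ 2) := by
    refine continuous_const.sub (Continuous.div (by fun_prop) (by fun_prop) fun θ => (Real.sqrt_pos.2 (hpos θ)).ne')
  have key := intervalIntegral.integral_comp_mul_deriv (a := 0) (b := π) (fun ψ _ => hder ψ) hcont'.continuousOn hcont
  simp only [sin_zero, mul_zero, arcsin_zero, sub_zero, sin_pi, sub_self] at key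
  rw [intervalIntegral.integral_symm π 0, ← key, ← intervalIntegral.integral_neg]
  refine intervalIntegral.integral_congr fun ψ _ => ?_
  set c := √(1 - k ^ 2 * sin ψ ^ 2) with hc
  have hc0 : 0 < c := Real.sqrt_pos.2 (hpos ψ)
  have hc2 : c ^ 2 = 1 - k ^ 2 * sin ψ ^ 2 := Real.sq_sqrt (hpos ψ).le
  have hcos : cos (π - ψ - arcsin (k * sin ψ)) = sin ψ * (k * sin ψ) - cos ψ * c := by
    rw [show π - ψ - arcsin (k * sin ψ) = π - (ψ + arcsin (k * sin ψ)) by ring, cos_pi_sub, cos_add,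
      sin_arcsin (hrange ψ).1.le (hrange ψ).2.le, cos_arcsin, mul_pow, ← hc]
    ring
  have hsum : 0 < c + k * cos ψ := by
    have h1 : (k * cos ψ) ^ 2 < c ^ 2 := by
      rw [hc2]; have := sin_sq_add_cos_sq ψ; nlinarith [hk0, hk1]
    linarith [(abs_lt.1 (abs_lt_of_sq_lt_sq h1 hc0.le)).1]
  have hD : 1 + k ^ 2 - 2 * k * cos (π - ψ - arcsin (k * sin ψ)) = (c + k * cos ψ) ^ 2 := by
    rw [hcos]; have := sin_sq_add_cos_sq ψ
    linear_combination (-1) * hc2 + k ^ 2 * (-1) * this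
  simp only [Function.comp]
  rw [hD, Real.sqrt_sq hsum.le]
  field_simp
  ring

theorem integral_zero_two_pi_eq_of_symm {h : ℝ → ℝ} (hc : Continuous h) (hs : ∀ x, h (2 * π - x) = h x) :
    ∫ θ in 0..(2 * π), h θ = 2 * ∫ θ in 0..π, h θ := by
  rw [← intervalIntegral.integral_add_adjacent_intervals (hc.intervalIntegrable 0 π) (hc.intervalIntegrable π (2 * π))]
  have := intervalIntegral.integral_comp_sub_left (a := π) (b := 2 * π) h (2 * π)
  simp only [hs, sub_self] at this
  rw [this, show 2 * π - π = π by ring]; ring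

theorem integral_zero_pi_eq_of_symm {h : ℝ → ℝ} (hc : Continuous h) (hs : ∀ x, h (π - x) = h x) :
    ∫ θ in 0..π, h θ = 2 * ∫ θ in 0..(π / 2), h θ := by
  rw [← intervalIntegral.integral_add_adjacent_intervals (hc.intervalIntegrable 0 (π / 2)) (hc.intervalIntegrable (π / 2) π)]
  have := intervalIntegral.integral_comp_sub_left (a := π / 2) (b := π) h π
  simp only [hs, sub_self] at this
  rw [this, show π - π / 2 = π / 2 by ring]; ring

/-- The Abel kernel `1 / √(cos t - cos φ)` for `t < φ`, extended by `0`, as a function with values in `[0, ∞]`. -/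
noncomputable def abelKernel (t φ : ℝ) : ℝ≥0∞ :=
  if t < φ then ENNReal.ofReal (√(cos t - cos φ))⁻¹ else 0

theorem measurable_abelKernel : Measurable fun p : ℝ × ℝ => abelKernel p.1 p.2 := by
  unfold abelKernel
  refine Measurable.ite (measurableSet_lt measurable_fst measurable_snd) ?_ measurable_const
  fun_prop

theorem dist_sph_sq (θ φ θ' ξ : ℝ) :
    dist (sph θ φ) (sph θ' ξ) ^ 2 = 2 - 2 * (cos φ * cos ξ + sin φ * sin ξ * cos (θ - θ')) := by
  rw [Subtype.dist_eq, EuclideanSpace.dist_eq, Real.sq_sqrt (by positivity), Fin.sum_univ_three]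
  simp only [sph, Real.dist_eq, sq_abs, Matrix.cons_val_zero, Matrix.cons_val_one, Matrix.cons_val]
  rw [cos_sub]
  have h1 := sin_sq_add_cos_sq φ
  have h2 := sin_sq_add_cos_sq θ
  have h3 := sin_sq_add_cos_sq ξ
  have h4 := sin_sq_add_cos_sq θ'
  linear_combination h1 + h3 + sin φ ^ 2 * h2 + sin ξ ^ 2 * h4

theorem dist_sph (θ φ θ' ξ : ℝ) :
    dist (sph θ φ) (sph θ' ξ) = √(2 - 2 * (cos φ * cos ξ + sin φ * sin ξ * cos (θ - θ'))) := by
  rw [← dist_sph_sq, Real.sqrt_sq dist_nonneg]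

/-- Copson's factorization of the ring potential: the Newtonian kernel averaged over a parallel is the
composition of two Abel kernels. Both sides are complete elliptic integrals of the first kind; they
agree by Landen's transformation. -/
theorem lintegral_inv_edist_of_lt {ξ φ : ℝ} (h0 : 0 < ξ) (hlt : ξ < φ) (hπ : φ < π) :
    ∫⁻ θ in Ioo 0 (2 * π), (edist (sph θ φ) (sph 0 ξ))⁻¹ =
      2 * ∫⁻ t in Ioo 0 π, abelKernel t φ * abelKernel t ξ := by
  have hφ2 : φ / 2 ∈ Ioo 0 (π / 2) := ⟨by linarith, by linarith⟩
  have hξ2 : ξ / 2 ∈ Ioo 0 (π / 2) := ⟨by linarith, by linarith⟩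
  have hs : 0 < sin (φ / 2) := sin_pos_of_pos_of_lt_pi hφ2.1 (by linarith [hφ2.2])
  have hc : 0 < cos (φ / 2) := cos_pos_of_mem_Ioo ⟨by linarith [hφ2.1], hφ2.2⟩
  have hs' : 0 < sin (ξ / 2) := sin_pos_of_pos_of_lt_pi hξ2.1 (by linarith [hξ2.2])
  have hc' : 0 < cos (ξ / 2) := cos_pos_of_mem_Ioo ⟨by linarith [hξ2.1], hξ2.2⟩
  have hsφ : sin φ = 2 * sin (φ / 2) * cos (φ / 2) := by rw [← sin_two_mul]; ring_nf
  have hsξ : sin ξ = 2 * sin (ξ / 2) * cos (ξ / 2) := by rw [← sin_two_mul]; ring_nf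
  have hcφ : cos φ = 2 * cos (φ / 2) ^ 2 - 1 := by rw [← cos_two_mul]; ring_nf
  have hcξ : cos ξ = 2 * cos (ξ / 2) ^ 2 - 1 := by rw [← cos_two_mul]; ring_nf
  have hpφ := sin_sq_add_cos_sq (φ / 2)
  have hpξ := sin_sq_add_cos_sq (ξ / 2)
  set s := sin (φ / 2) with hs_def
  set c := cos (φ / 2) with hc_def
  set s' := sin (ξ / 2) with hs'_def
  set c' := cos (ξ / 2) with hc'_def
  set k := s' * c / (c' * s) with hk_def
  have hk0 : 0 < k := by positivity
  have hk1 : k < 1 := by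
    rw [hk_def, div_lt_one (by positivity)]
    have : 0 < sin (φ / 2 - ξ / 2) := sin_pos_of_pos_of_lt_pi (by linarith) (by linarith)
    rw [sin_sub] at this
    linarith
  have hposk := one_sub_sq_mul_sin_sq_pos hk0 hk1
  -- with the modulus `k = tan (ξ / 2) / tan (φ / 2)` the distance is `2 s c' √(1 + k² - 2 k cos θ)`
  have hD : ∀ θ, (edist (sph θ φ) (sph 0 ξ))⁻¹ =
      ENNReal.ofReal ((2 * s * c')⁻¹ * (√(1 + k ^ 2 - 2 * k * cos θ))⁻¹) := by
    intro θ
    have h1 : 0 < 1 + k ^ 2 - 2 * k * cos θ := by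
      nlinarith [cos_le_one θ, sq_nonneg (1 - k), mul_pos (sub_pos.2 hk1) (sub_pos.2 hk1)]
    have h2 : dist (sph θ φ) (sph 0 ξ) = (2 * s * c') * √(1 + k ^ 2 - 2 * k * cos θ) := by
      rw [dist_sph, sub_zero, ← Real.sqrt_sq (show 0 ≤ 2 * s * c' by positivity),
        ← Real.sqrt_mul (by positivity)]
      congr 1
      rw [hsφ, hsξ, hcφ, hcξ, hk_def]
      field_simp
      linear_combination (-2 * c' ^ 2) * hpφ - 2 * c ^ 2 * hpξ
    rw [edist_dist, h2, ← mul_inv, ENNReal.ofReal_inv_of_pos]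
    have := Real.sqrt_pos.2 h1
    positivity
  have hcontθ : Continuous fun θ => (2 * s * c')⁻¹ * (√(1 + k ^ 2 - 2 * k * cos θ))⁻¹ := by
    refine continuous_const.mul (Continuous.inv₀ (by fun_prop) fun θ => (Real.sqrt_pos.2 ?_).ne')
    nlinarith [cos_le_one θ, sq_nonneg (1 - k), mul_pos (sub_pos.2 hk1) (sub_pos.2 hk1)]
  have hcontψ : Continuous fun ψ => (√(1 - k ^ 2 * sin ψ ^ 2))⁻¹ :=
    Continuous.inv₀ (by fun_prop) fun θ => (Real.sqrt_pos.2 (hposk θ)).ne'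
  have hL : ∫⁻ θ in Ioo 0 (2 * π), (edist (sph θ φ) (sph 0 ξ))⁻¹ =
      ENNReal.ofReal (2 * ∫ ψ in 0..(π / 2), (s * c')⁻¹ * (√(1 - k ^ 2 * sin ψ ^ 2))⁻¹) := by
    simp_rw [hD]
    rw [← ofReal_integral_eq_lintegral_ofReal, ← integral_Ioc_eq_integral_Ioo,
      ← intervalIntegral.integral_of_le (by positivity),
      integral_zero_two_pi_eq_of_symm hcontθ (fun x => by rw [cos_two_pi_sub]),
      intervalIntegral.integral_const_mul, integral_landen hk0 hk1,
      integral_zero_pi_eq_of_symm hcontψ (fun x => by rw [sin_pi_sub]),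
      intervalIntegral.integral_const_mul]
    · congr 1
      field_simp
    · exact hcontθ.integrableOn_Icc.mono_set Ioo_subset_Icc_self
    · exact ae_of_all _ fun θ => by positivity
  -- the substitution `tan (t / 2) = tan (ξ / 2) sin ψ` maps `(0, π / 2)` onto `(0, ξ)`
  set f : ℝ → ℝ := fun ψ => 2 * arctan (s' / c' * sin ψ) with hf_def
  have hb : 0 < s' / c' := by positivity
  have htan : tan (ξ / 2) = s' / c' := tan_eq_sin_div_cos _
  have hfder : ∀ ψ, HasDerivAt f (2 * (1 / (1 + (s' / c' * sin ψ) ^ 2) * (s' / c' * cos ψ))) ψ := fun ψ =>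
    (((hasDerivAt_sin ψ).const_mul (s' / c')).arctan).const_mul 2
  have hmono : StrictMonoOn f (Icc 0 (π / 2)) := by
    intro x hx y hy hxy
    have h1 : sin x < sin y := strictMonoOn_sin ⟨by linarith [hx.1, pi_pos], hx.2⟩ ⟨by linarith [hy.1, pi_pos], hy.2⟩ hxy
    have := arctan_strictMono ((mul_lt_mul_iff_right₀ hb).2 h1)
    simp only [hf_def]; linarith
  have hf0 : f 0 = 0 := by simp [hf_def]
  have hf1 : f (π / 2) = ξ := by
    simp only [hf_def, sin_pi_div_two, mul_one]
    rw [← htan, arctan_tan (by linarith [hξ2.1]) hξ2.2]; ring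
  have himg : f '' Ioo 0 (π / 2) = Ioo 0 ξ := by
    apply Subset.antisymm
    · rintro _ ⟨x, hx, rfl⟩
      rw [← hf0, ← hf1]
      exact ⟨hmono ⟨le_rfl, by positivity⟩ ⟨hx.1.le, hx.2.le⟩ hx.1,
        hmono ⟨hx.1.le, hx.2.le⟩ ⟨by positivity, le_rfl⟩ hx.2⟩
    · have := intermediate_value_Ioo (show (0:ℝ) ≤ π / 2 by positivity)
        (fun ψ _ => (hfder ψ).continuousAt.continuousWithinAt : ContinuousOn f _)
      rwa [hf0, hf1] at this
  have hR : ∫⁻ t in Ioo 0 π, abelKernel t φ * abelKernel t ξ =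
      ENNReal.ofReal (∫ ψ in 0..(π / 2), (s * c')⁻¹ * (√(1 - k ^ 2 * sin ψ ^ 2))⁻¹) := by
    have e1 : ∫⁻ t in Ioo 0 π, abelKernel t φ * abelKernel t ξ =
        ∫⁻ t in Ioo 0 ξ, abelKernel t φ * abelKernel t ξ := by
      rw [← lintegral_indicator measurableSet_Ioo, ← lintegral_indicator measurableSet_Ioo]
      refine lintegral_congr fun t => ?_
      by_cases h : t < ξ
      · have h' : t < π := h.trans (hlt.trans hπ)
        simp [Set.indicator, h, h']
      · simp [Set.indicator, h, abelKernel]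
    rw [e1, ← himg, lintegral_image_eq_lintegral_abs_deriv_mul measurableSet_Ioo
      (fun ψ _ => (hfder ψ).hasDerivWithinAt) (hmono.injOn.mono Ioo_subset_Icc_self)]
    rw [intervalIntegral.integral_of_le (by positivity), integral_Ioc_eq_integral_Ioo,
      ofReal_integral_eq_lintegral_ofReal]
    · refine setLIntegral_congr_fun measurableSet_Ioo fun ψ hψ => ?_
      have hcosψ : 0 < cos ψ := cos_pos_of_mem_Ioo ⟨by linarith [hψ.1, pi_pos], hψ.2⟩
      have hfψ : f ψ ∈ Ioo 0 ξ := himg ▸ mem_image_of_mem f hψ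
      have hcosf : cos (f ψ) = 2 / (1 + (s' / c' * sin ψ) ^ 2) - 1 := by
        simp only [hf_def]
        rw [cos_two_mul, cos_sq_arctan]; ring
      have hkpos := hposk ψ
      have hψ1 := sin_sq_add_cos_sq ψ
      have e2 : cos (f ψ) - cos φ = 2 * s ^ 2 * (1 - k ^ 2 * sin ψ ^ 2) / (1 + (s' / c' * sin ψ) ^ 2) := by
        rw [hcosf, hcφ, hk_def]
        field_simp
        linear_combination (- 2 * c' ^ 2) * hpφ
      have e3 : cos (f ψ) - cos ξ = 2 * s' ^ 2 * cos ψ ^ 2 / (1 + (s' / c' * sin ψ) ^ 2) := by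
        rw [hcosf, hcξ]
        field_simp
        linear_combination (- 2 * c' ^ 2) * hpξ - (2 * c' ^ 2 * s' ^ 2) * hψ1
      simp only [abelKernel, hfψ.2, hfψ.2.trans hlt, if_true]
      rw [← ENNReal.ofReal_mul (by positivity), ← ENNReal.ofReal_mul (by positivity), ← mul_inv, ← Real.sqrt_mul (by rw [e2]; positivity)]
      congr 1
      rw [abs_of_pos (by positivity), e2, e3]
      rw [show 2 * s ^ 2 * (1 - k ^ 2 * sin ψ ^ 2) / (1 + (s' / c' * sin ψ) ^ 2) *
        (2 * s' ^ 2 * cos ψ ^ 2 / (1 + (s' / c' * sin ψ) ^ 2)) =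
        (2 * s * s' * cos ψ / (1 + (s' / c' * sin ψ) ^ 2)) ^ 2 * (1 - k ^ 2 * sin ψ ^ 2) by ring,
        Real.sqrt_mul (by positivity), Real.sqrt_sq (by positivity)]
      have := Real.sqrt_pos.2 hkpos
      generalize √(1 - k ^ 2 * sin ψ ^ 2) = w at *
      field_simp
    · exact (continuous_const.mul hcontψ).integrableOn_Icc.mono_set Ioo_subset_Icc_self
    · exact ae_of_all _ fun θ => by have := hs; positivity
  rw [hL, hR, ENNReal.ofReal_mul (by norm_num)]
  simp

theorem lintegral_inv_edist {ξ φ : ℝ} (hξ : ξ ∈ Ioo 0 π) (hφ : φ ∈ Ioo 0 π) (hne : φ ≠ ξ) :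
    ∫⁻ θ in Ioo 0 (2 * π), (edist (sph θ φ) (sph 0 ξ))⁻¹ =
      2 * ∫⁻ t in Ioo 0 π, abelKernel t φ * abelKernel t ξ := by
  rcases hne.lt_or_gt with h | h
  · have := lintegral_inv_edist_of_lt hφ.1 h hξ.2
    rw [lintegral_congr fun t => mul_comm (abelKernel t φ) (abelKernel t ξ), ← this]
    refine lintegral_congr fun θ => ?_
    rw [edist_dist, edist_dist, dist_sph, dist_sph]
    congr 4
    ring
  · exact lintegral_inv_edist_of_lt hξ.1 h hφ.2

/-! ### Strict positive definiteness of the Newtonian kernel -/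

section Gaussian
variable {V : Type*} [NormedAddCommGroup V] [InnerProductSpace ℝ V] [FiniteDimensional ℝ V]
  [MeasurableSpace V] [BorelSpace V]

open Complex in
/-- A Gaussian is the Fourier transform of a Gaussian, integrated against a finite measure. -/
theorem integral_exp_eq_integral_charFun {b : ℝ} (hb : 0 < b) (ρ : Measure V) [IsFiniteMeasure ρ] :
    ((π / b : ℂ) ^ (Module.finrank ℝ V / 2 : ℂ)) * ∫ w, cexp (-(‖w‖ ^ 2 / (4 * b) : ℝ)) ∂ρ =
      ∫ v : V, cexp (-b * ‖v‖ ^ 2) * charFun ρ v := by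
  have hb' : 0 < (b : ℂ).re := by simpa using hb
  have hint : Integrable (fun v : V => cexp (-b * ‖v‖ ^ 2)) := by
    simpa using GaussianFourier.integrable_cexp_neg_mul_sq_norm_add hb' 0 (0 : V)
  have hF : Integrable (fun p : V × V => cexp (-b * ‖p.2‖ ^ 2) * cexp (inner ℝ p.1 p.2 * I)) (ρ.prod volume) := by
    refine (hint.comp_snd ρ).mul_bdd (c := 1) (by fun_prop) (ae_of_all _ fun p => ?_)
    rw [Complex.norm_exp_ofReal_mul_I]
  calc _ = ∫ w, (∫ v : V, cexp (-b * ‖v‖ ^ 2) * cexp (inner ℝ w v * I)) ∂ρ := by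
        rw [← integral_const_mul]
        refine integral_congr_ae (ae_of_all _ fun w => ?_)
        have := GaussianFourier.integral_cexp_neg_mul_sq_norm_add hb' I w
        simp only
        simp_rw [← Complex.exp_add, mul_comm _ I]
        rw [this]
        congr 2
        push_cast
        rw [I_sq]; ring
    _ = ∫ v : V, ∫ w, cexp (-b * ‖v‖ ^ 2) * cexp (inner ℝ w v * I) ∂ρ := integral_integral_swap hF
    _ = _ := by
        refine integral_congr_ae (ae_of_all _ fun v => ?_)
        simp only
        rw [integral_const_mul, charFun_apply]

/-- The mutual energy of two measures with respect to the Gaussian kernel `exp (-s |x - y|²)`. -/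
noncomputable def gaussEnergy (s : ℝ) (μ ν : Measure V) : ℝ := ∫ p, rexp (-(s * ‖p.1 - p.2‖ ^ 2)) ∂(μ.prod ν)

open Complex ComplexConjugate in
/-- Parseval's identity for the Gaussian energy. -/
theorem gaussEnergy_eq {b : ℝ} (hb : 0 < b) (μ ν : Measure V) [IsFiniteMeasure μ] [IsFiniteMeasure ν] :
    ((π / b : ℂ) ^ (Module.finrank ℝ V / 2 : ℂ)) * (gaussEnergy (1 / (4 * b)) μ ν : ℂ) =
      ∫ v : V, cexp (-b * ‖v‖ ^ 2) * (charFun μ v * conj (charFun ν v)) := by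
  have h := integral_exp_eq_integral_charFun hb ((μ.prod ν).map fun p => p.1 - p.2)
  rw [integral_map (by fun_prop) (by fun_prop)] at h
  have h1 : (gaussEnergy (1 / (4 * b)) μ ν : ℂ) = ∫ p, cexp (-(‖p.1 - p.2‖ ^ 2 / (4 * b) : ℝ)) ∂(μ.prod ν) := by
    unfold gaussEnergy
    rw [← integral_complex_ofReal]
    refine integral_congr_ae (ae_of_all _ fun p => ?_)
    simp only
    push_cast
    congr 1; ring
  rw [h1, h]
  refine integral_congr_ae (ae_of_all _ fun v => ?_)
  simp only
  congr 1
  rw [charFun_apply, integral_map (by fun_prop) (by fun_prop), ← charFun_neg, charFun_apply, charFun_apply,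
    ← integral_prod_mul]
  refine integral_congr_ae (ae_of_all _ fun p => ?_)
  simp only
  rw [← Complex.exp_add, inner_sub_left, inner_neg_right]
  congr 1
  push_cast; ring

open Complex ComplexConjugate in
/-- The Gaussian energy of the signed measure `μ - ν` is a weighted `L²` norm of its characteristic
function. -/
theorem gaussEnergy_quadratic {b : ℝ} (hb : 0 < b) (μ ν : Measure V) [IsFiniteMeasure μ] [IsFiniteMeasure ν] :
    (π / b) ^ (Module.finrank ℝ V / 2 : ℝ) * (gaussEnergy (1 / (4 * b)) μ μ + gaussEnergy (1 / (4 * b)) ν ν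
      - (gaussEnergy (1 / (4 * b)) μ ν + gaussEnergy (1 / (4 * b)) ν μ)) =
      ∫ v : V, rexp (-b * ‖v‖ ^ 2) * ‖charFun μ v - charFun ν v‖ ^ 2 := by
  have hb' : 0 < (b : ℂ).re := by simpa using hb
  have hint : Integrable (fun v : V => cexp (-b * ‖v‖ ^ 2)) := by
    simpa using GaussianFourier.integrable_cexp_neg_mul_sq_norm_add hb' 0 (0 : V)
  have hI : ∀ (μ ν : Measure V) [IsFiniteMeasure μ] [IsFiniteMeasure ν],
      Integrable fun v : V => cexp (-b * ‖v‖ ^ 2) * (charFun μ v * conj (charFun ν v)) := by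
    intro μ ν _ _
    refine hint.mul_bdd (c := μ.real univ * ν.real univ) ?_ (ae_of_all _ fun v => ?_)
    · exact (measurable_charFun.mul
        (Complex.continuous_conj.measurable.comp measurable_charFun)).aestronglyMeasurable
    · rw [norm_mul, RCLike.norm_conj]
      exact mul_le_mul (norm_charFun_le v) (norm_charFun_le v) (norm_nonneg _) (measureReal_nonneg)
  rw [← Complex.ofReal_inj]
  have e : (((π / b) ^ (Module.finrank ℝ V / 2 : ℝ) : ℝ) : ℂ) = (π / b : ℂ) ^ (Module.finrank ℝ V / 2 : ℂ) := by
    rw [Complex.ofReal_cpow (by positivity)]; push_cast; rfl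
  rw [← integral_complex_ofReal, Complex.ofReal_mul, e]
  push_cast
  rw [mul_sub, mul_add, mul_add]
  rw [gaussEnergy_eq hb, gaussEnergy_eq hb, gaussEnergy_eq hb, gaussEnergy_eq hb]
  have hsub := integral_sub ((hI μ μ).add (hI ν ν)) ((hI μ ν).add (hI ν μ))
  simp only [Pi.add_apply] at hsub
  rw [← integral_add (hI μ μ) (hI ν ν), ← integral_add (hI μ ν) (hI ν μ), ← hsub]
  refine integral_congr_ae (ae_of_all _ fun v => ?_)
  simp only
  rw [← Complex.mul_conj', map_sub]
  ring

theorem continuous_charFun_of_finite (μ : Measure V) [IsFiniteMeasure μ] : Continuous (charFun μ) := by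
  unfold charFun
  refine continuous_of_dominated (bound := fun _ => 1) (fun t => by fun_prop) (fun t => ae_of_all _ fun x => ?_)
    (integrable_const 1) (ae_of_all _ fun x => by fun_prop)
  rw [Complex.norm_exp_ofReal_mul_I]

/-- The Gaussian kernel is strictly positive definite on finite measures. -/
theorem eq_of_gaussEnergy_le {s : ℝ} (hs : 0 < s) (μ ν : Measure V) [IsFiniteMeasure μ] [IsFiniteMeasure ν] :
    gaussEnergy s μ ν + gaussEnergy s ν μ ≤ gaussEnergy s μ μ + gaussEnergy s ν ν ∧
    (gaussEnergy s μ ν + gaussEnergy s ν μ = gaussEnergy s μ μ + gaussEnergy s ν ν → μ = ν) := by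
  have hb : 0 < 1 / (4 * s) := by positivity
  have h := gaussEnergy_quadratic hb μ ν
  have e : 1 / (4 * (1 / (4 * s))) = s := by field_simp
  rw [e] at h
  have hc : 0 < (π / (1 / (4 * s))) ^ (Module.finrank ℝ V / 2 : ℝ) := by positivity
  have h0 : 0 ≤ ∫ v : V, rexp (-(1 / (4 * s)) * ‖v‖ ^ 2) * ‖charFun μ v - charFun ν v‖ ^ 2 :=
    integral_nonneg fun v => by positivity
  refine ⟨?_, fun heq => ?_⟩
  · rw [← h] at h0
    have := nonneg_of_mul_nonneg_right h0 hc
    linarith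
  · have hz : ∫ v : V, rexp (-(1 / (4 * s)) * ‖v‖ ^ 2) * ‖charFun μ v - charFun ν v‖ ^ 2 = 0 := by
      rw [← h, heq]; simp
    have hcm : Continuous (charFun μ) := continuous_charFun_of_finite μ
    have hcn : Continuous (charFun ν) := continuous_charFun_of_finite ν
    have hcont : Continuous fun v : V => rexp (-(1 / (4 * s)) * ‖v‖ ^ 2) * ‖charFun μ v - charFun ν v‖ ^ 2 := by
      fun_prop
    have hint : Integrable fun v : V => rexp (-(1 / (4 * s)) * ‖v‖ ^ 2) * ‖charFun μ v - charFun ν v‖ ^ 2 := by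
      have h1 : Integrable fun v : V => rexp (-(1 / (4 * s)) * ‖v‖ ^ 2) := by
        have hb' : 0 < ((1 / (4 * s) : ℝ) : ℂ).re := by simpa using hs
        have := (GaussianFourier.integrable_cexp_neg_mul_sq_norm_add hb' 0 (0 : V)).norm
        refine this.congr (ae_of_all _ fun v => ?_)
        have e : -((1 / (4 * s) : ℝ) : ℂ) * (‖v‖ : ℂ) ^ 2 + 0 * (inner ℝ 0 v : ℝ) =
            ((-(1 / (4 * s)) * ‖v‖ ^ 2 : ℝ) : ℂ) := by
          push_cast; ring
        simp only
        rw [Complex.norm_exp, e, Complex.ofReal_re]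
      refine h1.mul_bdd (c := (μ.real univ + ν.real univ) ^ 2) (by fun_prop) (ae_of_all _ fun v => ?_)
      rw [norm_pow, norm_norm]
      gcongr
      exact (norm_sub_le _ _).trans (add_le_add (norm_charFun_le v) (norm_charFun_le v))
    rw [integral_eq_zero_iff_of_nonneg (fun v => by positivity) hint] at hz
    have hz' := (hcont.ae_eq_iff_eq volume (continuous_const (y := (0:ℝ)))).1 hz
    refine Measure.ext_of_charFun (funext fun v => ?_)
    have := congrFun hz' v
    simp only [mul_eq_zero, (Real.exp_pos _).ne', false_or] at this
    exact sub_eq_zero.1 (by simpa using this)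

end Gaussian

section
variable {V : Type*} [NormedAddCommGroup V]

/-- The Newtonian kernel is a positive mixture of Gaussians; both sides are `∞` on the diagonal. -/
theorem inv_edist_eq_lintegral (x y : V) : (edist x y)⁻¹ =
    ENNReal.ofReal (√π)⁻¹ * ∫⁻ s in Ioi 0, ENNReal.ofReal (s ^ (-(1 / 2) : ℝ)) * ENNReal.ofReal (rexp (-(s * ‖x - y‖ ^ 2))) := by
  have hπ : 0 < √π := Real.sqrt_pos.2 pi_pos
  rcases eq_or_ne x y with rfl | hne
  · have : ∫⁻ s in Ioi (0:ℝ), ENNReal.ofReal (s ^ (-(1 / 2) : ℝ)) = ∞ := by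
      by_contra h
      refine not_integrableOn_Ioi_rpow (-(1 / 2)) ⟨by fun_prop, ?_⟩
      rw [hasFiniteIntegral_iff_ofReal]
      · exact lt_top_iff_ne_top.2 h
      · exact ae_restrict_of_forall_mem measurableSet_Ioi fun s hs => Real.rpow_nonneg (le_of_lt hs) _
    simp only [sub_self, norm_zero, ne_eq, OfNat.ofNat_ne_zero, not_false_eq_true, zero_pow, mul_zero,
      neg_zero, Real.exp_zero, ENNReal.ofReal_one, mul_one, this, edist_self, ENNReal.inv_zero]
    exact (ENNReal.mul_top (by simpa using pi_pos)).symm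
  · have hd : 0 < ‖x - y‖ := norm_pos_iff.2 (sub_ne_zero.2 hne)
    have key := Real.integral_rpow_mul_exp_neg_mul_Ioi (a := 1 / 2) (r := ‖x - y‖ ^ 2) (by norm_num) (by positivity)
    rw [Real.Gamma_one_half_eq, show (1 / 2 - 1 : ℝ) = -(1 / 2) by norm_num, ← Real.sqrt_eq_rpow,
      Real.sqrt_div zero_le_one, Real.sqrt_one, Real.sqrt_sq hd.le] at key
    have hint : IntegrableOn (fun t : ℝ => t ^ (-(1 / 2) : ℝ) * rexp (-(‖x - y‖ ^ 2 * t))) (Ioi 0) := by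
      by_contra h
      rw [integral_undef h] at key
      have : 0 < 1 / ‖x - y‖ * √π := by positivity
      linarith
    have h2 := ofReal_integral_eq_lintegral_ofReal hint
      (ae_restrict_of_forall_mem measurableSet_Ioi fun s hs => mul_nonneg (Real.rpow_nonneg (le_of_lt hs) _) (Real.exp_pos _).le)
    rw [key] at h2
    have h3 : ∫⁻ s in Ioi 0, ENNReal.ofReal (s ^ (-(1 / 2) : ℝ)) * ENNReal.ofReal (rexp (-(s * ‖x - y‖ ^ 2)))
        = ENNReal.ofReal (1 / ‖x - y‖ * √π) := by
      rw [h2]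
      refine setLIntegral_congr_fun measurableSet_Ioi fun s hs => ?_
      rw [← ENNReal.ofReal_mul (Real.rpow_nonneg (le_of_lt hs) _), mul_comm s]
    rw [h3, ← ENNReal.ofReal_mul (by positivity), edist_dist, dist_eq_norm, ← ENNReal.ofReal_inv_of_pos hd]
    congr 1
    field_simp

end

/-- The mutual Newtonian energy `∬ 1 / |x - y| dν(y) dμ(x)`, with values in `[0, ∞]`; on the diagonal it
is `energy`. -/
noncomputable def mutualEnergy (μ ν : Measure S2) : ℝ≥0∞ := ∫⁻ x, ∫⁻ y, (edist x y)⁻¹ ∂ν ∂μ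

theorem measurable_inv_edist : Measurable fun p : S2 × S2 => (edist p.1 p.2)⁻¹ :=
  (measurable_edist).inv

theorem mutualEnergy_comm (μ ν : Measure S2) [SFinite μ] [SFinite ν] : mutualEnergy μ ν = mutualEnergy ν μ := by
  unfold mutualEnergy
  rw [lintegral_lintegral_swap measurable_inv_edist.aemeasurable]
  simp_rw [edist_comm]

theorem integrable_exp_neg_dist {s : ℝ} (hs : 0 ≤ s) (μ ν : Measure S2) [IsFiniteMeasure μ] [IsFiniteMeasure ν] :
    Integrable (fun p : S2 × S2 => rexp (-(s * ‖p.1.1 - p.2.1‖ ^ 2))) (μ.prod ν) := by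
  refine (integrable_const (1 : ℝ)).mono' (by fun_prop) (ae_of_all _ fun p => ?_)
  rw [Real.norm_eq_abs, abs_of_pos (Real.exp_pos _), Real.exp_le_one_iff, neg_nonpos]
  positivity

theorem mutualEnergy_eq_lintegral (μ ν : Measure S2) [IsFiniteMeasure μ] [IsFiniteMeasure ν] :
    mutualEnergy μ ν = ENNReal.ofReal (√π)⁻¹ * ∫⁻ s in Ioi 0, ENNReal.ofReal (s ^ (-(1 / 2) : ℝ)) *
      ENNReal.ofReal (gaussEnergy s (μ.map Subtype.val) (ν.map Subtype.val)) := by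
  have h1 : mutualEnergy μ ν = ∫⁻ p, (edist p.1 p.2)⁻¹ ∂(μ.prod ν) :=
    (lintegral_prod _ measurable_inv_edist.aemeasurable).symm
  have h2 : ∀ p : S2 × S2, (edist p.1 p.2)⁻¹ = ENNReal.ofReal (√π)⁻¹ *
      ∫⁻ s in Ioi 0, ENNReal.ofReal (s ^ (-(1 / 2) : ℝ)) * ENNReal.ofReal (rexp (-(s * ‖p.1.1 - p.2.1‖ ^ 2))) :=
    fun p => inv_edist_eq_lintegral p.1.1 p.2.1
  rw [h1, lintegral_congr h2, lintegral_const_mul']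
  · congr 1
    rw [lintegral_lintegral_swap (by fun_prop)]
    refine setLIntegral_congr_fun measurableSet_Ioi fun s hs => ?_
    rw [lintegral_const_mul' _ _ ENNReal.ofReal_ne_top]
    congr 1
    unfold gaussEnergy
    have hm : (μ.map Subtype.val).prod (ν.map Subtype.val) =
        (μ.prod ν).map (Prod.map (Subtype.val : S2 → _) (Subtype.val : S2 → _)) :=
      Measure.map_prod_map μ ν measurable_subtype_coe measurable_subtype_coe
    rw [hm, integral_map (by fun_prop) (by fun_prop), ofReal_integral_eq_lintegral_ofReal]
    · rfl
    · exact integrable_exp_neg_dist hs.le μ ν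
    · exact ae_of_all _ fun p => (Real.exp_pos _).le
  · exact ENNReal.ofReal_ne_top

/-- The Newtonian kernel is strictly positive definite: `I(μ - ν) ≤ 0` forces `μ = ν` when both energies
are finite. The inequality is stated without subtraction, so that the mutual energy may be infinite. -/
theorem eq_of_energy_le (μ ν : Measure S2) [IsFiniteMeasure μ] [IsFiniteMeasure ν]
    (hμ : energy μ ≠ ∞) (hν : energy ν ≠ ∞) (h : energy μ + energy ν ≤ mutualEnergy μ ν + mutualEnergy ν μ) :
    μ = ν := by
  set μ' : Measure (EuclideanSpace ℝ (Fin 3)) := μ.map Subtype.val with hμ'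
  set ν' : Measure (EuclideanSpace ℝ (Fin 3)) := ν.map Subtype.val with hν'
  have hc0 : ENNReal.ofReal (√π)⁻¹ ≠ 0 := by simp [pi_pos]
  have hct : ENNReal.ofReal (√π)⁻¹ ≠ ∞ := ENNReal.ofReal_ne_top
  have hg0 : ∀ s (ρ τ : Measure (EuclideanSpace ℝ (Fin 3))), 0 ≤ gaussEnergy s ρ τ := fun s ρ τ =>
    integral_nonneg fun p => (Real.exp_pos _).le
  have hgm : ∀ (ρ τ : Measure (EuclideanSpace ℝ (Fin 3))) [IsFiniteMeasure ρ] [IsFiniteMeasure τ],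
      Measurable fun s : ℝ => ENNReal.ofReal (s ^ (-(1 / 2) : ℝ)) * ENNReal.ofReal (gaussEnergy s ρ τ) := by
    intro ρ τ _ _
    have : StronglyMeasurable fun s : ℝ => gaussEnergy s ρ τ := by
      unfold gaussEnergy
      refine StronglyMeasurable.integral_prod_right' (f := fun q : ℝ × (EuclideanSpace ℝ (Fin 3) × EuclideanSpace ℝ (Fin 3)) => rexp (-(q.1 * ‖q.2.1 - q.2.2‖ ^ 2))) ?_
      exact (by fun_prop : Measurable _).stronglyMeasurable
    have := this.measurable
    fun_prop
  have hE : ∀ ρ : Measure S2, energy ρ = mutualEnergy ρ ρ := fun _ => rfl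
  rw [hE μ, mutualEnergy_eq_lintegral] at hμ
  rw [hE ν, mutualEnergy_eq_lintegral] at hν
  rw [hE μ, hE ν] at h
  simp only [mutualEnergy_eq_lintegral, ← hμ', ← hν'] at h hμ hν
  rw [← mul_add, ← mul_add, ENNReal.mul_le_mul_iff_right hc0 hct, ← lintegral_add_left (hgm _ _),
    ← lintegral_add_left (hgm _ _)] at h
  have hle : ∀ᵐ s ∂(volume.restrict (Ioi (0:ℝ))),
      ENNReal.ofReal (s ^ (-(1 / 2) : ℝ)) * ENNReal.ofReal (gaussEnergy s μ' ν') +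
        ENNReal.ofReal (s ^ (-(1 / 2) : ℝ)) * ENNReal.ofReal (gaussEnergy s ν' μ') ≤
      ENNReal.ofReal (s ^ (-(1 / 2) : ℝ)) * ENNReal.ofReal (gaussEnergy s μ' μ') +
        ENNReal.ofReal (s ^ (-(1 / 2) : ℝ)) * ENNReal.ofReal (gaussEnergy s ν' ν') := by
    refine ae_restrict_of_forall_mem measurableSet_Ioi fun s hs => ?_
    rw [← mul_add, ← mul_add, ← ENNReal.ofReal_add (hg0 _ _ _) (hg0 _ _ _), ← ENNReal.ofReal_add (hg0 _ _ _) (hg0 _ _ _)]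
    exact mul_le_mul_right (ENNReal.ofReal_le_ofReal (eq_of_gaussEnergy_le hs μ' ν').1) _
  have hfin : ∀ {x : ℝ≥0∞}, ENNReal.ofReal (√π)⁻¹ * x ≠ ∞ → x ≠ ∞ := by
    rintro x hx rfl
    exact hx (ENNReal.mul_top hc0)
  have key := ae_eq_of_ae_le_of_lintegral_le hle ?_
    ((hgm μ' μ').add (hgm ν' ν')).aemeasurable h
  · have hex : ∃ s : ℝ, 0 < s ∧ ENNReal.ofReal (s ^ (-(1 / 2) : ℝ)) * ENNReal.ofReal (gaussEnergy s μ' ν') +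
      ENNReal.ofReal (s ^ (-(1 / 2) : ℝ)) * ENNReal.ofReal (gaussEnergy s ν' μ') =
      ENNReal.ofReal (s ^ (-(1 / 2) : ℝ)) * ENNReal.ofReal (gaussEnergy s μ' μ') +
      ENNReal.ofReal (s ^ (-(1 / 2) : ℝ)) * ENNReal.ofReal (gaussEnergy s ν' ν') := by
      -- the mixture has positive density, so equality of the energies forces equality at some `s > 0`
      have : (ae (volume.restrict (Ioi (0:ℝ)))).NeBot := by
        rw [ae_neBot, Ne, Measure.restrict_eq_zero]; simp
      obtain ⟨s, h1, h2⟩ := (key.and (ae_restrict_mem measurableSet_Ioi)).exists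
      exact ⟨s, h2, h1⟩
    obtain ⟨s, hs, heq⟩ := hex
    rw [← mul_add, ← mul_add, ENNReal.mul_right_inj (by simpa using Real.rpow_pos_of_pos hs _) ENNReal.ofReal_ne_top,
      ← ENNReal.ofReal_add (hg0 _ _ _) (hg0 _ _ _), ← ENNReal.ofReal_add (hg0 _ _ _) (hg0 _ _ _),
      ENNReal.ofReal_eq_ofReal_iff (add_nonneg (hg0 _ _ _) (hg0 _ _ _)) (add_nonneg (hg0 _ _ _) (hg0 _ _ _))] at heq
    have h3 := (eq_of_gaussEnergy_le hs μ' ν').2 heq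
    exact (MeasurableEmbedding.subtype_coe Metric.isClosed_sphere.measurableSet).map_injective h3
  · refine ne_top_of_le_ne_top ?_ (lintegral_mono_ae hle)
    rw [lintegral_add_left (hgm _ _)]
    exact ENNReal.add_ne_top.2 ⟨hfin hμ, hfin hν⟩

/-! ### Rotations and measures of revolution -/

theorem sum_sq_coord (x : S2) : x.1 0 ^ 2 + x.1 1 ^ 2 + x.1 2 ^ 2 = 1 := by
  have h := mem_sphere_zero_iff_norm.1 x.2
  rw [EuclideanSpace.norm_eq, Real.sqrt_eq_one, Fin.sum_univ_three] at h
  simpa using h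

theorem ext_coord {x y : S2} (h0 : x.1 0 = y.1 0) (h1 : x.1 1 = y.1 1) (h2 : x.1 2 = y.1 2) : x = y := by
  apply Subtype.ext
  ext i
  fin_cases i
  · exact h0
  · exact h1
  · exact h2

@[simp] theorem sph_zero (θ φ : ℝ) : (sph θ φ).1 0 = sin φ * cos θ := by simp [sph]
@[simp] theorem sph_one (θ φ : ℝ) : (sph θ φ).1 1 = sin φ * sin θ := by simp [sph]
@[simp] theorem sph_two (θ φ : ℝ) : (sph θ φ).1 2 = cos φ := by simp [sph]

/-- The rotation by the angle `θ` about the polar axis. -/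
noncomputable def rot (θ : ℝ) (x : S2) : S2 :=
  ⟨!₂[cos θ * x.1 0 - sin θ * x.1 1, sin θ * x.1 0 + cos θ * x.1 1, x.1 2], by
    rw [mem_sphere_zero_iff_norm, EuclideanSpace.norm_eq, Real.sqrt_eq_one]
    simp only [Fin.sum_univ_three, Real.norm_eq_abs, sq_abs]
    simp only [Matrix.cons_val_zero, Matrix.cons_val_one, Matrix.cons_val]
    have h2 := sin_sq_add_cos_sq θ
    linear_combination (x.1 0 ^ 2 + x.1 1 ^ 2) * h2 + sum_sq_coord x⟩

@[simp] theorem rot_zero (θ : ℝ) (x : S2) : (rot θ x).1 0 = cos θ * x.1 0 - sin θ * x.1 1 := by simp [rot]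
@[simp] theorem rot_one (θ : ℝ) (x : S2) : (rot θ x).1 1 = sin θ * x.1 0 + cos θ * x.1 1 := by simp [rot]
@[simp] theorem rot_two (θ : ℝ) (x : S2) : (rot θ x).1 2 = x.1 2 := by simp [rot]

theorem continuous_rot : Continuous fun p : ℝ × S2 => rot p.1 p.2 := by
  refine Continuous.subtype_mk ?_ _
  refine (PiLp.continuous_toLp 2 _).comp (continuous_pi fun i => ?_)
  fin_cases i <;> simp <;> fun_prop

theorem measurable_rot (θ : ℝ) : Measurable (rot θ) :=
  (continuous_rot.comp (Continuous.prodMk_right θ)).measurable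

theorem rot_sph (θ θ' φ : ℝ) : rot θ (sph θ' φ) = sph (θ + θ') φ := by
  apply ext_coord <;> simp [cos_add, sin_add] <;> ring

theorem rot_neg_rot (θ : ℝ) (x : S2) : rot (-θ) (rot θ x) = x := by
  have := sin_sq_add_cos_sq θ
  apply ext_coord <;> simp
  · linear_combination x.1 0 * this
  · linear_combination x.1 1 * this

/-- The rotation `rot θ` as a measurable equivalence, with inverse `rot (-θ)`. -/
noncomputable def rotEquiv (θ : ℝ) : S2 ≃ᵐ S2 where
  toFun := rot θ
  invFun := rot (-θ)
  left_inv := rot_neg_rot θ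
  right_inv x := by simpa using rot_neg_rot (-θ) x
  measurable_toFun := measurable_rot θ
  measurable_invFun := measurable_rot (-θ)

theorem edist_rot (θ : ℝ) (x y : S2) : edist (rot θ x) (rot θ y) = edist x y := by
  rw [edist_dist, edist_dist, Subtype.dist_eq, Subtype.dist_eq, EuclideanSpace.dist_eq, EuclideanSpace.dist_eq]
  congr 2
  simp only [Fin.sum_univ_three, Real.dist_eq, sq_abs, rot_zero, rot_one, rot_two]
  have := sin_sq_add_cos_sq θ
  linear_combination ((x.1 0 - y.1 0) ^ 2 + (x.1 1 - y.1 1) ^ 2) * this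

/-- The polar angle of a point, in `[0, π]`. -/
noncomputable def polar (x : S2) : ℝ := arccos (x.1 2)

theorem continuous_polar : Continuous polar := by
  unfold polar
  exact continuous_arccos.comp (by fun_prop)

theorem polar_mem (x : S2) : polar x ∈ Icc 0 π := ⟨arccos_nonneg _, arccos_le_pi _⟩

theorem polar_sph (θ : ℝ) {φ : ℝ} (hφ : φ ∈ Icc 0 π) : polar (sph θ φ) = φ := by
  unfold polar
  rw [sph_two, arccos_cos hφ.1 hφ.2]

theorem cos_polar (x : S2) : cos (polar x) = x.1 2 := by
  have := sum_sq_coord x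
  unfold polar
  rw [cos_arccos] <;> nlinarith [sq_nonneg (x.1 0), sq_nonneg (x.1 1)]

theorem sph_add_two_pi (θ φ : ℝ) : sph (θ + 2 * π) φ = sph θ φ := by
  apply ext_coord <;> simp

theorem exists_eq_sph (x : S2) : ∃ θ ∈ Icc 0 (2 * π), x = sph θ (polar x) := by
  set z : ℂ := ⟨x.1 0, x.1 1⟩ with hz
  have hsin : ‖z‖ = sin (polar x) := by
    have h1 : 0 ≤ sin (polar x) := sin_nonneg_of_nonneg_of_le_pi (polar_mem x).1 (polar_mem x).2
    rw [← sq_eq_sq₀ (norm_nonneg _) h1, ← Complex.normSq_eq_norm_sq, Complex.normSq_mk, sin_sq, cos_polar]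
    linarith [sum_sq_coord x]
  have key : x = sph z.arg (polar x) := by
    apply ext_coord
    · rw [sph_zero, ← hsin, Complex.norm_mul_cos_arg]
    · rw [sph_one, ← hsin, Complex.norm_mul_sin_arg]
    · rw [sph_two, cos_polar]
  rcases le_or_gt 0 z.arg with h | h
  · exact ⟨z.arg, ⟨h, by linarith [Complex.arg_le_pi z, pi_pos]⟩, key⟩
  · exact ⟨z.arg + 2 * π, ⟨by linarith [Complex.neg_pi_lt_arg z, pi_pos], by linarith⟩, by rw [sph_add_two_pi]; exact key⟩

theorem mem_northCap_iff {α : ℝ} (hα : α ≤ π) (x : S2) : x ∈ northCap α ↔ polar x ≤ α := by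
  constructor
  · rintro ⟨⟨θ, φ⟩, ⟨-, hφ⟩, rfl⟩
    simp only at hφ ⊢
    rw [polar_sph θ ⟨hφ.1, hφ.2.trans hα⟩]
    exact hφ.2
  · intro h
    obtain ⟨θ, hθ, hx⟩ := exists_eq_sph x
    exact ⟨(θ, polar x), ⟨hθ, (polar_mem x).1, h⟩, hx.symm⟩

theorem measurable_sph : Measurable fun p : ℝ × ℝ => sph p.1 p.2 := continuous_sph.measurable

/-- An integral over a full parallel does not depend on the origin of the azimuth. -/
theorem lintegral_sph_add (h : S2 → ℝ≥0∞) (c φ : ℝ) :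
    ∫⁻ θ in Ioo 0 (2 * π), h (sph (θ + c) φ) = ∫⁻ θ in Ioo 0 (2 * π), h (sph θ φ) := by
  have h2π : 0 < 2 * π := by positivity
  have e : ∀ (a : ℝ) (H : ℝ → ℝ≥0∞), ∫⁻ θ in Ioo a (a + 2 * π), H θ = ∫⁻ θ in Ioc a (a + 2 * π), H θ := fun a H =>
    setLIntegral_congr Ioo_ae_eq_Ioc
  have h1 : ∫⁻ θ in Ioo 0 (2 * π), h (sph (θ + c) φ) = ∫⁻ θ in Ioo c (c + 2 * π), h (sph θ φ) := by
    have := (measurePreserving_add_right volume c).setLIntegral_comp_emb (measurableEmbedding_addRight c)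
      (fun θ => h (sph θ φ)) (Ioo 0 (2 * π))
    rw [this, image_add_const_Ioo, zero_add, add_comm c]
  have h3 := e 0 (fun θ => h (sph θ φ))
  rw [zero_add] at h3
  rw [h1, e, h3]
  have := (isAddFundamentalDomain_Ioc h2π c volume).setLIntegral_eq (isAddFundamentalDomain_Ioc h2π 0 volume)
    (fun θ => h (sph θ φ)) ?_
  · rwa [zero_add] at this
  · rintro ⟨g, hg⟩ θ
    obtain ⟨n, rfl⟩ := AddSubgroup.mem_zmultiples_iff.1 hg
    have hper : Function.Periodic (fun θ => h (sph θ φ)) (2 * π) := fun θ => by simp only [sph_add_two_pi]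
    have := (hper.zsmul n) θ
    rw [AddSubgroup.vadd_def, vadd_eq_add, add_comm]
    exact this

theorem ofReal_two_pi_ne : ENNReal.ofReal (2 * π) ≠ 0 ∧ ENNReal.ofReal (2 * π) ≠ ∞ :=
  ⟨by simp [pi_pos], ENNReal.ofReal_ne_top⟩

/-- The mean of `h` over the parallel of polar angle `φ`. -/
noncomputable def parallelMean (h : S2 → ℝ≥0∞) (φ : ℝ) : ℝ≥0∞ :=
  (ENNReal.ofReal (2 * π))⁻¹ * ∫⁻ θ in Ioo 0 (2 * π), h (sph θ φ)

theorem measurable_parallelMean {h : S2 → ℝ≥0∞} (hh : Measurable h) : Measurable (parallelMean h) := by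
  unfold parallelMean
  refine Measurable.const_mul ?_ _
  exact Measurable.lintegral_prod_left' (f := fun p : ℝ × ℝ => h (sph p.1 p.2)) (hh.comp measurable_sph)

/-- The measure on the sphere that is invariant under rotations about the polar axis and has the polar
law `M`: the image of (uniform azimuth) `× M`. It is meaningful for `M` carried by `[0, π]`. -/
noncomputable def revolve (M : Measure ℝ) : Measure S2 :=
  (((ENNReal.ofReal (2 * π))⁻¹ • volume.restrict (Ioo 0 (2 * π))).prod M).map fun p : ℝ × ℝ => sph p.1 p.2

theorem lintegral_revolve (M : Measure ℝ) [SFinite M] {h : S2 → ℝ≥0∞} (hh : Measurable h) :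
    ∫⁻ x, h x ∂(revolve M) = ∫⁻ φ, parallelMean h φ ∂M := by
  unfold revolve parallelMean
  rw [lintegral_map hh measurable_sph, lintegral_prod_symm' (fun p : ℝ × ℝ => h (sph p.1 p.2)) (hh.comp measurable_sph)]
  simp_rw [lintegral_smul_measure, smul_eq_mul]

theorem parallelMean_const (c : ℝ≥0∞) (φ : ℝ) : parallelMean (fun _ => c) φ = c := by
  unfold parallelMean
  rw [setLIntegral_const, Real.volume_Ioo, sub_zero, mul_comm c, ← mul_assoc,
    ENNReal.inv_mul_cancel ofReal_two_pi_ne.1 ofReal_two_pi_ne.2, one_mul]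

theorem parallelMean_of_rot {h : S2 → ℝ≥0∞} (hr : ∀ θ φ, h (sph θ φ) = h (sph 0 φ)) (φ : ℝ) :
    parallelMean h φ = h (sph 0 φ) := by
  rw [← parallelMean_const (h (sph 0 φ)) φ]
  unfold parallelMean
  simp_rw [hr _ φ]

theorem revolve_univ (M : Measure ℝ) [SFinite M] : revolve M univ = M univ := by
  rw [← lintegral_one, ← lintegral_one, lintegral_revolve M measurable_const]
  exact lintegral_congr fun φ => parallelMean_const 1 φ

instance (M : Measure ℝ) [IsFiniteMeasure M] : IsFiniteMeasure (revolve M) :=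
  ⟨by rw [revolve_univ]; exact measure_lt_top M univ⟩

/-- A rotation invariant measure is determined by the law of the polar angle. -/
theorem eq_revolve_of_rot_invariant (μ : Measure S2) [IsFiniteMeasure μ] (hμ : ∀ θ, μ.map (rot θ) = μ) :
    μ = revolve (μ.map polar) := by
  refine Measure.ext_of_lintegral _ fun h hh => ?_
  rw [lintegral_revolve _ hh, lintegral_map (measurable_parallelMean hh) continuous_polar.measurable]
  have h1 : ∀ θ, ∫⁻ x, h (rot θ x) ∂μ = ∫⁻ x, h x ∂μ := fun θ => by
    conv_rhs => rw [← hμ θ]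
    rw [lintegral_map hh (measurable_rot θ)]
  have h2 : ∀ x, parallelMean h (polar x) = (ENNReal.ofReal (2 * π))⁻¹ * ∫⁻ θ in Ioo 0 (2 * π), h (rot θ x) := by
    intro x
    obtain ⟨θ₀, -, hx⟩ := exists_eq_sph x
    unfold parallelMean
    rw [← lintegral_sph_add h θ₀]
    congr 1
    refine lintegral_congr fun θ => ?_
    conv_rhs => rw [hx, rot_sph]
  simp_rw [h2]
  rw [lintegral_const_mul', lintegral_lintegral_swap]
  · simp_rw [h1]
    rw [setLIntegral_const, Real.volume_Ioo, sub_zero, mul_comm (∫⁻ x, h x ∂μ), ← mul_assoc,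
      ENNReal.inv_mul_cancel ofReal_two_pi_ne.1 ofReal_two_pi_ne.2, one_mul]
  · exact (hh.comp (continuous_rot.measurable.comp measurable_swap)).aemeasurable
  · exact ENNReal.inv_ne_top.2 ofReal_two_pi_ne.1

/-! ### Potentials of measures of revolution -/

/-- The Newtonian potential `∫ 1 / |x - y| dν(y)`, with values in `[0, ∞]`. -/
noncomputable def potential (ν : Measure S2) (x : S2) : ℝ≥0∞ := ∫⁻ y, (edist x y)⁻¹ ∂ν

theorem measurable_inv_edist_right (x : S2) : Measurable fun y : S2 => (edist x y)⁻¹ :=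
  measurable_edist_right.inv

theorem measurable_potential (ν : Measure S2) [SFinite ν] : Measurable (potential ν) :=
  Measurable.lintegral_prod_right' measurable_inv_edist

theorem potential_revolve_sph (M : Measure ℝ) [SFinite M] (θ ξ : ℝ) :
    potential (revolve M) (sph θ ξ) = potential (revolve M) (sph 0 ξ) := by
  unfold potential
  rw [lintegral_revolve M (measurable_inv_edist_right _), lintegral_revolve M (measurable_inv_edist_right _)]
  refine lintegral_congr fun φ => ?_
  unfold parallelMean
  rw [← lintegral_sph_add (fun y => (edist (sph θ ξ) y)⁻¹) θ]
  congr 1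
  refine lintegral_congr fun θ' => ?_
  show _ = (edist (sph 0 ξ) (sph θ' φ))⁻¹
  rw [← edist_rot θ (sph 0 ξ), rot_sph, rot_sph, add_zero, add_comm θ θ']

/-- The Abel transform `∫_{φ > t} dM(φ) / √(cos t - cos φ)` of a polar law. -/
noncomputable def abelTransform (M : Measure ℝ) (t : ℝ) : ℝ≥0∞ := ∫⁻ φ, abelKernel t φ ∂M

theorem measurable_abelTransform (M : Measure ℝ) [SFinite M] : Measurable (abelTransform M) :=
  Measurable.lintegral_prod_right' measurable_abelKernel

/-- The potential of a measure of revolution is obtained from its polar law by two Abel transforms. -/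
theorem potential_revolve (M : Measure ℝ) [SFinite M] (hM : ∀ᵐ φ ∂M, φ ∈ Ioo 0 π) {ξ : ℝ} (hξ : ξ ∈ Ioo 0 π)
    (hMξ : M {ξ} = 0) :
    potential (revolve M) (sph 0 ξ) =
      (ENNReal.ofReal π)⁻¹ * ∫⁻ t in Ioo 0 π, abelTransform M t * abelKernel t ξ := by
  unfold potential abelTransform
  rw [lintegral_revolve M (measurable_inv_edist_right _)]
  have h1 : ∀ᵐ φ ∂M, parallelMean (fun y => (edist (sph 0 ξ) y)⁻¹) φ =
      (ENNReal.ofReal π)⁻¹ * ∫⁻ t in Ioo 0 π, abelKernel t φ * abelKernel t ξ := by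
    have h2 : ∀ᵐ φ ∂M, φ ≠ ξ := by rw [ae_iff]; simpa using hMξ
    filter_upwards [hM, h2] with φ hφ hne
    unfold parallelMean
    have := lintegral_inv_edist hξ hφ hne
    simp_rw [edist_comm (sph 0 ξ)]
    rw [this, ENNReal.ofReal_mul (by norm_num), ENNReal.mul_inv (by simp) (by simp), ENNReal.ofReal_ofNat,
      mul_comm (2⁻¹ : ℝ≥0∞), mul_assoc, ← mul_assoc (2⁻¹ : ℝ≥0∞), ENNReal.inv_mul_cancel (by simp) (by simp), one_mul]
  have hm : Measurable fun p : ℝ × ℝ => abelKernel p.2 p.1 * abelKernel p.2 ξ :=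
    (measurable_abelKernel.comp measurable_swap).mul
      (measurable_abelKernel.comp (measurable_snd.prodMk measurable_const))
  rw [lintegral_congr_ae h1, lintegral_const_mul', lintegral_lintegral_swap hm.aemeasurable]
  · congr 1
    refine lintegral_congr fun t => ?_
    rw [lintegral_mul_const]
    exact measurable_abelKernel.comp measurable_prodMk_left
  · exact ENNReal.inv_ne_top.2 (by simp [pi_pos])

/-- A parallel of positive mass has infinite potential on itself, the kernel being at least `1 / θ` at
azimuthal distance `θ`. -/
theorem measure_singleton_eq_zero_of_potential (M : Measure ℝ) [SFinite M] {ξ : ℝ}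
    (h : potential (revolve M) (sph 0 ξ) ≠ ∞) : M {ξ} = 0 := by
  by_contra hM
  apply h
  unfold potential
  rw [lintegral_revolve M (measurable_inv_edist_right _)]
  have h1 : parallelMean (fun y => (edist (sph 0 ξ) y)⁻¹) ξ = ∞ := by
    unfold parallelMean
    -- on its own parallel the kernel dominates `1 / θ`
    have h2 : ∫⁻ θ in Ioo 0 (2 * π), ENNReal.ofReal θ⁻¹ = ∞ := by
      by_contra hfin
      have h3 : ¬ IntervalIntegrable (fun x : ℝ => x⁻¹) volume 0 (2 * π) := by
        rw [intervalIntegrable_inv_iff]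
        push Not
        exact ⟨by positivity, left_mem_uIcc⟩
      rw [intervalIntegrable_iff_integrableOn_Ioo_of_le (by positivity)] at h3
      refine h3 ⟨by fun_prop, ?_⟩
      rw [hasFiniteIntegral_iff_ofReal]
      · exact lt_top_iff_ne_top.2 hfin
      · exact ae_restrict_of_forall_mem measurableSet_Ioo fun s hs => inv_nonneg.2 hs.1.le
    have h4 : ∫⁻ θ in Ioo 0 (2 * π), (edist (sph 0 ξ) (sph θ ξ))⁻¹ = ∞ := by
      rw [eq_top_iff, ← h2]
      refine setLIntegral_mono' measurableSet_Ioo fun θ hθ => ?_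
      rw [ENNReal.ofReal_inv_of_pos hθ.1, ENNReal.inv_le_inv, edist_dist]
      refine ENNReal.ofReal_le_ofReal ?_
      rw [← sq_le_sq₀ dist_nonneg hθ.1.le, dist_sph_sq, zero_sub, cos_neg]
      have h5 := one_sub_sq_div_two_le_cos (x := θ)
      have h6 := sin_sq_add_cos_sq ξ
      have h7 := sin_sq_le_one ξ
      nlinarith [sq_nonneg (sin ξ), cos_le_one θ]
    rw [h4]
    exact ENNReal.mul_top (ENNReal.inv_ne_zero.2 ofReal_two_pi_ne.2)
  rw [eq_top_iff]
  calc ∞ = ∫⁻ φ in {ξ}, parallelMean (fun y => (edist (sph 0 ξ) y)⁻¹) φ ∂M := by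
        rw [lintegral_singleton, h1, ENNReal.top_mul hM]
    _ ≤ _ := setLIntegral_le_lintegral _ _

/-! ### Extremal measures and the Frostman conditions -/

theorem mutualEnergy_eq_lintegral_potential (μ ν : Measure S2) : mutualEnergy μ ν = ∫⁻ x, potential ν x ∂μ := rfl

theorem energy_eq_mutualEnergy (μ : Measure S2) : energy μ = mutualEnergy μ μ := rfl

theorem mutualEnergy_add_left (μ₁ μ₂ ν : Measure S2) :
    mutualEnergy (μ₁ + μ₂) ν = mutualEnergy μ₁ ν + mutualEnergy μ₂ ν := lintegral_add_measure _ _ _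

theorem mutualEnergy_smul_left (c : ℝ≥0∞) (μ ν : Measure S2) :
    mutualEnergy (c • μ) ν = c * mutualEnergy μ ν := lintegral_smul_measure _ _

theorem mutualEnergy_smul_right (c : ℝ≥0∞) (μ ν : Measure S2) [SFinite ν] :
    mutualEnergy μ (c • ν) = c * mutualEnergy μ ν := by
  simp only [mutualEnergy_eq_lintegral_potential]
  rw [← lintegral_const_mul _ (measurable_potential ν)]
  exact lintegral_congr fun x => lintegral_smul_measure _ _

theorem mutualEnergy_add_right (μ ν₁ ν₂ : Measure S2) [SFinite ν₁] :
    mutualEnergy μ (ν₁ + ν₂) = mutualEnergy μ ν₁ + mutualEnergy μ ν₂ := by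
  simp only [mutualEnergy_eq_lintegral_potential]
  rw [← lintegral_add_left (measurable_potential ν₁)]
  exact lintegral_congr fun x => lintegral_add_measure _ _ _

theorem energy_smul_add_smul (a b : ℝ≥0∞) (μ ν : Measure S2) [IsFiniteMeasure μ] [IsFiniteMeasure ν] :
    energy (a • μ + b • ν) = a * a * energy μ + 2 * (a * b * mutualEnergy μ ν) + b * b * energy ν := by
  rw [energy_eq_mutualEnergy, mutualEnergy_add_left, mutualEnergy_add_right, mutualEnergy_add_right]
  simp only [mutualEnergy_smul_left, mutualEnergy_smul_right]
  rw [mutualEnergy_comm ν μ, ← energy_eq_mutualEnergy, ← energy_eq_mutualEnergy]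
  ring

theorem energy_mono {μ ν : Measure S2} (h : μ ≤ ν) : energy μ ≤ energy ν :=
  lintegral_mono' h fun _ => lintegral_mono' h fun _ => le_rfl

theorem mem_unitMeasures_convex {E : Set S2} {μ ν : Measure S2} (hμ : μ ∈ unitMeasures E)
    (hν : ν ∈ unitMeasures E) {ε : ℝ} (h0 : 0 ≤ ε) (h1 : ε ≤ 1) :
    ENNReal.ofReal (1 - ε) • μ + ENNReal.ofReal ε • ν ∈ unitMeasures E := by
  have := hμ.1
  have := hν.1
  refine ⟨⟨?_⟩, ?_⟩
  · simp only [Measure.coe_add, Measure.coe_smul, Pi.add_apply, Pi.smul_apply, measure_univ, smul_eq_mul, mul_one]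
    rw [← ENNReal.ofReal_add (by linarith) h0]
    simp
  · rw [Measure.support_add]
    exact union_subset ((Measure.AbsolutelyContinuous.support_mono Measure.smul_absolutelyContinuous).trans hμ.2)
      ((Measure.AbsolutelyContinuous.support_mono Measure.smul_absolutelyContinuous).trans hν.2)

theorem minEnergy_le {E : Set S2} (Q : S2 → ℝ≥0∞) {ν : Measure S2} (hν : ν ∈ unitMeasures E) :
    minEnergy E Q ≤ weightedEnergy Q ν := iInf₂_le ν hν

/-- The first variation: moving mass from an extremal measure to `ν` does not decrease the energy. -/
theorem extremal_variation {E : Set S2} {Q : S2 → ℝ≥0∞} {μ ν : Measure S2} (hμ : IsExtremal E Q μ)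
    (he : energy μ ≠ ∞) (hq : ∫⁻ x, Q x ∂μ ≠ ∞) (hν : ν ∈ unitMeasures E) (he' : energy ν ≠ ∞) :
    energy μ + ∫⁻ x, Q x ∂μ ≤ mutualEnergy μ ν + ∫⁻ x, Q x ∂ν := by
  have := hμ.1.1
  have := hν.1
  by_contra! hlt
  have hB : mutualEnergy μ ν + ∫⁻ x, Q x ∂ν ≠ ∞ := hlt.ne_top
  obtain ⟨hm, hq'⟩ := ENNReal.add_ne_top.1 hB
  have key : ∀ ε : ℝ, 0 ≤ ε → ε ≤ 1 → energy μ + 2 * ∫⁻ x, Q x ∂μ ≤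
      ENNReal.ofReal (1 - ε) * ENNReal.ofReal (1 - ε) * energy μ +
        2 * (ENNReal.ofReal (1 - ε) * ENNReal.ofReal ε * mutualEnergy μ ν) +
        ENNReal.ofReal ε * ENNReal.ofReal ε * energy ν +
        2 * (ENNReal.ofReal (1 - ε) * ∫⁻ x, Q x ∂μ + ENNReal.ofReal ε * ∫⁻ x, Q x ∂ν) := by
    intro ε h0 h1
    have h2 := minEnergy_le Q (mem_unitMeasures_convex hμ.1 hν h0 h1)
    rw [← hμ.2] at h2
    unfold weightedEnergy at h2
    rwa [energy_smul_add_smul, lintegral_add_measure,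
      lintegral_smul_measure, lintegral_smul_measure] at h2
  generalize energy μ = e at *
  generalize energy ν = e' at *
  generalize mutualEnergy μ ν = m at *
  generalize ∫⁻ x, Q x ∂μ = q at *
  generalize ∫⁻ x, Q x ∂ν = q' at *
  lift e to NNReal using he
  lift e' to NNReal using he'
  lift m to NNReal using hm
  lift q to NNReal using hq
  lift q' to NNReal using hq'
  have hlt' : (m : ℝ) + q' < e + q := by exact_mod_cast hlt
  set δ : ℝ := (e + q) - (m + q') with hδ
  have hδ0 : 0 < δ := by linarith
  set C : ℝ := |(e : ℝ) - 2 * m + e'| with hC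
  have hC0 : 0 ≤ C := abs_nonneg _
  -- for this `ε` the linear gain `2 δ ε` exceeds the quadratic loss `C ε²`
  set ε : ℝ := δ / (δ + C) with hε
  have hε0 : 0 < ε := by positivity
  have hε1 : ε ≤ 1 := (div_le_one (by positivity)).2 (by linarith)
  have h3 := key ε hε0.le hε1
  lift ε to NNReal using hε0.le with ε₁ hε₁
  have h4 : (1 - (ε₁ : ℝ)) = ((1 - ε₁ : NNReal) : ℝ) := by
    rw [NNReal.coe_sub (by exact_mod_cast hε1)]; simp
  rw [h4] at h3
  simp only [ENNReal.ofReal_coe_nnreal] at h3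
  have h5 : (e : ℝ) + 2 * q ≤ (1 - ε₁ : NNReal) * (1 - ε₁ : NNReal) * e + 2 * ((1 - ε₁ : NNReal) * ε₁ * m) + ε₁ * ε₁ * e'
      + 2 * ((1 - ε₁ : NNReal) * q + ε₁ * q') := by exact_mod_cast h3
  rw [← h4] at h5
  have h6 : 0 ≤ (ε₁ : ℝ) * (-2 * δ + ε₁ * (e - 2 * m + e')) := by
    rw [hδ]; linarith
  have h7 := nonneg_of_mul_nonneg_right h6 hε0
  have h8 : (ε₁ : ℝ) * (e - 2 * m + e') ≤ ε₁ * C := mul_le_mul_of_nonneg_left (le_abs_self _) hε0.le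
  have h9 : (ε₁ : ℝ) * C ≤ δ := by
    rw [hε, div_mul_eq_mul_div, div_le_iff₀ (by positivity)]
    nlinarith
  linarith

theorem support_subset_of_measure_compl {ν : Measure S2} {S : Set S2} (hS : IsClosed S) (h : ν Sᶜ = 0) : ν.support ⊆ S :=
  Measure.support_subset_of_isClosed hS (mem_ae_iff.2 h)

/-- Frostman's inequality: `U^μ + Q ≥ I(μ) + ∫ Q dμ` holds outside a set that no measure of finite energy
carried by the support charges. On the support, `Q` is replaced by a measurable function `Q₀`. -/
theorem measure_potential_lt_eq_zero {E : Set S2} {Q Q₀ : S2 → ℝ≥0∞} {μ ν : Measure S2} (hμ : IsExtremal E Q μ)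
    (he : energy μ ≠ ∞) (hq : ∫⁻ x, Q x ∂μ ≠ ∞) (hQ₀ : Measurable Q₀) (hQQ : ∀ x ∈ μ.support, Q₀ x = Q x)
    [IsFiniteMeasure ν] (hν : ν μ.supportᶜ = 0) (he' : energy ν ≠ ∞) :
    ν {x | potential μ x + Q₀ x < energy μ + ∫⁻ x, Q x ∂μ} = 0 := by
  have := hμ.1.1
  set I₀ := energy μ + ∫⁻ x, Q x ∂μ with hI₀
  have hI : I₀ ≠ ∞ := ENNReal.add_ne_top.2 ⟨he, hq⟩
  have hmeas : Measurable fun x => potential μ x + Q₀ x := (measurable_potential μ).add hQ₀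
  set B := {x | potential μ x + Q₀ x < I₀} with hB
  have hBm : MeasurableSet B := measurableSet_lt hmeas measurable_const
  by_contra hνB
  have hνB' : ν B ≠ ∞ := measure_ne_top ν B
  -- the normalized restriction of `ν` to the bad set would violate the variational inequality
  set ν' : Measure S2 := (ν B)⁻¹ • ν.restrict B with hν'
  have hc : (ν B)⁻¹ ≠ ∞ := ENNReal.inv_ne_top.2 hνB
  have hSν : ν.restrict B μ.supportᶜ = 0 := le_antisymm ((Measure.restrict_le_self _).trans_eq hν) bot_le
  have hmem : ν' ∈ unitMeasures E := by
    refine ⟨⟨?_⟩, ?_⟩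
    · simp [hν', ENNReal.inv_mul_cancel hνB hνB']
    · refine (support_subset_of_measure_compl Measure.isClosed_support ?_).trans hμ.1.2
      rw [hν', Measure.smul_apply, hSν, smul_zero]
  have hen : energy ν' ≠ ∞ := by
    rw [energy_eq_mutualEnergy, hν', mutualEnergy_smul_left, mutualEnergy_smul_right, ← energy_eq_mutualEnergy]
    exact ENNReal.mul_ne_top hc (ENNReal.mul_ne_top hc (ne_top_of_le_ne_top he' (energy_mono Measure.restrict_le_self)))
  have hprob := hmem.1
  have h1 := extremal_variation hμ he hq hmem hen
  have h2 : ∫⁻ x, Q x ∂ν' = ∫⁻ x, Q₀ x ∂ν' := by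
    refine lintegral_congr_ae ?_
    have : ν' μ.supportᶜ = 0 := by rw [hν', Measure.smul_apply, hSν, smul_zero]
    filter_upwards [mem_ae_iff.2 this] with x hx using (hQQ x hx).symm
  rw [h2, mutualEnergy_comm, mutualEnergy_eq_lintegral_potential, ← lintegral_add_left (measurable_potential μ),
    hν', lintegral_smul_measure, smul_eq_mul] at h1
  have h3 : ∫⁻ x in B, potential μ x + Q₀ x ∂ν < ∫⁻ x in B, I₀ ∂ν := by
    refine setLIntegral_strict_mono hBm hνB measurable_const ?_ (ae_of_all _ fun x hx => hx)
    refine ne_top_of_le_ne_top (ENNReal.mul_ne_top hI hνB') ?_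
    rw [← setLIntegral_const]
    exact setLIntegral_mono' hBm fun x hx => le_of_lt hx
  rw [setLIntegral_const] at h3
  have h4 : (ν B)⁻¹ * ∫⁻ x in B, potential μ x + Q₀ x ∂ν < (ν B)⁻¹ * (I₀ * ν B) :=
    (ENNReal.mul_lt_mul_iff_right (ENNReal.inv_ne_zero.2 hνB') hc).2 h3
  rw [mul_comm I₀, ← mul_assoc, ENNReal.inv_mul_cancel hνB hνB', one_mul] at h4
  exact absurd h1 (not_le.2 h4)

/-- The principle of descent, in the form of lower semicontinuity of the potential. -/
theorem potential_le_liminf (μ : Measure S2) (x : S2) (T : Set S2) [(𝓝[T] x).NeBot] :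
    potential μ x ≤ liminf (potential μ) (𝓝[T] x) := by
  have h1 : ∀ z, liminf (fun y => (edist y z)⁻¹) (𝓝[T] x) = (edist x z)⁻¹ := fun z => by
    have : Continuous fun y : S2 => (edist y z)⁻¹ := (continuous_id.edist continuous_const).inv
    exact (this.continuousAt.mono_left nhdsWithin_le_nhds).liminf_eq
  calc potential μ x = ∫⁻ z, liminf (fun y => (edist y z)⁻¹) (𝓝[T] x) ∂μ := by
        simp_rw [h1]; rfl
    _ ≤ _ := lintegral_liminf_le fun y => measurable_inv_edist_right y

/-- Equality `μ`-almost everywhere gives the upper inequality at every point of the support, as the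
potential is lower semicontinuous and `Q` is continuous. -/
theorem potential_add_le_of_mem_support {Q : S2 → ℝ≥0∞} {μ : Measure S2} {N : Set S2}
    (hSN : μ.support ⊆ N) (hQ : ContinuousOn Q N) (hfin : ∀ x ∈ N, Q x ≠ ∞) {I₀ : ℝ≥0∞} (hI₀ : I₀ ≠ ∞)
    (hae : ∀ᵐ x ∂μ, potential μ x + Q x = I₀) {x : S2} (hx : x ∈ μ.support) :
    potential μ x + Q x ≤ I₀ := by
  -- `T` carries `μ`, hence every point of the support is a limit of points of `T`
  set T := {y | y ∈ N ∧ potential μ y + Q y = I₀} with hT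
  have hTae : T ∈ ae μ := by
    filter_upwards [hae, Measure.support_mem_ae (μ := μ)] with y h1 h2 using ⟨hSN h2, h1⟩
  have hne : (𝓝[T] x).NeBot := by
    rw [← mem_closure_iff_nhdsWithin_neBot]
    exact Measure.support_subset_of_isClosed isClosed_closure (mem_of_superset hTae subset_closure) hx
  have hTN : T ⊆ N := fun y hy => hy.1
  have hQT : Tendsto Q (𝓝[T] x) (𝓝 (Q x)) := ((hQ x (hSN hx)).mono hTN)
  have hle : Q x ≤ I₀ := by
    refine le_of_tendsto hQT (eventually_nhdsWithin_of_forall fun y hy => ?_)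
    rw [← hy.2]; exact le_add_self
  have h1 : Tendsto (potential μ) (𝓝[T] x) (𝓝 (I₀ - Q x)) := by
    refine (ENNReal.Tendsto.sub tendsto_const_nhds hQT (Or.inl hI₀)).congr' ?_
    refine eventually_nhdsWithin_of_forall fun y hy => ?_
    simp only [← hy.2, ENNReal.add_sub_cancel_right (hfin y hy.1)]
  have h2 := potential_le_liminf μ x T
  rw [h1.liminf_eq] at h2
  calc potential μ x + Q x ≤ (I₀ - Q x) + Q x := by gcongr
    _ = I₀ := tsub_add_cancel_of_le hle

/-! ### The surface measure of a cap -/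

theorem measurable_abelKernel_left (t : ℝ) : Measurable (abelKernel t) := by
  unfold abelKernel
  refine Measurable.ite (measurableSet_lt measurable_const measurable_id) ?_ measurable_const
  fun_prop

/-- The polar law `sin φ dφ` on `(0, α)`. The corresponding measure of revolution is a multiple of the
surface measure of the cap; it serves as a test measure of finite energy. -/
noncomputable def capLaw (α : ℝ) : Measure ℝ := (volume.restrict (Ioo 0 α)).withDensity fun φ => ENNReal.ofReal (sin φ)

instance (α : ℝ) : IsFiniteMeasure (capLaw α) := by
  refine isFiniteMeasure_withDensity_ofReal ?_
  exact (continuous_sin.integrableOn_Icc.mono_set (Ioo_subset_Icc_self (a := 0) (b := α))).2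

/-- The Abel transform of `capLaw α` is elementary for `t ≤ α` and vanishes beyond; it is thus bounded. -/
theorem abelTransform_capLaw {t α : ℝ} (ht : 0 ≤ t) (hα : α ≤ π) :
    abelTransform (capLaw α) t = ENNReal.ofReal (2 * √(cos t - cos α)) ∨ abelTransform (capLaw α) t = 0 := by
  unfold abelTransform capLaw
  rw [lintegral_withDensity_eq_lintegral_mul _ (by fun_prop) (measurable_abelKernel_left t)]
  rcases le_or_gt t α with h | h
  · left
    rw [← integral_abel_right ht h hα, ← lintegral_indicator measurableSet_Ioo, ← lintegral_indicator measurableSet_Ioo]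
    refine lintegral_congr fun φ => ?_
    simp only [Set.indicator, mem_Ioo, Pi.mul_apply, abelKernel]
    by_cases h1 : t < φ
    · by_cases h2 : φ < α
      · simp only [h1, h2, ht.trans_lt h1, and_self, if_true]
        rw [← ENNReal.ofReal_mul (sin_nonneg_of_mem_Ioo ht hα ⟨h1, h2⟩), div_eq_mul_inv]
      · simp [h2]
    · simp [h1]
  · right
    rw [lintegral_eq_zero_iff (by
      refine Measurable.mul (by fun_prop) (measurable_abelKernel_left t))]
    refine ae_restrict_of_forall_mem measurableSet_Ioo fun φ hφ => ?_
    have : ¬ t < φ := by have := hφ.2; linarith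
    simp [abelKernel, this]

theorem ae_capLaw_mem (α : ℝ) : ∀ᵐ φ ∂(capLaw α), φ ∈ Ioo 0 α :=
  (withDensity_absolutelyContinuous _ _).ae_le (ae_restrict_mem measurableSet_Ioo)

theorem energy_revolve_capLaw {α : ℝ} (hα : α ≤ π) : energy (revolve (capLaw α)) ≠ ∞ := by
  have hac : capLaw α ≪ volume := (withDensity_absolutelyContinuous _ _).trans Measure.restrict_le_self.absolutelyContinuous
  have hae : ∀ᵐ φ ∂(capLaw α), φ ∈ Ioo 0 π := by
    filter_upwards [ae_capLaw_mem α] with φ h using ⟨h.1, h.2.trans_le hα⟩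
  have hπ : (ENNReal.ofReal π)⁻¹ ≠ ∞ := ENNReal.inv_ne_top.2 (by simp [pi_pos])
  have h1 : energy (revolve (capLaw α)) =
      ∫⁻ ξ, ((ENNReal.ofReal π)⁻¹ * ∫⁻ t in Ioo 0 π, abelTransform (capLaw α) t * abelKernel t ξ) ∂(capLaw α) := by
    rw [energy_eq_mutualEnergy, mutualEnergy_eq_lintegral_potential, lintegral_revolve _ (measurable_potential _)]
    refine lintegral_congr_ae ?_
    filter_upwards [hae] with ξ hξ
    rw [parallelMean_of_rot fun θ φ => potential_revolve_sph _ θ φ]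
    exact potential_revolve _ hae hξ (hac (by simp))
  have hm : Measurable fun p : ℝ × ℝ => abelTransform (capLaw α) p.2 * abelKernel p.2 p.1 :=
    ((measurable_abelTransform _).comp measurable_snd).mul (measurable_abelKernel.comp measurable_swap)
  rw [h1, lintegral_const_mul' _ _ hπ, lintegral_lintegral_swap hm.aemeasurable]
  refine ENNReal.mul_ne_top hπ ?_
  refine ne_top_of_le_ne_top (b := ∫⁻ t in Ioo 0 π, ENNReal.ofReal (2 * √2) * ENNReal.ofReal (2 * √2)) ?_ ?_
  · rw [setLIntegral_const]
    refine ENNReal.mul_ne_top (ENNReal.mul_ne_top ENNReal.ofReal_ne_top ENNReal.ofReal_ne_top) (by simp)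
  · refine setLIntegral_mono' measurableSet_Ioo fun t ht => ?_
    have h2 : abelTransform (capLaw α) t ≤ ENNReal.ofReal (2 * √2) := by
      rcases abelTransform_capLaw ht.1.le hα with h | h
      · rw [h]
        refine ENNReal.ofReal_le_ofReal ?_
        gcongr
        linarith [cos_le_one t, neg_one_le_cos α]
      · rw [h]; exact bot_le
    rw [lintegral_const_mul _ (measurable_abelKernel_left t)]
    exact mul_le_mul' h2 h2

/-! ### Rotational symmetry of the extremal measure -/

/-- An extremal measure inherits the rotational symmetry of its support and of the field: otherwise the
midpoint of `μ` and its rotated copy would have smaller weighted energy. -/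
theorem map_rot_eq_of_isExtremal {E : Set S2} {Q : S2 → ℝ≥0∞} {μ : Measure S2} (hμ : IsExtremal E Q μ)
    (he : energy μ ≠ ∞) (hq : ∫⁻ x, Q x ∂μ ≠ ∞)
    (hS : ∀ θ, ∀ x ∈ μ.support, rot θ x ∈ μ.support) (hrot : RotInvariant E Q) (θ : ℝ) : μ.map (rot θ) = μ := by
  have := hμ.1.1
  set ν := μ.map (rot θ) with hν
  have hνp : IsProbabilityMeasure ν := Measure.isProbabilityMeasure_map (measurable_rot θ).aemeasurable
  have hE : ∀ x ∈ μ.support, x ∈ E := fun x hx => hμ.1.2 hx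
  have hνS : ν μ.supportᶜ = 0 := by
    rw [hν, Measure.map_apply (measurable_rot θ) Measure.isClosed_support.measurableSet.compl]
    refine measure_mono_null (fun x hx => ?_) (Measure.measure_compl_support (μ := μ))
    exact fun h => hx (hS θ x h)
  have hνE : ν ∈ unitMeasures E := ⟨hνp, (support_subset_of_measure_compl Measure.isClosed_support hνS).trans hμ.1.2⟩
  have hen : energy ν = energy μ := by
    rw [energy_eq_mutualEnergy, energy_eq_mutualEnergy, mutualEnergy_eq_lintegral_potential,
      mutualEnergy_eq_lintegral_potential]
    conv_lhs => rw [hν]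
    rw [lintegral_map (measurable_potential _) (measurable_rot θ)]
    refine lintegral_congr fun x => ?_
    unfold potential
    rw [lintegral_map (measurable_inv_edist_right _) (measurable_rot θ)]
    simp_rw [edist_rot]
  have hQν : ∫⁻ x, Q x ∂ν = ∫⁻ x, Q x ∂μ := by
    rw [hν, show μ.map (rot θ) = μ.map (rotEquiv θ) from rfl, lintegral_map_equiv]
    refine lintegral_congr_ae ?_
    filter_upwards [Measure.support_mem_ae (μ := μ)] with x hx
    exact hrot _ (hE _ (hS θ x hx)) _ (hE _ hx) (rot_two θ x)
  have hmid := minEnergy_le Q (mem_unitMeasures_convex hμ.1 hνE (ε := 1 / 2) (by norm_num) (by norm_num))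
  rw [← hμ.2] at hmid
  unfold weightedEnergy at hmid
  rw [energy_smul_add_smul, lintegral_add_measure,
      lintegral_smul_measure, lintegral_smul_measure, hQν, hen] at hmid
  refine (eq_of_energy_le μ ν he (hen ▸ he) ?_).symm
  rw [hen, mutualEnergy_comm ν μ]
  -- the energy of the midpoint is at least that of `μ`, so the mutual energy is at least `energy μ`
  rcases eq_or_ne (mutualEnergy μ ν) ∞ with hm | hm
  · simp [hm]
  generalize energy μ = e at *
  generalize mutualEnergy μ ν = m at *
  generalize ∫⁻ x, Q x ∂μ = q at *
  lift e to NNReal using he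
  lift m to NNReal using hm
  lift q to NNReal using hq
  have h4 : (1 - (1 / 2 : ℝ)) = ((1 / 2 : NNReal) : ℝ) := by push_cast; norm_num
  have h4' : ((1 / 2 : ℝ)) = ((1 / 2 : NNReal) : ℝ) := by push_cast; norm_num
  rw [h4, h4'] at hmid
  simp only [ENNReal.ofReal_coe_nnreal, smul_eq_mul] at hmid
  have h5 : (e : ℝ) + 2 * q ≤ (1 / 2 : NNReal) * (1 / 2 : NNReal) * e + 2 * ((1 / 2 : NNReal) * (1 / 2 : NNReal) * m) + (1 / 2 : NNReal) * (1 / 2 : NNReal) * e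
      + 2 * ((1 / 2 : NNReal) * q + (1 / 2 : NNReal) * q) := by exact_mod_cast hmid
  push_cast at h5
  have h6 : (e : ℝ) + e ≤ m + m := by linarith
  exact_mod_cast h6

/-! ### Regularity of `g` and `F` -/

theorem hasDerivAt_one_sub_cos (x : ℝ) : HasDerivAt (fun x => 1 - cos x) (sin x) x :=
  ((hasDerivAt_cos x).const_sub 1).congr_deriv (by ring)

/-- The substitution `u = 1 - cos x`, which turns the kernels on the sphere into the classical Abel kernels. -/
theorem integral_subst_one_sub_cos {a b : ℝ} (ha : 0 ≤ a) (hab : a ≤ b) (hb : b ≤ π) (g : ℝ → ℝ) :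
    (IntervalIntegrable (fun x => g (1 - cos x) * sin x) volume a b ↔
      IntervalIntegrable g volume (1 - cos a) (1 - cos b)) ∧
    ∫ x in a..b, g (1 - cos x) * sin x = ∫ u in (1 - cos a)..(1 - cos b), g u := by
  have h1 : ContinuousOn (fun x => 1 - cos x) (uIcc a b) := by fun_prop
  have h2 : ∀ x ∈ Ioo (min a b) (max a b), HasDerivAt (fun x => 1 - cos x) (sin x) x :=
    fun x _ => hasDerivAt_one_sub_cos x
  have h3 : ∀ x ∈ Ioo (min a b) (max a b), 0 ≤ sin x := by
    rw [min_eq_left hab, max_eq_right hab]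
    exact fun x hx => sin_nonneg_of_mem_Ioo ha hb hx
  exact ⟨intervalIntegral.integrable_comp_mul_deriv_iff_of_deriv_nonneg h1 h2 h3,
    intervalIntegral.integral_comp_mul_deriv_of_deriv_nonneg h1 h2 h3⟩

theorem arccos_mem_Ioo {α u : ℝ} (hα0 : 0 ≤ α) (hα : α ≤ π) (hu : u ∈ Ioo 0 (1 - cos α)) : arccos (1 - u) ∈ Ioo 0 α := by
  refine ⟨arccos_pos.2 (by linarith [hu.1]), ?_⟩
  rw [← arccos_cos hα0 hα]
  exact strictAntiOn_arccos ⟨neg_one_le_cos α, cos_le_one α⟩ ⟨by linarith [neg_one_le_cos α, hu.2], by linarith [hu.1]⟩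
    (by linarith [hu.2])

theorem contDiffOn_comp_arccos {n : ℕ} {α : ℝ} (hα0 : 0 ≤ α) (hα : α ≤ π) {q : ℝ → ℝ}
    (hq : ContDiffOn ℝ n q (Ioo 0 α)) : ContDiffOn ℝ n (fun u => q (arccos (1 - u))) (Ioo 0 (1 - cos α)) := by
  refine hq.comp ?_ fun u hu => arccos_mem_Ioo hα0 hα hu
  intro u hu
  refine ContDiffAt.contDiffWithinAt ?_
  refine ContDiffAt.comp (g := arccos) u (contDiffAt_arccos ?_ ?_) (by fun_prop)
  · linarith [hu.2, neg_one_le_cos α]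
  · linarith [hu.1]

theorem one_sub_cos_mem_Ioo {α φ : ℝ} (hα : α ≤ π) (hφ : φ ∈ Ioo 0 α) : 1 - cos φ ∈ Ioo 0 (1 - cos α) := by
  have h1 := cos_lt_cos_of_mem le_rfl hφ.1 (hφ.2.le.trans hα)
  have h2 := cos_lt_cos_of_mem hφ.1.le hφ.2 hα
  rw [cos_zero] at h1
  exact ⟨h1, by linarith⟩

/-- The inner Abel integral of a bounded `C²` profile converges and is `C²` in the open interval. -/
theorem gIntegral_regularity {Q : S2 → ℝ≥0∞} {α : ℝ} (hα0 : 0 < α) (hα : α ≤ π)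
    (hq : ContDiffOn ℝ 2 (profile Q) (Ioo 0 α)) {C : ℝ} (hC : ∀ ξ ∈ Ioo 0 α, |profile Q ξ| ≤ C) :
    (∀ t ∈ Ioo 0 α, IntervalIntegrable (gIntegrand Q t) volume 0 t) ∧
    ContDiffOn ℝ 2 (gIntegral Q) (Ioo 0 α) := by
  set f : ℝ → ℝ := fun u => profile Q (arccos (1 - u)) with hf
  have hfn : ContDiffOn ℝ (2 : ℕ) f (Ioo 0 (1 - cos α)) := contDiffOn_comp_arccos hα0.le hα (by exact_mod_cast hq)
  have hfi : ∀ x ∈ Ioo 0 (1 - cos α), IntervalIntegrable f volume 0 x := by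
    intro x hx
    rw [intervalIntegrable_iff_integrableOn_Ioo_of_le hx.1.le]
    refine (integrable_const C).mono' ?_ ?_
    · exact (hfn.continuousOn.mono (Ioo_subset_Ioo_right hx.2.le)).aestronglyMeasurable measurableSet_Ioo
    · refine ae_restrict_of_forall_mem measurableSet_Ioo fun u hu => ?_
      exact hC _ (arccos_mem_Ioo hα0.le hα ⟨hu.1, hu.2.trans hx.2⟩)
  obtain ⟨h1, h2⟩ := contDiffOn_abel_left hfi hfn
  have hcongr : ∀ t ∈ Ioo 0 α, ∀ ξ ∈ Ioo 0 t, f (1 - cos ξ) / √((1 - cos t) - (1 - cos ξ)) * sin ξ = gIntegrand Q t ξ := by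
    intro t ht ξ hξ
    simp only [hf, gIntegrand]
    rw [sub_sub_cancel, arccos_cos hξ.1.le (by linarith [hξ.2, ht.2]), show 1 - cos t - (1 - cos ξ) = cos ξ - cos t by ring]
    ring
  have hsub := fun t (ht : t ∈ Ioo 0 α) => integral_subst_one_sub_cos le_rfl ht.1.le (ht.2.le.trans hα)
    (fun u => f u / √((1 - cos t) - u))
  simp only [cos_zero, sub_self] at hsub
  refine ⟨fun t ht => ?_, ?_⟩
  · have h3 := (hsub t ht).1.2 (h2 _ (one_sub_cos_mem_Ioo hα ht))
    rw [intervalIntegrable_iff_integrableOn_Ioo_of_le ht.1.le] at h3 ⊢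
    exact h3.congr_fun (hcongr t ht) measurableSet_Ioo
  · have h4 : ContDiffOn ℝ (2 : ℕ) (fun t => ∫ u in (0:ℝ)..(1 - cos t), f u / √((1 - cos t) - u)) (Ioo 0 α) :=
      h1.comp (by fun_prop) fun t ht => one_sub_cos_mem_Ioo hα ht
    refine ContDiffOn.congr (by exact_mod_cast h4) fun t ht => ?_
    rw [← (hsub t ht).2]
    unfold gIntegral
    rw [intervalIntegral.integral_of_le ht.1.le, intervalIntegral.integral_of_le ht.1.le,
      integral_Ioc_eq_integral_Ioo, integral_Ioc_eq_integral_Ioo]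
    exact (setIntegral_congr_fun measurableSet_Ioo (hcongr t ht)).symm

theorem contDiffOn_gFun {Q : S2 → ℝ≥0∞} {α : ℝ} (h : ContDiffOn ℝ 2 (gIntegral Q) (Ioo 0 α)) :
    ContDiffOn ℝ 1 (gFun Q) (Ioo 0 α) := by
  have h2 : ContDiffOn ℝ (1 + 1) (gIntegral Q) (Ioo 0 α) := by
    convert h using 1; norm_num
  rw [contDiffOn_succ_iff_deriv_of_isOpen isOpen_Ioo] at h2
  exact contDiffOn_const.mul h2.2.2

theorem FIntegral_differentiable {Q : S2 → ℝ≥0∞} {α : ℝ} (hα0 : 0 < α) (hα : α ≤ π)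
    (hg : ContDiffOn ℝ 1 (gFun Q) (Ioo 0 α)) (hgi : IntervalIntegrable (gFun Q) volume 0 α) :
    ∀ φ ∈ Ioo 0 α, DifferentiableAt ℝ (FIntegral Q α) φ := by
  set f : ℝ → ℝ := fun u => gFun Q (arccos (1 - u)) with hf
  have hfn : ContDiffOn ℝ (1 : ℕ) f (Ioo 0 (1 - cos α)) := contDiffOn_comp_arccos hα0.le hα (by exact_mod_cast hg)
  have hfi : ∀ x ∈ Ioo 0 (1 - cos α), IntervalIntegrable f volume x (1 - cos α) := by
    intro x hx
    have hy := arccos_mem_Ioo hα0.le hα hx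
    have h1 := (integral_subst_one_sub_cos hy.1.le hy.2.le hα f).1
    rw [cos_arccos (by linarith [hx.2, neg_one_le_cos α]) (by linarith [hx.1]), sub_sub_cancel] at h1
    refine h1.1 ?_
    have h2 : IntervalIntegrable (fun t => gFun Q t * sin t) volume 0 α := hgi.mul_continuousOn (by fun_prop)
    rw [intervalIntegrable_iff_integrableOn_Ioo_of_le hα0.le] at h2
    rw [intervalIntegrable_iff_integrableOn_Ioo_of_le hy.2.le]
    refine (h2.mono_set (Ioo_subset_Ioo_left hy.1.le)).congr_fun (fun t ht => ?_) measurableSet_Ioo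
    simp only [hf]
    rw [sub_sub_cancel, arccos_cos (hy.1.le.trans ht.1.le) (ht.2.le.trans hα)]
  have h1 := contDiffOn_abel_right hfi hfn
  have h2 : ContDiffOn ℝ (1 : ℕ) (fun φ => ∫ u in (1 - cos φ)..(1 - cos α), f u / √(u - (1 - cos φ))) (Ioo 0 α) :=
    h1.comp (by fun_prop) fun t ht => one_sub_cos_mem_Ioo hα ht
  have h3 : DifferentiableOn ℝ (FIntegral Q α) (Ioo 0 α) := by
    refine (h2.differentiableOn (by simp)).congr fun φ hφ => ?_
    rw [← (integral_subst_one_sub_cos hφ.1.le hφ.2.le hα (fun u => f u / √(u - (1 - cos φ)))).2]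
    unfold FIntegral
    rw [intervalIntegral.integral_of_le hφ.2.le, intervalIntegral.integral_of_le hφ.2.le,
      integral_Ioc_eq_integral_Ioo, integral_Ioc_eq_integral_Ioo]
    refine setIntegral_congr_fun measurableSet_Ioo fun t ht => ?_
    simp only [hf, FIntegrand]
    rw [sub_sub_cancel, arccos_cos (hφ.1.le.trans ht.1.le) (ht.2.le.trans hα), show 1 - cos t - (1 - cos φ) = cos φ - cos t by ring]
    ring
  exact fun φ hφ => (h3 φ hφ).differentiableAt (isOpen_Ioo.mem_nhds hφ)

/-! ### Abel inversion -/

/-- Applying the left Abel transform to `ξ ↦ ∫ S(t) abelKernel t ξ dt` recovers the integral of `S` over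
`(0, τ)`. -/
theorem lintegral_abel_left_inversion {S : ℝ → ℝ≥0∞} (hS : Measurable S) {τ : ℝ} (hτ : τ ≤ π) :
    ∫⁻ ξ in Ioo 0 τ, (∫⁻ t in Ioo 0 π, S t * abelKernel t ξ) * ENNReal.ofReal (sin ξ / √(cos ξ - cos τ)) =
      ENNReal.ofReal π * ∫⁻ t in Ioo 0 τ, S t := by
  have h1 : ∀ ξ, (∫⁻ t in Ioo 0 π, S t * abelKernel t ξ) * ENNReal.ofReal (sin ξ / √(cos ξ - cos τ)) =
      ∫⁻ t in Ioo 0 π, S t * (abelKernel t ξ * ENNReal.ofReal (sin ξ / √(cos ξ - cos τ))) := fun ξ => by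
    rw [← lintegral_mul_const']
    · simp_rw [mul_assoc]
    · exact ENNReal.ofReal_ne_top
  have hm : Measurable fun p : ℝ × ℝ => S p.2 * (abelKernel p.2 p.1 * ENNReal.ofReal (sin p.1 / √(cos p.1 - cos τ))) := by
    refine (hS.comp measurable_snd).mul ((measurable_abelKernel.comp measurable_swap).mul ?_)
    fun_prop
  simp_rw [h1]
  rw [lintegral_lintegral_swap hm.aemeasurable, ← lintegral_const_mul _ hS]
  have h2 : ∀ t ∈ Ioo 0 π, ∫⁻ ξ in Ioo 0 τ, S t * (abelKernel t ξ * ENNReal.ofReal (sin ξ / √(cos ξ - cos τ))) =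
      (Ioo 0 τ).indicator (fun t => ENNReal.ofReal π * S t) t := by
    intro t ht
    have hmt : Measurable fun ξ => abelKernel t ξ * ENNReal.ofReal (sin ξ / √(cos ξ - cos τ)) :=
      (measurable_abelKernel_left t).mul (by fun_prop)
    rw [lintegral_const_mul _ hmt]
    by_cases htτ : t < τ
    · have h3 : ∫⁻ ξ in Ioo 0 τ, abelKernel t ξ * ENNReal.ofReal (sin ξ / √(cos ξ - cos τ)) = ENNReal.ofReal π := by
        rw [← lintegral_abel_product ht.1.le htτ hτ, ← lintegral_indicator measurableSet_Ioo, ← lintegral_indicator measurableSet_Ioo]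
        refine lintegral_congr fun ξ => ?_
        simp only [Set.indicator, mem_Ioo, abelKernel]
        by_cases h4 : t < ξ
        · simp only [h4, ht.1.trans h4, true_and, if_true]
          split_ifs
          · rw [← ENNReal.ofReal_mul (by positivity)]
            congr 1
            rw [mul_comm (√(cos t - cos ξ)), ← div_div, div_eq_inv_mul]
            ring
          · rfl
        · simp [h4]
      rw [h3, Set.indicator_of_mem (show t ∈ Ioo 0 τ from ⟨ht.1, htτ⟩), mul_comm]
    · rw [Set.indicator_of_notMem (fun h => htτ h.2)]
      have h3 : ∫⁻ ξ in Ioo 0 τ, abelKernel t ξ * ENNReal.ofReal (sin ξ / √(cos ξ - cos τ)) = 0 := by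
        rw [setLIntegral_congr_fun (g := fun _ => 0) measurableSet_Ioo]
        · simp
        · intro ξ hξ
          have : ¬ t < ξ := fun h => htτ (h.trans hξ.2)
          simp [abelKernel, this]
      rw [h3, mul_zero]
  rw [setLIntegral_congr_fun measurableSet_Ioo h2, lintegral_indicator measurableSet_Ioo, Measure.restrict_restrict measurableSet_Ioo]
  congr 2
  rw [inter_eq_left]
  exact Ioo_subset_Ioo_right hτ

/-- Applying the right Abel transform to `abelTransform M` recovers the tail `M (φ, ∞)`. -/
theorem lintegral_abel_right_inversion (M : Measure ℝ) [SFinite M] {φ α : ℝ} (hφ : 0 ≤ φ) (hα : α ≤ π)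
    (hM : ∀ᵐ ψ ∂M, ψ ≤ α) :
    ∫⁻ t in Ioo φ α, abelTransform M t * ENNReal.ofReal (sin t / √(cos φ - cos t)) = ENNReal.ofReal π * M (Ioi φ) := by
  unfold abelTransform
  have h1 : ∀ t, (∫⁻ ψ, abelKernel t ψ ∂M) * ENNReal.ofReal (sin t / √(cos φ - cos t)) =
      ∫⁻ ψ, abelKernel t ψ * ENNReal.ofReal (sin t / √(cos φ - cos t)) ∂M := fun t => by
    rw [lintegral_mul_const']
    exact ENNReal.ofReal_ne_top
  have hm : Measurable fun p : ℝ × ℝ => abelKernel p.1 p.2 * ENNReal.ofReal (sin p.1 / √(cos φ - cos p.1)) :=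
    measurable_abelKernel.mul (by fun_prop)
  simp_rw [h1]
  rw [lintegral_lintegral_swap hm.aemeasurable]
  have h2 : ∀ᵐ ψ ∂M, ∫⁻ t in Ioo φ α, abelKernel t ψ * ENNReal.ofReal (sin t / √(cos φ - cos t)) =
      (Ioi φ).indicator (fun _ => ENNReal.ofReal π) ψ := by
    filter_upwards [hM] with ψ hψ
    by_cases h : φ < ψ
    · rw [Set.indicator_of_mem (show ψ ∈ Ioi φ from h), ← lintegral_abel_product hφ h (hψ.trans hα),
        ← lintegral_indicator measurableSet_Ioo, ← lintegral_indicator measurableSet_Ioo]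
      refine lintegral_congr fun t => ?_
      simp only [Set.indicator, mem_Ioo, abelKernel]
      by_cases h4 : t < ψ
      · simp only [h4, h4.trans_le hψ, and_true, if_true]
        split_ifs
        · rw [← ENNReal.ofReal_mul (by positivity)]
          congr 1
          rw [← div_div, div_eq_inv_mul, div_eq_inv_mul]
        · rfl
      · simp [h4]
    · rw [Set.indicator_of_notMem (show ψ ∉ Ioi φ from h), setLIntegral_congr_fun (g := fun _ => 0) measurableSet_Ioo]
      · simp
      · intro t ht
        have : ¬ t < ψ := fun h' => h (ht.1.trans h')
        simp [abelKernel, this]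
  rw [lintegral_congr_ae h2, lintegral_indicator measurableSet_Ioi, setLIntegral_const]

/-! ### Inversion of the equilibrium condition -/

theorem gIntegrand_nonneg (Q : S2 → ℝ≥0∞) {t ξ : ℝ} (hξ : 0 ≤ ξ) (hπ : ξ ≤ π) : 0 ≤ gIntegrand Q t ξ :=
  div_nonneg (mul_nonneg ENNReal.toReal_nonneg (sin_nonneg_of_nonneg_of_le_pi hξ hπ)) (Real.sqrt_nonneg _)

/-- The equilibrium condition `U^μ + Q = F` on the cap, almost everywhere in the polar angle, with the
potential of the measure with polar law `M` written through Abel kernels as in `potential_revolve`. -/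
def PolarEquation (Q : S2 → ℝ≥0∞) (α F : ℝ) (M : Measure ℝ) : Prop :=
  ∀ᵐ ξ ∂(volume.restrict (Ioo 0 α)), (ENNReal.ofReal π)⁻¹ * (∫⁻ t in Ioo 0 π, abelTransform M t * abelKernel t ξ) +
    ENNReal.ofReal (profile Q ξ) = ENNReal.ofReal F

theorem lintegral_abelTransform_add {Q : S2 → ℝ≥0∞} {α F : ℝ} (hα : α ≤ π) (M : Measure ℝ) [SFinite M]
    (hF : 0 ≤ F) (heq : PolarEquation Q α F M) {τ : ℝ} (h0 : 0 ≤ τ) (hτ : τ ≤ α) :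
    (∫⁻ t in Ioo 0 τ, abelTransform M t) + ∫⁻ ξ in Ioo 0 τ, ENNReal.ofReal (gIntegrand Q τ ξ) =
      ENNReal.ofReal (F * (2 * √(1 - cos τ))) := by
  have hπ0 : ENNReal.ofReal π ≠ 0 := by simp [pi_pos]
  have hw : Measurable fun ξ => ENNReal.ofReal (sin ξ / √(cos ξ - cos τ)) := by fun_prop
  have h1 : ∀ᵐ ξ ∂(volume.restrict (Ioo 0 τ)),
      (ENNReal.ofReal π)⁻¹ * ((∫⁻ t in Ioo 0 π, abelTransform M t * abelKernel t ξ) *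
        ENNReal.ofReal (sin ξ / √(cos ξ - cos τ))) + ENNReal.ofReal (gIntegrand Q τ ξ) =
      ENNReal.ofReal F * ENNReal.ofReal (sin ξ / √(cos ξ - cos τ)) := by
    filter_upwards [ae_restrict_of_ae_restrict_of_subset (Ioo_subset_Ioo_right hτ) heq, ae_restrict_mem measurableSet_Ioo] with ξ h hξ
    rw [← h, add_mul, mul_assoc, ← ENNReal.ofReal_mul (show 0 ≤ profile Q ξ from ENNReal.toReal_nonneg)]
    congr 2
    unfold gIntegrand
    rw [mul_div_assoc]
  have hm : Measurable fun ξ => (∫⁻ t in Ioo 0 π, abelTransform M t * abelKernel t ξ) *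
      ENNReal.ofReal (sin ξ / √(cos ξ - cos τ)) := by
    refine Measurable.mul ?_ hw
    refine Measurable.lintegral_prod_left' (f := fun p : ℝ × ℝ => abelTransform M p.1 * abelKernel p.1 p.2) ?_
    exact ((measurable_abelTransform M).comp measurable_fst).mul measurable_abelKernel
  have h2 := lintegral_congr_ae h1
  rw [lintegral_add_left (hm.const_mul _), lintegral_const_mul _ hm,
    lintegral_abel_left_inversion (measurable_abelTransform M) (hτ.trans hα), ← mul_assoc,
    ENNReal.inv_mul_cancel hπ0 ENNReal.ofReal_ne_top, one_mul, lintegral_const_mul _ hw,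
    (integral_abel_left h0 (hτ.trans hα)).2.2, ← ENNReal.ofReal_mul hF] at h2
  exact h2

/-- The left inversion of the equilibrium condition: the Abel transform of the polar law is integrable, and
its primitive is known. -/
theorem integral_toReal_abelTransform {Q : S2 → ℝ≥0∞} {α F : ℝ} (hα0 : 0 < α) (hα : α ≤ π) (M : Measure ℝ) [SFinite M]
    (hF : 0 ≤ F) (heq : PolarEquation Q α F M) (hgI : ∀ t ∈ Ioo 0 α, IntervalIntegrable (gIntegrand Q t) volume 0 t) :
    (∀ᵐ t ∂(volume.restrict (Ioo 0 α)), abelTransform M t < ∞) ∧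
    IntervalIntegrable (fun t => (abelTransform M t).toReal) volume 0 α ∧
    ∀ τ ∈ Ioo 0 α, ∫ t in 0..τ, (abelTransform M t).toReal = F * (2 * √(1 - cos τ)) - gIntegral Q τ := by
  have hfin : ∫⁻ t in Ioo 0 α, abelTransform M t ≠ ∞ := by
    have := lintegral_abelTransform_add hα M hF heq hα0.le le_rfl
    refine ne_top_of_le_ne_top (b := ENNReal.ofReal (F * (2 * √(1 - cos α)))) ENNReal.ofReal_ne_top ?_
    rw [← this]; exact le_self_add
  have hae : ∀ᵐ t ∂(volume.restrict (Ioo 0 α)), abelTransform M t < ∞ := ae_lt_top (measurable_abelTransform M) hfin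
  have hint : IntegrableOn (fun t => (abelTransform M t).toReal) (Ioo 0 α) :=
    integrable_toReal_of_lintegral_ne_top (measurable_abelTransform M).aemeasurable hfin
  refine ⟨hae, (intervalIntegrable_iff_integrableOn_Ioo_of_le hα0.le).2 hint, fun τ hτ => ?_⟩
  have h1 := lintegral_abelTransform_add hα M hF heq hτ.1.le hτ.2.le
  have hg := hgI τ hτ
  rw [intervalIntegrable_iff_integrableOn_Ioo_of_le hτ.1.le] at hg
  have hg0 : ∀ ξ ∈ Ioo 0 τ, 0 ≤ gIntegrand Q τ ξ := fun ξ hξ =>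
    gIntegrand_nonneg Q hξ.1.le (by linarith [hξ.2, hτ.2])
  rw [← ofReal_integral_eq_lintegral_ofReal hg (ae_restrict_of_forall_mem measurableSet_Ioo hg0)] at h1
  have h2 : ∫ ξ in Ioo 0 τ, gIntegrand Q τ ξ = gIntegral Q τ := by
    unfold gIntegral
    rw [intervalIntegral.integral_of_le hτ.1.le, integral_Ioc_eq_integral_Ioo]
  have h3 : 0 ≤ gIntegral Q τ := by rw [← h2]; exact setIntegral_nonneg measurableSet_Ioo hg0
  rw [h2] at h1
  rw [intervalIntegral.integral_of_le hτ.1.le, integral_Ioc_eq_integral_Ioo,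
    integral_toReal (measurable_abelTransform M).aemeasurable (ae_restrict_of_ae_restrict_of_subset (Ioo_subset_Ioo_right hτ.2.le) hae)]
  have h4 : ∫⁻ t in Ioo 0 τ, abelTransform M t ≠ ∞ :=
    ne_top_of_le_ne_top hfin (lintegral_mono_set (Ioo_subset_Ioo_right hτ.2.le))
  have h5 := congrArg ENNReal.toReal h1
  rw [ENNReal.toReal_add h4 ENNReal.ofReal_ne_top, ENNReal.toReal_ofReal h3, ENNReal.toReal_ofReal (by positivity)] at h5
  linarith

/-- By Lebesgue's differentiation theorem, the Abel transform of the polar law is `F √(1 + cos t) - 4 π g(t)`. -/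
theorem toReal_abelTransform_eq {Q : S2 → ℝ≥0∞} {α F : ℝ} (hα0 : 0 < α) (hα : α ≤ π) (M : Measure ℝ) [SFinite M]
    (hF : 0 ≤ F) (heq : PolarEquation Q α F M) (hgI : ∀ t ∈ Ioo 0 α, IntervalIntegrable (gIntegrand Q t) volume 0 t)
    (hgd : ∀ t ∈ Ioo 0 α, DifferentiableAt ℝ (gIntegral Q) t) :
    ∀ᵐ t ∂(volume.restrict (Ioo 0 α)), (abelTransform M t).toReal = F * √(1 + cos t) - 4 * π * gFun Q t := by
  obtain ⟨-, hint, hval⟩ := integral_toReal_abelTransform hα0 hα M hF heq hgI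
  rw [ae_restrict_iff' measurableSet_Ioo]
  filter_upwards [hint.ae_hasDerivAt_integral] with τ hτd hτ
  have h1 := hτd (by rw [uIcc_of_le hα0.le]; exact Ioo_subset_Icc_self hτ) 0 left_mem_uIcc
  have hc : 0 < 1 - cos τ := (one_sub_cos_mem_Ioo hα hτ).1
  have h2 : HasDerivAt (fun τ => F * (2 * √(1 - cos τ)) - gIntegral Q τ)
      (F * √(1 + cos τ) - deriv (gIntegral Q) τ) τ := by
    refine (((((hasDerivAt_one_sub_cos τ).sqrt hc.ne').const_mul 2).const_mul F).sub (hgd τ hτ).hasDerivAt).congr_deriv ?_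
    congr 2
    have hs : sin τ = √(1 - cos τ) * √(1 + cos τ) := by
      rw [← Real.sqrt_mul hc.le, show (1 - cos τ) * (1 + cos τ) = sin τ ^ 2 by
        have := sin_sq_add_cos_sq τ; linarith, Real.sqrt_sq (sin_nonneg_of_mem_Ioo le_rfl hα hτ)]
    have := Real.sqrt_pos.2 hc
    rw [hs]; field_simp
  have h3 := h1.unique (h2.congr_of_eventuallyEq (by
    filter_upwards [isOpen_Ioo.mem_nhds hτ] with y hy using hval y hy))
  rw [h3]
  unfold gFun
  have := pi_pos
  field_simp

/-- The function `g` is integrable up to both end points. This is not evident from its definition; it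
follows from integrability of the Abel transform of the polar law. -/
theorem intervalIntegrable_gFun {Q : S2 → ℝ≥0∞} {α F : ℝ} (hα0 : 0 < α) (M : Measure ℝ)
    (hS : IntervalIntegrable (fun t => (abelTransform M t).toReal) volume 0 α)
    (hSeq : ∀ᵐ t ∂(volume.restrict (Ioo 0 α)), (abelTransform M t).toReal = F * √(1 + cos t) - 4 * π * gFun Q t) :
    IntervalIntegrable (gFun Q) volume 0 α := by
  have h1 : IntervalIntegrable (fun t => F * √(1 + cos t)) volume 0 α :=
    Continuous.intervalIntegrable (by fun_prop) _ _
  have h2 := (h1.sub hS).const_mul (1 / (4 * π))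
  rw [intervalIntegrable_iff_integrableOn_Ioo_of_le hα0.le] at h2 ⊢
  refine h2.congr ?_
  filter_upwards [hSeq] with t ht
  rw [ht]
  have := pi_pos
  field_simp
  ring

/-- The right inversion of the equilibrium condition: the tail of the polar law is the right Abel transform of
`F √(1 + cos t) - 4 π g(t)`. -/
theorem FIntegrand_integral {Q : S2 → ℝ≥0∞} {α F : ℝ} (hα : α ≤ π) (M : Measure ℝ) [IsFiniteMeasure M]
    (hM : ∀ᵐ ψ ∂M, ψ ≤ α)
    (hSf : ∀ᵐ t ∂(volume.restrict (Ioo 0 α)), abelTransform M t < ∞)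
    (hSeq : ∀ᵐ t ∂(volume.restrict (Ioo 0 α)), (abelTransform M t).toReal = F * √(1 + cos t) - 4 * π * gFun Q t)
    {φ : ℝ} (h0 : 0 ≤ φ) (hφ : φ < α) :
    IntervalIntegrable (FIntegrand Q φ) volume φ α ∧
      π * M.real (Ioi φ) = F * capTransform α φ - 4 * π * FIntegral Q α φ := by
  have h1 := lintegral_abel_right_inversion M h0 hα hM
  have hw0 : ∀ t ∈ Ioo φ α, 0 ≤ sin t / √(cos φ - cos t) := fun t ht =>
    div_nonneg (sin_nonneg_of_mem_Ioo h0 hα ht) (Real.sqrt_nonneg _)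
  have hSf' := ae_restrict_of_ae_restrict_of_subset (Ioo_subset_Ioo_left h0) hSf
  have hSeq' := ae_restrict_of_ae_restrict_of_subset (Ioo_subset_Ioo_left h0) hSeq
  have hmeas : AEMeasurable (fun t => abelTransform M t * ENNReal.ofReal (sin t / √(cos φ - cos t))) (volume.restrict (Ioo φ α)) :=
    ((measurable_abelTransform M).mul (by fun_prop)).aemeasurable
  have hfin : ∫⁻ t in Ioo φ α, abelTransform M t * ENNReal.ofReal (sin t / √(cos φ - cos t)) ≠ ∞ := by
    rw [h1]; exact ENNReal.mul_ne_top ENNReal.ofReal_ne_top (measure_ne_top _ _)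
  have h2 := integrable_toReal_of_lintegral_ne_top hmeas hfin
  have h3 := integral_toReal hmeas (ae_lt_top' hmeas hfin)
  have hcongr : ∀ᵐ t ∂(volume.restrict (Ioo φ α)),
      (abelTransform M t * ENNReal.ofReal (sin t / √(cos φ - cos t))).toReal =
        F * (√(1 + cos t) * sin t / √(cos φ - cos t)) - 4 * π * FIntegrand Q φ t := by
    filter_upwards [hSeq', ae_restrict_mem measurableSet_Ioo] with t ht htm
    rw [ENNReal.toReal_mul, ENNReal.toReal_ofReal (hw0 t htm), ht]
    unfold FIntegrand
    ring
  have h4 : IntegrableOn (fun t => F * (√(1 + cos t) * sin t / √(cos φ - cos t)) - 4 * π * FIntegrand Q φ t) (Ioo φ α) :=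
    h2.congr hcongr
  rw [integral_congr_ae hcongr, h1] at h3
  have hcap := integral_capTransform h0 hφ hα
  have h5 : IntervalIntegrable (FIntegrand Q φ) volume φ α := by
    have h6 := (((intervalIntegrable_iff_integrableOn_Ioo_of_le hφ.le).1 hcap.1).const_mul F).sub h4
    rw [intervalIntegrable_iff_integrableOn_Ioo_of_le hφ.le]
    refine (h6.const_mul (1 / (4 * π))).congr (ae_of_all _ fun t => ?_)
    simp only [Pi.sub_apply]
    have := pi_pos
    field_simp
    ring
  refine ⟨h5, ?_⟩
  rw [← integral_Ioc_eq_integral_Ioo, ← intervalIntegral.integral_of_le hφ.le,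
    intervalIntegral.integral_sub (hcap.1.const_mul F) (h5.const_mul (4 * π)),
    intervalIntegral.integral_const_mul, intervalIntegral.integral_const_mul, hcap.2] at h3
  rw [show FIntegral Q α φ = ∫ t in φ..α, FIntegrand Q φ t from rfl, h3, ENNReal.toReal_mul, ENNReal.toReal_ofReal pi_pos.le]
  rfl

theorem continuousOn_capTransform {α : ℝ} (h0 : 0 < α) (hα : α ≤ π) : ContinuousOn (capTransform α) (Icc 0 α) := by
  rcases eq_or_lt_of_le hα with rfl | hlt
  · have : ∀ φ ∈ Icc 0 π, capTransform π φ = (1 + cos φ) * (π / 2) := by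
      intro φ hφ
      unfold capTransform
      rw [cos_pi, show cos φ - -1 = 1 + cos φ by ring]
      rcases eq_or_ne (1 + cos φ) 0 with h | h
      · rw [h]; simp
      · rw [div_self h]; simp
    exact ContinuousOn.congr (by fun_prop) this
  · unfold capTransform
    refine ContinuousOn.add (by fun_prop) (ContinuousOn.mul (by fun_prop) ?_)
    refine continuous_arcsin.comp_continuousOn (ContinuousOn.sqrt (ContinuousOn.div (by fun_prop) (by fun_prop) ?_))
    intro φ hφ
    have := cos_lt_cos_of_mem hφ.1 (hφ.2.trans_lt hlt) le_rfl
    rw [cos_pi] at this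
    linarith

theorem continuous_measureReal_Ioi (M : Measure ℝ) [IsFiniteMeasure M] [NullSingletonClass M] :
    Continuous fun φ => M.real (Ioi φ) := by
  have h1 : ∀ φ, M.real (Ioi φ) = ∫ x, (Ioi φ).indicator (fun _ => (1 : ℝ)) x ∂M := fun φ => by
    rw [integral_indicator measurableSet_Ioi]; simp
  simp_rw [h1]
  refine continuous_iff_continuousAt.2 fun φ₀ => ?_
  refine continuousAt_of_dominated (bound := fun _ => 1) (.of_forall fun φ => ?_) (.of_forall fun φ => ae_of_all _ fun x => ?_)
    (integrable_const 1) ?_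
  · exact (measurable_const.indicator measurableSet_Ioi).aestronglyMeasurable
  · by_cases h : x ∈ Ioi φ <;> simp [h]
  · have : ∀ᵐ x ∂M, x ≠ φ₀ := by rw [ae_iff]; simp
    filter_upwards [this] with x hx
    rcases hx.lt_or_gt with h | h
    · refine continuousAt_const.congr (f := fun _ => (0 : ℝ)) ?_
      filter_upwards [Ioi_mem_nhds h] with φ hφ
      rw [Set.indicator_of_notMem]
      exact fun h' : φ < x => lt_asymm h' hφ
    · refine continuousAt_const.congr (f := fun _ => (1 : ℝ)) ?_
      filter_upwards [Iio_mem_nhds h] with φ hφ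
      rw [Set.indicator_of_mem]
      exact hφ

/-- Differentiating the tail of the polar law gives its density. The density is nonnegative as the tail is
monotone, and the total mass `1` determines the constant `F`. -/
theorem polar_law_eq {Q : S2 → ℝ≥0∞} {α F : ℝ} (hα0 : 0 < α) (hα : α ≤ π) (M : Measure ℝ) [IsProbabilityMeasure M] [NullSingletonClass M]
    (hM : ∀ᵐ ψ ∂M, ψ ∈ Ioo 0 α)
    (hW : ∀ φ, 0 ≤ φ → φ < α → π * M.real (Ioi φ) = F * capTransform α φ - 4 * π * FIntegral Q α φ)
    (hd : ∀ φ ∈ Ioo 0 α, DifferentiableAt ℝ (FIntegral Q α) φ) :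
    IntervalIntegrable (fun φ => FFun Q α φ * sin φ) volume 0 α ∧
    F = π / (sin α + α) * (1 - 2 * π * ∫ φ in 0..α, FFun Q α φ * sin φ) ∧
    (∀ φ ∈ Ioo 0 α, 0 ≤ densityFormula Q α F φ) ∧
    M = (volume.restrict (Ioo 0 α)).withDensity fun φ => ENNReal.ofReal (2 * π * (densityFormula Q α F φ * sin φ)) := by
  set W : ℝ → ℝ := fun φ => M.real (Ioi φ) with hWdef
  have hWc : Continuous W := continuous_measureReal_Ioi M
  have hsin : ∀ φ ∈ Ioo 0 α, 0 < sin φ := fun φ hφ => sin_pos_of_pos_of_lt_pi hφ.1 (hφ.2.trans_le hα)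
  have hW0 : W 0 = 1 := by
    simp only [hWdef]
    rw [measureReal_def, (prob_compl_eq_zero_iff measurableSet_Ioi).1]
    · simp
    · exact mem_ae_iff.1 (hM.mono fun x hx => hx.1)
  have hWα : W α = 0 := by
    simp only [hWdef]
    rw [measureReal_def, show M (Ioi α) = 0 from
      measure_mono_null (t := (Ioo 0 α)ᶜ) (fun x (hx : α < x) h => lt_asymm hx h.2) (mem_ae_iff.1 hM)]
    simp
  -- derivative of `FIntegral` in terms of `FFun`
  have hFd : ∀ φ ∈ Ioo 0 α, deriv (FIntegral Q α) φ = π / 2 * (FFun Q α φ * sin φ) := by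
    intro φ hφ
    have := hsin φ hφ
    have := pi_pos
    unfold FFun
    field_simp
  have hWd : ∀ φ ∈ Ioo 0 α, HasDerivAt (fun φ => - W φ) (2 * π * (densityFormula Q α F φ * sin φ)) φ := by
    intro φ hφ
    have h1 : HasDerivAt (fun φ => - ((F * capTransform α φ - 4 * π * FIntegral Q α φ) / π)) _ φ :=
      ((((hasDerivAt_capTransform hφ.1 hφ.2 hα).const_mul F).sub ((hd φ hφ).hasDerivAt.const_mul (4 * π))).div_const π).neg
    refine (h1.congr_of_eventuallyEq ?_).congr_deriv ?_
    · filter_upwards [isOpen_Ioo.mem_nhds hφ] with y hy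
      rw [← hW y hy.1.le hy.2, mul_div_cancel_left₀ _ pi_pos.ne']
    · rw [hFd φ hφ]
      unfold densityFormula
      have := pi_pos
      field_simp
      ring
  have hnn : ∀ φ ∈ Ioo 0 α, 0 ≤ densityFormula Q α F φ := by
    intro φ hφ
    have hmono : Monotone fun φ => - W φ := fun x y hxy =>
      neg_le_neg (measureReal_mono (Ioi_subset_Ioi hxy))
    have h1 := hmono.deriv_nonneg (x := φ)
    rw [(hWd φ hφ).deriv] at h1
    have h2 : 0 ≤ densityFormula Q α F φ * sin φ := nonneg_of_mul_nonneg_right h1 (by positivity)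
    exact nonneg_of_mul_nonneg_left h2 (hsin φ hφ)
  have hdens0 : ∀ φ ∈ Ioo 0 α, 0 ≤ 2 * π * (densityFormula Q α F φ * sin φ) := fun φ hφ =>
    mul_nonneg (by positivity) (mul_nonneg (hnn φ hφ) (hsin φ hφ).le)
  have hdens := fun b (hb : b ∈ Icc 0 α) => lintegral_Ioo_deriv_of_nonneg hb.1 (g := fun φ => - W φ) (by fun_prop)
    (fun φ hφ => hWd φ ⟨hφ.1, hφ.2.trans_le hb.2⟩) (fun φ hφ => hdens0 φ ⟨hφ.1, hφ.2.trans_le hb.2⟩)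
  have hcap := lintegral_Ioo_deriv_of_nonneg hα0.le (g := fun φ => - capTransform α φ)
    (f := fun φ => sin φ * (√((1 + cos α) / (cos φ - cos α)) + (π / 2 - arctan √((1 + cos α) / (cos φ - cos α)))))
    (continuousOn_capTransform hα0 hα).neg
    (fun φ hφ => (hasDerivAt_capTransform hφ.1 hφ.2 hα).neg.congr_deriv (by ring))
    (fun φ hφ => mul_nonneg (hsin φ hφ).le (add_nonneg (Real.sqrt_nonneg _)
      (sub_nonneg.2 (arctan_lt_pi_div_two _).le)))
  obtain ⟨hd1, hd2, -⟩ := hdens α ⟨hα0.le, le_rfl⟩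
  have hFeq : ∀ φ, FFun Q α φ * sin φ = 1 / (2 * π) * (2 * π * (densityFormula Q α F φ * sin φ)) - F / (2 * π ^ 2) *
      (sin φ * (√((1 + cos α) / (cos φ - cos α)) + (π / 2 - arctan √((1 + cos α) / (cos φ - cos α))))) := by
    intro φ
    unfold densityFormula
    have := pi_pos
    field_simp
    ring
  refine ⟨?_, ?_, hnn, ?_⟩
  · simp_rw [hFeq]
    exact (hd1.const_mul _).sub (hcap.1.const_mul _)
  · have hval : ∫ φ in 0..α, FFun Q α φ * sin φ = 1 / (2 * π) * (-W α - -W 0) -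
        F / (2 * π ^ 2) * (-capTransform α α - -capTransform α 0) := by
      rw [← hd2, ← hcap.2.1, ← intervalIntegral.integral_const_mul (1 / (2 * π)),
        ← intervalIntegral.integral_const_mul (F / (2 * π ^ 2)),
        ← intervalIntegral.integral_sub (hd1.const_mul _) (hcap.1.const_mul _)]
      exact intervalIntegral.integral_congr fun φ _ => hFeq φ
    rw [hval, hW0, hWα, capTransform_zero hα0.le hα]
    have h1 : capTransform α α = 0 := by simp [capTransform]
    rw [h1]
    have : 0 ≤ sin α := sin_nonneg_of_nonneg_of_le_pi hα0.le hα
    have h2 : 0 < sin α + α := by linarith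
    have := pi_pos
    field_simp
    ring
  · refine Measure.ext_of_Iic _ _ fun b => ?_
    -- both measures live on `(0, α)`, so `b` may be moved to the nearest point of `[0, α]`
    set b' := max 0 (min b α) with hb'
    have hb'm : b' ∈ Icc 0 α := ⟨le_max_left _ _, max_le hα0.le (min_le_right _ _)⟩
    have hsetae : ∀ x ∈ Ioo 0 α, (x ∈ Iic b ↔ x ≤ b') := by
      intro x hx
      simp only [hb', mem_Iic, le_max_iff, le_min_iff]
      constructor
      · exact fun h => Or.inr ⟨h, hx.2.le⟩
      · rintro (h | h)
        · exact absurd hx.1 (not_lt.2 h)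
        · exact h.1
    have hL : M (Iic b) = ENNReal.ofReal (W 0 - W b') := by
      have h1 : M (Iic b) = M (Iic b') := measure_congr (by
        filter_upwards [hM] with x hx
        exact propext (hsetae x hx))
      rw [h1, hW0, ← compl_Ioi, ← ofReal_measureReal, measureReal_compl measurableSet_Ioi]
      simp [hWdef]
    rw [hL, withDensity_apply _ measurableSet_Iic, Measure.restrict_restrict measurableSet_Iic]
    have hset : (Iic b ∩ Ioo 0 α : Set ℝ) =ᵐ[volume] Ioo 0 b' := by
      have h3 : ∀ᵐ x : ℝ, x ≠ b' := by rw [ae_iff]; simp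
      filter_upwards [h3] with x hx
      refine propext ⟨fun h => ?_, fun h => ?_⟩
      · exact ⟨h.2.1, lt_of_le_of_ne ((hsetae x h.2).1 h.1) hx⟩
      · have : x ∈ Ioo 0 α := ⟨h.1, h.2.trans_le hb'm.2⟩
        exact ⟨(hsetae x this).2 h.2.le, this⟩
    rw [setLIntegral_congr hset, (hdens b' hb'm).2.2]
    congr 1; ring

/-! ### The equilibrium measure of a cap -/

theorem isClosed_northCap {α : ℝ} (hα : α ≤ π) : IsClosed (northCap α) := by
  rw [show northCap α = {x | polar x ≤ α} from Set.ext fun x => mem_northCap_iff hα x]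
  exact isClosed_le continuous_polar continuous_const

theorem sph_mem_northCap_iff {α : ℝ} (hα : α ≤ π) (θ φ : ℝ) : sph θ φ ∈ northCap α ↔ sph 0 φ ∈ northCap α := by
  rw [mem_northCap_iff hα, mem_northCap_iff hα]
  unfold polar
  rw [sph_two, sph_two]

theorem sph_mem_northCap {α : ℝ} (hα : α ≤ π) (θ : ℝ) {φ : ℝ} (hφ : φ ∈ Icc 0 α) : sph θ φ ∈ northCap α := by
  rw [mem_northCap_iff hα, polar_sph θ ⟨hφ.1, hφ.2.trans hα⟩]
  exact hφ.2

theorem rot_mem_northCap {α : ℝ} (hα : α ≤ π) (θ : ℝ) {x : S2} (hx : x ∈ northCap α) : rot θ x ∈ northCap α := by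
  rw [mem_northCap_iff hα] at hx ⊢
  unfold polar at *
  rwa [rot_two]

/-- The mass of a rotation invariant set is the mass of its meridian section under the polar law. -/
theorem revolve_apply_of_rot (M : Measure ℝ) [SFinite M] {A : Set S2} (hA : MeasurableSet A)
    (hr : ∀ θ φ, sph θ φ ∈ A ↔ sph 0 φ ∈ A) : revolve M A = M {φ | sph 0 φ ∈ A} := by
  have hs : Measurable fun φ => sph 0 φ := (continuous_sph.comp (Continuous.prodMk_right 0)).measurable
  have hm : MeasurableSet {φ | sph 0 φ ∈ A} := hs hA
  rw [← lintegral_indicator_one hA, lintegral_revolve M (measurable_one.indicator hA), ← lintegral_indicator_one hm]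
  refine lintegral_congr fun φ => ?_
  rw [parallelMean_of_rot fun θ φ => ?_]
  · rfl
  · by_cases h : sph 0 φ ∈ A
    · rw [indicator_of_mem h, indicator_of_mem ((hr θ φ).2 h)]; rfl
    · rw [indicator_of_notMem h, indicator_of_notMem (mt (hr θ φ).1 h)]

theorem restrict_absolutelyContinuous_capLaw {α : ℝ} (hα : α ≤ π) : volume.restrict (Ioo 0 α) ≪ capLaw α := by
  refine withDensity_absolutelyContinuous' (by fun_prop) ?_
  refine ae_restrict_of_forall_mem measurableSet_Ioo fun φ hφ => ?_
  simpa using sin_pos_of_pos_of_lt_pi hφ.1 (hφ.2.trans_le hα)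

theorem revolve_capLaw_compl {α : ℝ} (hα : α ≤ π) : revolve (capLaw α) (northCap α)ᶜ = 0 := by
  rw [revolve_apply_of_rot _ (isClosed_northCap hα).measurableSet.compl
    fun θ φ => not_congr (sph_mem_northCap_iff hα θ φ)]
  refine measure_mono_null (t := (Ioo 0 α)ᶜ) (fun φ (hφ : sph 0 φ ∉ northCap α) h => ?_) (mem_ae_iff.1 (ae_capLaw_mem α))
  exact hφ (sph_mem_northCap hα 0 (Ioo_subset_Icc_self h))

theorem minEnergy_lt_top {E : Set S2} {Q : S2 → ℝ≥0∞} {α : ℝ} (hα0 : 0 < α) (hα : α ≤ π)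
    (hE : northCap α ⊆ E) {C : ℝ≥0∞} (hC : C ≠ ∞) (hQ : ∀ x ∈ northCap α, Q x ≤ C) : minEnergy E Q < ∞ := by
  set ρ := revolve (capLaw α) with hρ
  have h0 : ρ univ ≠ 0 := by
    rw [hρ, revolve_univ]
    intro h
    have := restrict_absolutelyContinuous_capLaw hα h
    simp only [Measure.restrict_apply_univ, Real.volume_Ioo, sub_zero, ENNReal.ofReal_eq_zero] at this
    linarith
  have hc : (ρ univ)⁻¹ ≠ ∞ := ENNReal.inv_ne_top.2 h0
  -- the competitor is the normalized surface measure of the cap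
  set ν := (ρ univ)⁻¹ • ρ with hν
  have hνS : ν (northCap α)ᶜ = 0 := by rw [hν, Measure.smul_apply, revolve_capLaw_compl hα, smul_zero]
  have hprob : IsProbabilityMeasure ν := ⟨by
    rw [hν, Measure.smul_apply, smul_eq_mul, ENNReal.inv_mul_cancel h0 (measure_ne_top _ _)]⟩
  refine (minEnergy_le Q (ν := ν) ⟨hprob, (support_subset_of_measure_compl (isClosed_northCap hα) hνS).trans hE⟩).trans_lt ?_
  have h1 : energy ν ≠ ∞ := by
    rw [energy_eq_mutualEnergy, hν, mutualEnergy_smul_left, mutualEnergy_smul_right, ← energy_eq_mutualEnergy]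
    exact ENNReal.mul_ne_top hc (ENNReal.mul_ne_top hc (energy_revolve_capLaw hα))
  have h2 : ∫⁻ x, Q x ∂ν ≤ C := by
    calc ∫⁻ x, Q x ∂ν ≤ ∫⁻ _, C ∂ν := by
          refine lintegral_mono_ae ?_
          filter_upwards [mem_ae_iff.2 hνS] with x hx using hQ x hx
      _ = C := by simp
  exact lt_top_iff_ne_top.2 (ENNReal.add_ne_top.2 ⟨h1, ENNReal.mul_ne_top (by simp) (ne_top_of_le_ne_top hC h2)⟩)

theorem contDiffOn_profile {Q : S2 → ℝ≥0∞} {N : Set S2} (hC2 : IsC2On Q N) {s : Set ℝ}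
    (hs : ∀ ξ ∈ s, sph 0 ξ ∈ N) : ContDiffOn ℝ 2 (profile Q) s := by
  have : Fact (Module.finrank ℝ (EuclideanSpace ℝ (Fin 3)) = 2 + 1) := ⟨by simp⟩
  have h1 : ContMDiff 𝓘(ℝ, ℝ) 𝓘(ℝ, EuclideanSpace ℝ (Fin 3)) 2 fun ξ : ℝ => (sph 0 ξ).1 := by
    rw [contMDiff_iff_contDiff, contDiff_euclidean]
    intro i
    fin_cases i
    · simpa [sph] using contDiff_sin.of_le le_top
    · simpa [sph] using contDiff_const
    · simpa [sph] using contDiff_cos.of_le le_top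
  have h2 : ContMDiff 𝓘(ℝ, ℝ) (𝓡 2) 2 fun ξ : ℝ => sph 0 ξ := h1.codRestrict_sphere fun ξ => (sph 0 ξ).2
  exact contMDiffOn_iff_contDiffOn.1 (hC2.2.comp h2.contMDiffOn hs)

theorem IsC2On.continuousOn {Q : S2 → ℝ≥0∞} {N : Set S2} (hC2 : IsC2On Q N) : ContinuousOn Q N :=
  (ENNReal.continuous_ofReal.comp_continuousOn hC2.2.continuousOn).congr fun x hx =>
    (ENNReal.ofReal_toReal (hC2.1 x hx).ne).symm

theorem ae_potential_add_eq {E : Set S2} {Q Q₀ : S2 → ℝ≥0∞} {μ : Measure S2} (hμ : IsExtremal E Q μ)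
    (he : energy μ ≠ ∞) (hq : ∫⁻ x, Q x ∂μ ≠ ∞) (hQ₀ : Measurable Q₀) (hQQ : ∀ x ∈ μ.support, Q₀ x = Q x) :
    ∀ᵐ x ∂μ, potential μ x + Q x = energy μ + ∫⁻ x, Q x ∂μ := by
  have := hμ.1.1
  have h1 := measure_potential_lt_eq_zero hμ he hq hQ₀ hQQ Measure.measure_compl_support he
  have hle : (fun _ => energy μ + ∫⁻ x, Q x ∂μ) ≤ᵐ[μ] fun x => potential μ x + Q₀ x := by
    filter_upwards [measure_eq_zero_iff_ae_notMem.1 h1] with x hx using not_lt.1 hx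
  have hQae : ∀ᵐ x ∂μ, Q₀ x = Q x := by
    filter_upwards [Measure.support_mem_ae (μ := μ)] with x hx using hQQ x hx
  have h2 := ae_eq_of_ae_le_of_lintegral_le hle (by simp [he, hq])
    ((measurable_potential μ).add hQ₀).aemeasurable (by
      rw [lintegral_add_left (measurable_potential μ), lintegral_congr_ae hQae, lintegral_const, measure_univ, mul_one]
      exact le_of_eq rfl)
  filter_upwards [h2, hQae] with x hx hx'
  rw [← hx', hx]

theorem capMeasure_eq_revolve (α : ℝ) {f : ℝ → ℝ} (hf : Measurable f) :
    capMeasure α f = revolve ((volume.restrict (Ioo 0 α)).withDensity fun φ => ENNReal.ofReal (2 * π * (f φ * sin φ))) := by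
  unfold capMeasure revolve
  congr 1
  have hm : Measurable fun φ => ENNReal.ofReal (2 * π * (f φ * sin φ)) := by fun_prop
  have hm' : Measurable fun p : ℝ × ℝ => ENNReal.ofReal (2 * π * (f p.2 * sin p.2)) := by fun_prop
  rw [prod_withDensity_right hm, Measure.prod_smul_left, Measure.prod_restrict, withDensity_smul_measure,
    ← withDensity_smul _ hm', ← Measure.volume_eq_prod]
  congr 1
  funext p
  rw [Pi.smul_apply, smul_eq_mul, ENNReal.ofReal_mul (p := 2 * π) (by positivity), ← mul_assoc,
    ENNReal.inv_mul_cancel ofReal_two_pi_ne.1 ofReal_two_pi_ne.2, one_mul]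

theorem measurable_densityFormula (Q : S2 → ℝ≥0∞) (α c : ℝ) : Measurable (densityFormula Q α c) := by
  unfold densityFormula FFun
  have := measurable_deriv (FIntegral Q α)
  have h := measurable_arctan
  fun_prop

theorem contDiffOn_gIntegral {Q : S2 → ℝ≥0∞} {N : Set S2} (hC2 : IsC2On Q N) {α : ℝ} (hα0 : 0 < α) (hα : α ≤ π)
    (hN : northCap α ⊆ N) {C : ℝ} (hC0 : 0 ≤ C) (hC : ∀ x ∈ northCap α, Q x ≤ ENNReal.ofReal C) :
    (∀ t ∈ Ioo 0 α, IntervalIntegrable (gIntegrand Q t) volume 0 t) ∧ ContDiffOn ℝ 2 (gIntegral Q) (Ioo 0 α) := by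
  have hmem : ∀ ξ ∈ Ioo 0 α, sph 0 ξ ∈ northCap α := fun ξ hξ => sph_mem_northCap hα 0 (Ioo_subset_Icc_self hξ)
  refine gIntegral_regularity (C := C) hα0 hα (contDiffOn_profile hC2 fun ξ hξ => hN (hmem ξ hξ)) fun ξ hξ => ?_
  unfold profile
  rw [abs_of_nonneg ENNReal.toReal_nonneg]
  exact ENNReal.toReal_le_of_le_ofReal hC0 (hC _ (hmem ξ hξ))

theorem exists_bound_of_isC2On {Q : S2 → ℝ≥0∞} {N K : Set S2} (hC2 : IsC2On Q N) (hK : IsCompact K) (hKN : K ⊆ N) :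
    ∃ C : ℝ, 0 ≤ C ∧ ∀ x ∈ K, Q x ≤ ENNReal.ofReal C := by
  obtain ⟨C, hC⟩ := hK.exists_bound_of_continuousOn (hC2.2.continuousOn.mono hKN)
  refine ⟨max C 0, le_max_right _ _, fun x hx => ?_⟩
  rw [← ENNReal.ofReal_toReal (hC2.1 x (hKN hx)).ne]
  exact ENNReal.ofReal_le_ofReal ((le_abs_self _).trans ((hC x hx).trans (le_max_left _ _)))

/-- The extremal measure is the measure of revolution of a polar law on `(0, α)` that has no atoms and
satisfies the equilibrium condition with the constant `I(μ) + ∫ Q dμ`. -/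
theorem exists_polar_law {E : Set S2} {Q : S2 → ℝ≥0∞} (hrot : RotInvariant E Q) {μ : Measure S2}
    (hμ : IsExtremal E Q μ) {N : Set S2} (hSN : μ.support ⊆ N) (hC2 : IsC2On Q N) {α : ℝ} (hα : α ≤ π)
    (hS : μ.support = northCap α) (he : energy μ ≠ ∞) (hq : ∫⁻ x, Q x ∂μ ≠ ∞) :
    ∃ M : Measure ℝ, IsProbabilityMeasure M ∧ NullSingletonClass M ∧ (∀ᵐ φ ∂M, φ ∈ Ioo 0 α) ∧ μ = revolve M ∧
      PolarEquation Q α (energy μ + ∫⁻ x, Q x ∂μ).toReal M := by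
  have := hμ.1.1
  have hcapE : northCap α ⊆ E := hS ▸ hμ.1.2
  have hcapN : northCap α ⊆ N := hS ▸ hSN
  have hI : energy μ + ∫⁻ x, Q x ∂μ ≠ ∞ := ENNReal.add_ne_top.2 ⟨he, hq⟩
  -- a Borel measurable, rotation invariant field that agrees with `Q` on the cap
  set Q₀ : S2 → ℝ≥0∞ := (northCap α).indicator Q with hQ₀def
  have hQQ : ∀ x ∈ northCap α, Q₀ x = Q x := fun x hx => indicator_of_mem hx Q
  have hQ₀ : Measurable Q₀ := by
    classical
    rw [hQ₀def, ← piecewise_eq_indicator]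
    exact (hC2.continuousOn.mono hcapN).measurable_piecewise continuousOn_const (isClosed_northCap hα).measurableSet
  have hQ₀rot : ∀ θ φ, Q₀ (sph θ φ) = Q₀ (sph 0 φ) := by
    intro θ φ
    by_cases h : sph 0 φ ∈ northCap α
    · have h' := (sph_mem_northCap_iff hα θ φ).2 h
      rw [hQQ _ h, hQQ _ h']
      exact hrot _ (hcapE h') _ (hcapE h) (by rw [sph_two, sph_two])
    · rw [hQ₀def, indicator_of_notMem h, indicator_of_notMem (mt (sph_mem_northCap_iff hα θ φ).1 h)]
  have hμrot := map_rot_eq_of_isExtremal hμ he hq (by rw [hS]; exact fun θ x hx => rot_mem_northCap hα θ hx) hrot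
  set M := μ.map polar with hM
  have hMp : IsProbabilityMeasure M := Measure.isProbabilityMeasure_map continuous_polar.measurable.aemeasurable
  have hμM : μ = revolve M := eq_revolve_of_rot_invariant μ hμrot
  have hpot : ∀ θ φ, potential μ (sph θ φ) = potential μ (sph 0 φ) := by
    rw [hμM]; exact potential_revolve_sph M
  have hle : ∀ x ∈ northCap α, potential μ x + Q x ≤ energy μ + ∫⁻ x, Q x ∂μ := fun x hx =>
    potential_add_le_of_mem_support hSN hC2.continuousOn (fun x hx => (hC2.1 x hx).ne) hI
      (ae_potential_add_eq hμ he hq hQ₀ (hS ▸ hQQ)) (hS ▸ hx)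
  have hMcap : ∀ᵐ φ ∂M, φ ∈ Icc 0 α := by
    refine (ae_map_iff (p := fun φ => φ ∈ Icc 0 α) continuous_polar.measurable.aemeasurable measurableSet_Icc).2 ?_
    filter_upwards [Measure.support_mem_ae (μ := μ)] with x hx
    rw [hS, mem_northCap_iff hα] at hx
    exact ⟨(polar_mem x).1, hx⟩
  have hatom : NullSingletonClass M := ⟨fun φ => by
    by_cases hφ : φ ∈ Icc 0 α
    · refine measure_singleton_eq_zero_of_potential M (ne_top_of_le_ne_top hI ?_)
      rw [← hμM]
      exact le_self_add.trans (hle _ (sph_mem_northCap hα 0 hφ))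
    · refine measure_mono_null (singleton_subset_iff.2 ?_) (mem_ae_iff.1 hMcap)
      exact hφ⟩
  have hMioo : ∀ᵐ φ ∂M, φ ∈ Ioo 0 α := by
    have h0 : ∀ᵐ φ ∂M, φ ≠ 0 := by rw [ae_iff]; simp
    have h1 : ∀ᵐ φ ∂M, φ ≠ α := by rw [ae_iff]; simp
    filter_upwards [hMcap, h0, h1] with φ hφ h0 h1 using ⟨lt_of_le_of_ne hφ.1 h0.symm, lt_of_le_of_ne hφ.2 h1⟩
  refine ⟨M, hMp, hatom, hMioo, hμM, ?_⟩
  -- the inequality that holds off a set of zero capacity holds almost everywhere on the cap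
  have hge : ∀ᵐ φ ∂(volume.restrict (Ioo 0 α)),
      energy μ + ∫⁻ x, Q x ∂μ ≤ potential μ (sph 0 φ) + Q₀ (sph 0 φ) := by
    have h1 := measure_potential_lt_eq_zero hμ he hq hQ₀ (hS ▸ hQQ) (ν := revolve (capLaw α))
      (by rw [hS]; exact revolve_capLaw_compl hα) (energy_revolve_capLaw hα)
    have hsum : Measurable fun x => potential μ x + Q₀ x := (measurable_potential μ).add hQ₀
    rw [revolve_apply_of_rot _ (measurableSet_lt hsum measurable_const)
      fun θ φ => by rw [mem_ofPred_eq, mem_ofPred_eq, hpot θ φ, hQ₀rot θ φ]] at h1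
    filter_upwards [measure_eq_zero_iff_ae_notMem.1 (restrict_absolutelyContinuous_capLaw hα h1)] with φ hφ
      using not_lt.1 hφ
  unfold PolarEquation
  filter_upwards [hge, ae_restrict_mem measurableSet_Ioo] with ξ hξ hξm
  have hmem := sph_mem_northCap hα 0 (Ioo_subset_Icc_self hξm)
  rw [← potential_revolve M (hMioo.mono fun φ hφ => ⟨hφ.1, hφ.2.trans_le hα⟩) ⟨hξm.1, hξm.2.trans_le hα⟩ (by simp), ← hμM,
    ENNReal.ofReal_toReal hI, profile, ENNReal.ofReal_toReal (hC2.1 _ (hcapN hmem)).ne]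
  rw [hQQ _ hmem] at hξ
  exact le_antisymm (hle _ hmem) hξ

end SphereEnergy

theorem theorem2
    (E : Set SphereEnergy.S2) (hE : IsCompact E)
    (Q : SphereEnergy.S2 → ℝ≥0∞) (hQ : SphereEnergy.IsExternalField E Q)
    (hrot : SphereEnergy.RotInvariant E Q)
    (μ : Measure SphereEnergy.S2) (hμ : SphereEnergy.IsExtremal E Q μ)
    (N : Set SphereEnergy.S2) (hN : IsOpen N) (hSN : μ.support ⊆ N)
    (hC2 : SphereEnergy.IsC2On Q N)
    (α : ℝ) (hα0 : 0 < α) (hαπ : α ≤ π) (hS : μ.support = SphereEnergy.northCap α) :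
    -- the quantities that define `F_Q` are finite
    (SphereEnergy.minEnergy E Q < ⊤ ∧ ∫⁻ x, Q x ∂μ < ⊤) ∧
    -- `g` is well defined
    (∀ t ∈ Ioo 0 α,
      IntervalIntegrable (SphereEnergy.gIntegrand Q t) volume 0 t ∧
      DifferentiableAt ℝ (SphereEnergy.gIntegral Q) t) ∧
    -- `F` is well defined
    (∀ φ ∈ Ioo 0 α,
      IntervalIntegrable (SphereEnergy.FIntegrand Q φ) volume φ α ∧
      DifferentiableAt ℝ (SphereEnergy.FIntegral Q α) φ) ∧
    IntervalIntegrable (fun φ => SphereEnergy.FFun Q α φ * sin φ) volume 0 α ∧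
    -- the constant `F_Q`
    SphereEnergy.robin E Q μ =
      π / (sin α + α) * (1 - 2 * π * ∫ φ in (0 : ℝ)..α, SphereEnergy.FFun Q α φ * sin φ) ∧
    -- the density of the equilibrium measure
    (∀ φ ∈ Ioo 0 α,
      0 ≤ SphereEnergy.densityFormula Q α (SphereEnergy.robin E Q μ) φ) ∧
    μ = SphereEnergy.capMeasure α
      (SphereEnergy.densityFormula Q α (SphereEnergy.robin E Q μ)) := by
  open SphereEnergy in
  have hcapE : northCap α ⊆ E := hS ▸ hμ.1.2
  have hcapN : northCap α ⊆ N := hS ▸ hSN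
  obtain ⟨C, hC0, hC⟩ := exists_bound_of_isC2On hC2 (isClosed_northCap hαπ).isCompact hcapN
  have hmin : minEnergy E Q < ⊤ := minEnergy_lt_top hα0 hαπ hcapE ENNReal.ofReal_ne_top hC
  have hw : energy μ + 2 * ∫⁻ x, Q x ∂μ = minEnergy E Q := hμ.2
  have hsum := hmin.ne
  rw [← hw] at hsum
  obtain ⟨he, hq2⟩ := ENNReal.add_ne_top.1 hsum
  have hq : ∫⁻ x, Q x ∂μ ≠ ⊤ := fun h => hq2 (by rw [h]; simp)
  have hF : robin E Q μ = (energy μ + ∫⁻ x, Q x ∂μ).toReal := by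
    unfold robin
    rw [← hw, ENNReal.toReal_add he hq2, ENNReal.toReal_mul, ENNReal.toReal_add he hq, ENNReal.toReal_ofNat]
    ring
  have hF0 : 0 ≤ robin E Q μ := hF ▸ ENNReal.toReal_nonneg
  obtain ⟨M, hMp, hatom, hM, hμM, heq⟩ := exists_polar_law hrot hμ hSN hC2 hαπ hS he hq
  rw [← hF] at heq
  obtain ⟨hgI, hg2⟩ := contDiffOn_gIntegral hC2 hα0 hαπ hcapN hC0 hC
  have hgd : ∀ t ∈ Ioo 0 α, DifferentiableAt ℝ (gIntegral Q) t := fun t ht =>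
    (hg2.differentiableOn (by norm_num)).differentiableAt (isOpen_Ioo.mem_nhds ht)
  obtain ⟨hAf, hAi, -⟩ := integral_toReal_abelTransform hα0 hαπ M hF0 heq hgI
  have hAeq := toReal_abelTransform_eq hα0 hαπ M hF0 heq hgI hgd
  have hgi := intervalIntegrable_gFun hα0 M hAi hAeq
  have hFI := fun φ (h0 : 0 ≤ φ) (hφ : φ < α) =>
    FIntegrand_integral hαπ M (hM.mono fun ψ hψ => hψ.2.le) hAf hAeq h0 hφ
  have hFd := FIntegral_differentiable hα0 hαπ (contDiffOn_gFun hg2) hgi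
  obtain ⟨h1, h2, h3, h4⟩ := polar_law_eq hα0 hαπ M hM (fun φ h0 hφ => (hFI φ h0 hφ).2) hFd
  refine ⟨⟨hmin, hq.lt_top⟩, fun t ht => ⟨hgI t ht, hgd t ht⟩, fun φ hφ => ⟨(hFI φ hφ.1.le hφ.2).1, hFd φ hφ⟩,
    h1, h2, h3, ?_⟩
  rw [capMeasure_eq_revolve α (measurable_densityFormula Q α _), ← h4]
  exact hμM
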